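/- Let $\Theta$ be a compact metric space, $T:\Theta\to\Theta$ a homeomorphism, $\mu$ a $T$-ergodic Borel probability measure on $\Theta$, and $m\ge 1$. Let $C\in \mathrm{GL}(m,\mathbb C)$ and let $f:\Theta\to \mathrm{Her}_m\mathbb C$ be a continuous map into the Hermitian $m\times m$ matrices. For $\theta\in\Theta$ let $H_\theta$ be the bounded self-adjoint operator on $\ell^2(\mathbb Z,\mathbb C^m)$ $$(H_\theta u)_n=C^*u_{n-1}+f(T^n\theta)u_n+Cu_{n+1}.$$ Its density of states measure $k$ is given by $\int g\,dk=\int_\Theta\frac1m\sum_{i=1}^m\langle\delta_{0,i},g(H_\theta)\delta_{0,i}\rangle\,d\mu(\theta)$ for bounded measurable $g$, where $\delta_{0,1},\dots,\delta_{0,m}\in\ell^2(\mathbb Z,\mathbb C^m)$ are the standard basis vectors supported at the site $0$. The integrated density of states is $\mathcal N(E)=k((-\infty,E])$. Let $\mathrm{HSp}(2m,\mathbb C)$ be the group of $M\in \mathrm{GL}(2m,\mathbb C)$ with $M^*JM=J$, $J=\begin{pmatrix}0&-I_m\\ I_m&0\end{pmatrix}$. It acts on the Lagrangian subspaces $\Lambda=\mathrm{range}\begin{pmatrix}X\\Y\end{pmatrix}$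 of $\mathbb C^{2m}$ (where $X,Y$ are $m\times m$ matrices, $X^*Y=Y^*X$ and $\begin{pmatrix}X\\Y\end{pmatrix}$ has rank $m$), and $\Lambda\mapsto W_\Lambda=(X+iY)(X-iY)^{-1}$ identifies these subspaces with the unitary group $\mathbf U(m)$. For a continuous $A:\Theta\to\mathrm{HSp}(2m,\mathbb C)$ let $(T,A)$ act on $\Theta\times\mathbf U(m)$ by $(\theta,W_\Lambda)\mapsto(T\theta,W_{A(\theta)\Lambda})$. A lift of $(T,A)$ is a continuous self-map $F$ of $\Theta\times\mathbb R\times\mathbf{SU}(m)$ that covers this action under the covering $(\theta,x,S)\mapsto(\theta,e^{2\pi ix}S)$. Write $p_2$ for the projection to $\mathbb R$ and $\mu(C(\Theta,\mathbb Z))=\{\int p\,d\mu: p\in C(\Theta,\mathbb Z)\}$. For $A$ homotopic to the identity lifts exist, and for every lift $F$ the function $m\,(p_2F(\theta,x,S)-x)$ descends to a continuous function $g$ on $\Theta\times\mathbf U(m)$. The fibered rotation number $\mathrm{rot}_f(T,A)\in\mathbb R/\mu(C(\Theta,\mathbb Z))$ is the class, the same for all lifts, of $$\lim_{n\to\infty}\frac1n\sum_{k=0}^{n-1}g\big((T,A)^k(\theta,W)\big)=\int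 g\,d\nu ,$$ where the limit exists for $\mu$-a.e. $\theta$ and all $W\in\mathbf U(m)$, and $\nu$ is any $(T,A)$-invariant Borel probability measure on $\Theta\times\mathbf U(m)$ that projects to $\mu$. For $E\in\mathbb R$ let $A_E=\begin{pmatrix}(E-f)C^{-1}&-C^*\\ C^{-1}&0\end{pmatrix}:\Theta\to\mathrm{HSp}(2m,\mathbb C)$, so that $(T,A_E)$ is the Schrödinger cocycle. A fibered rotation function of the family is a continuous branch of $E\mapsto\mathrm{rot}_f(T,A_E)$, that is, a continuous $\rho:\mathbb R\to\mathbb R$ with $\rho(E)\in\mathrm{rot}_f(T,A_E)$ for all $E$. **Theorem.** For every $E\in\mathbb R$ the map $A_E$ is homotopic to the identity and $\mathrm{rot}_f(T,A_E)$ is well defined as above. The function $E\mapsto m(1-\mathcal N(E))$ is a fibered rotation function of the family $(T,A_E)$, and for every fibered rotation function $\mathrm{rot}_f(E)$ there is a constant $c\in\mu(C(\Theta,\mathbb Z))$, independent of $E$, such that $$m\,(1-\mathcal N(E))=\mathrm{rot}_f(E)+c\qquad\text{for all }E\in\mathbb R .$$ In other words, $m(1-\mathcal N(E))=\mathrm{rot}_f(E)\bmod\mu(C(\Theta,\mathbb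 Z))$. -/

import Mathlib

open MeasureTheory Filter Topology
open scoped Matrix CompactlySupported ENNReal

noncomputable section

namespace StripSchrodinger

/-! ### Hermitian symplectic matrices and Lagrangian frames -/

/-- The Hermitian symplectic group `HSp(2m, ℂ)` inside the `2m × 2m` matrices, where
`Matrix.J` is `[[0, -1], [1, 0]]`. -/
def HSp (m : ℕ) : Set (Matrix (Fin m ⊕ Fin m) (Fin m ⊕ Fin m) ℂ) :=
  {M | Mᴴ * Matrix.J (Fin m) ℂ * M = Matrix.J (Fin m) ℂ}

/-- The identity as an element of `HSp(2m, ℂ)`. -/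
def HSp.id (m : ℕ) : HSp m := ⟨1, by simp [HSp]⟩

/-- A Lagrangian frame `L = [X; Y]` of `ℂ^{2m}`: an injective `2m × m` matrix whose range is
isotropic, that is, `Xᴴ Y = Yᴴ X`. -/
structure LagrangianFrame (m : ℕ) where
  mat : Matrix (Fin m ⊕ Fin m) (Fin m) ℂ
  isotropic : matᴴ * Matrix.J (Fin m) ℂ * mat = 0
  injective : ∀ v, mat *ᵥ v = 0 → v = 0

namespace LagrangianFrame

variable {m : ℕ}

/-- The upper block of a frame `[X; Y]`. -/
def X (L : LagrangianFrame m) : Matrix (Fin m) (Fin m) ℂ := L.mat.toRows₁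

/-- The lower block of a frame `[X; Y]`. -/
def Y (L : LagrangianFrame m) : Matrix (Fin m) (Fin m) ℂ := L.mat.toRows₂

lemma mat_eq (L : LagrangianFrame m) : L.mat = Matrix.fromRows L.X L.Y :=
  (Matrix.fromRows_toRows L.mat).symm

lemma isotropic_iff (X Y : Matrix (Fin m) (Fin m) ℂ) :
    (Matrix.fromRows X Y)ᴴ * Matrix.J (Fin m) ℂ * Matrix.fromRows X Y = 0 ↔ Xᴴ * Y = Yᴴ * X := by
  have : (Matrix.fromRows X Y)ᴴ * Matrix.J (Fin m) ℂ * Matrix.fromRows X Y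
      = Yᴴ * X - Xᴴ * Y := by
    rw [Matrix.conjTranspose_fromRows_eq_fromCols_conjTranspose, Matrix.J,
      Matrix.fromCols_mul_fromBlocks, Matrix.fromCols_mul_fromRows]
    simp [sub_eq_add_neg]
  rw [this, sub_eq_zero, eq_comm]

lemma conj_mul_eq (L : LagrangianFrame m) : L.Xᴴ * L.Y = L.Yᴴ * L.X := by
  have h := L.isotropic
  rw [mat_eq] at h
  exact (isotropic_iff _ _).1 h

lemma conj_mul_sub (L : LagrangianFrame m) :
    (L.X - Complex.I • L.Y)ᴴ * (L.X - Complex.I • L.Y) = L.Xᴴ * L.X + L.Yᴴ * L.Y := by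
  have h := L.conj_mul_eq
  simp only [Matrix.conjTranspose_sub, Matrix.conjTranspose_smul, sub_mul, mul_sub,
    Matrix.smul_mul, Matrix.mul_smul, h]
  simp [smul_smul]
  abel

lemma conj_mul_add (L : LagrangianFrame m) :
    (L.X + Complex.I • L.Y)ᴴ * (L.X + Complex.I • L.Y) = L.Xᴴ * L.X + L.Yᴴ * L.Y := by
  have h := L.conj_mul_eq
  simp only [Matrix.conjTranspose_add, Matrix.conjTranspose_smul, add_mul, mul_add,
    Matrix.smul_mul, Matrix.mul_smul, h]
  simp [smul_smul]

open scoped ComplexOrder in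
lemma isUnit_sub (L : LagrangianFrame m) : IsUnit (L.X - Complex.I • L.Y) := by
  rw [← Matrix.mulVec_injective_iff_isUnit]
  refine (injective_iff_map_eq_zero (Matrix.mulVecLin (L.X - Complex.I • L.Y))).2 fun v hv => ?_
  rw [Matrix.mulVecLin_apply] at hv
  have h1 : (L.matᴴ * L.mat) *ᵥ v = 0 := by
    rw [mat_eq, Matrix.conjTranspose_fromRows_eq_fromCols_conjTranspose,
      Matrix.fromCols_mul_fromRows, ← L.conj_mul_sub, ← Matrix.mulVec_mulVec, hv,
      Matrix.mulVec_zero]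
  exact L.injective v ((Matrix.conjTranspose_mul_self_mulVec_eq_zero _ _).1 h1)

/-- `W_Λ = (X + iY)(X - iY)⁻¹ ∈ U(m)`. -/
def toUnitary (L : LagrangianFrame m) : Matrix.unitaryGroup (Fin m) ℂ :=
  ⟨(L.X + Complex.I • L.Y) * (L.X - Complex.I • L.Y)⁻¹, by
    rw [Matrix.mem_unitaryGroup_iff', Matrix.star_eq_conjTranspose, Matrix.conjTranspose_mul]
    have hu : IsUnit (L.X - Complex.I • L.Y).det :=
      (Matrix.isUnit_iff_isUnit_det _).1 L.isUnit_sub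
    calc _ = (L.X - Complex.I • L.Y)⁻¹ᴴ * ((L.X + Complex.I • L.Y)ᴴ * (L.X + Complex.I • L.Y))
            * (L.X - Complex.I • L.Y)⁻¹ := by simp only [mul_assoc]
      _ = ((L.X - Complex.I • L.Y) * (L.X - Complex.I • L.Y)⁻¹)ᴴ
            * ((L.X - Complex.I • L.Y) * (L.X - Complex.I • L.Y)⁻¹) := by
          rw [conj_mul_add, ← conj_mul_sub, Matrix.conjTranspose_mul]
          simp only [mul_assoc]
      _ = 1 := by rw [Matrix.mul_nonsing_inv _ hu]; simp⟩

/-- The action of `HSp(2m, ℂ)` on Lagrangian frames. -/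
def act (M : HSp m) (L : LagrangianFrame m) : LagrangianFrame m where
  mat := M.1 * L.mat
  isotropic := by
    have hM : M.1ᴴ * Matrix.J (Fin m) ℂ * M.1 = Matrix.J (Fin m) ℂ := M.2
    calc _ = L.matᴴ * (M.1ᴴ * Matrix.J (Fin m) ℂ * M.1) * L.mat := by
          rw [Matrix.conjTranspose_mul]; simp only [Matrix.mul_assoc]
      _ = 0 := by rw [hM, L.isotropic]
  injective v hv := by
    have hM : M.1ᴴ * Matrix.J (Fin m) ℂ * M.1 = Matrix.J (Fin m) ℂ := M.2
    apply L.injective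
    have h2 : Matrix.J (Fin m) ℂ *ᵥ (L.mat *ᵥ v) = 0 := by
      rw [← hM, ← Matrix.mulVec_mulVec, Matrix.mulVec_mulVec v M.1 L.mat, hv, Matrix.mulVec_zero]
    have h3 : (Matrix.J (Fin m) ℂ * Matrix.J (Fin m) ℂ) *ᵥ (L.mat *ᵥ v) = 0 := by
      rw [← Matrix.mulVec_mulVec, h2, Matrix.mulVec_zero]
    rwa [Matrix.J_squared, Matrix.neg_mulVec, Matrix.one_mulVec, neg_eq_zero] at h3

/-- The Lagrangian frame `[W + 1; i(1 - W)]`, whose Lagrangian subspace `Λ` satisfies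
`W_Λ = W`. -/
def ofUnitary (W : Matrix.unitaryGroup (Fin m) ℂ) : LagrangianFrame m where
  mat := Matrix.fromRows (W.1 + 1) (Complex.I • (1 - W.1))
  isotropic := by
    rw [isotropic_iff]
    have hW : W.1ᴴ * W.1 = 1 := Matrix.mem_unitaryGroup_iff'.1 W.2
    have h1 : (W.1 + 1)ᴴ * (1 - W.1) = W.1ᴴ - W.1 := by
      rw [Matrix.conjTranspose_add, Matrix.conjTranspose_one, add_mul, mul_sub, hW]
      simp
    have h2 : (1 - W.1)ᴴ * (W.1 + 1) = -(W.1ᴴ - W.1) := by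
      rw [Matrix.conjTranspose_sub, Matrix.conjTranspose_one, sub_mul, Matrix.one_mul,
        Matrix.mul_add, hW]
      simp
      abel
    rw [Matrix.mul_smul, h1, Matrix.conjTranspose_smul, Matrix.smul_mul, h2, RCLike.star_def,
      Complex.conj_I, smul_neg, neg_smul, neg_neg]
  injective v hv := by
    have h1 : (W.1 + 1) *ᵥ v = 0 := by
      have := congrArg (fun w => w ∘ Sum.inl) hv
      simpa [Matrix.fromRows_mulVec] using this
    have h2 : (Complex.I • (1 - W.1)) *ᵥ v = 0 := by
      have := congrArg (fun w => w ∘ Sum.inr) hv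
      simpa [Matrix.fromRows_mulVec] using this
    rw [Matrix.smul_mulVec, smul_eq_zero_iff_right Complex.I_ne_zero, Matrix.sub_mulVec,
      Matrix.one_mulVec, sub_eq_zero] at h2
    rw [Matrix.add_mulVec, Matrix.one_mulVec, ← h2] at h1
    have : (2 : ℂ) • v = 0 := by rw [two_smul]; exact h1
    simpa using this

/-- `W ↦ [W + 1; i(1 - W)]` inverts `Λ ↦ W_Λ`. -/
lemma toUnitary_ofUnitary (W : Matrix.unitaryGroup (Fin m) ℂ) : (ofUnitary W).toUnitary = W := by
  apply Subtype.ext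
  have hX : (ofUnitary W).X = W.1 + 1 := Matrix.toRows₁_fromRows _ _
  have hY : (ofUnitary W).Y = Complex.I • (1 - W.1) := Matrix.toRows₂_fromRows _ _
  have h1 : (ofUnitary W).X - Complex.I • (ofUnitary W).Y = (2 : ℂ) • 1 := by
    rw [hX, hY, smul_smul, Complex.I_mul_I, two_smul]
    simp only [neg_smul, one_smul]
    abel
  have h2 : (ofUnitary W).X + Complex.I • (ofUnitary W).Y = W.1 * ((2 : ℂ) • 1) := by
    rw [hX, hY, smul_smul, Complex.I_mul_I, two_smul]
    simp only [neg_smul, one_smul, mul_add, mul_one]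
    abel
  have hu := (Matrix.isUnit_iff_isUnit_det _).1 (ofUnitary W).isUnit_sub
  rw [h1] at hu
  change ((ofUnitary W).X + _) * ((ofUnitary W).X - _)⁻¹ = _
  rw [h1, h2, Matrix.mul_assoc, Matrix.mul_nonsing_inv _ hu, Matrix.mul_one]

/-- Two frames have the same `W` only if they span the same subspace. -/
lemma ofUnitary_toUnitary (L : LagrangianFrame m) :
    (ofUnitary L.toUnitary).mat * (L.X - Complex.I • L.Y) = (2 : ℂ) • L.mat := by
  have hu := (Matrix.isUnit_iff_isUnit_det _).1 L.isUnit_sub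
  have h : L.toUnitary.1 * (L.X - Complex.I • L.Y) = L.X + Complex.I • L.Y := by
    change (L.X + _) * (L.X - _)⁻¹ * _ = _
    rw [Matrix.mul_assoc, Matrix.nonsing_inv_mul _ hu, Matrix.mul_one]
  change Matrix.fromRows (L.toUnitary.1 + 1) (Complex.I • (1 - L.toUnitary.1)) * _ = _
  rw [Matrix.fromRows_mul, Matrix.smul_mul, Matrix.add_mul, Matrix.sub_mul, Matrix.one_mul, h,
    mat_eq]
  ext i j
  rcases i with i | i
  · simp
    ring
  · simp
    linear_combination (-2 * L.Y i j) * Complex.I_mul_I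

/-- `W_Λ` does not depend on the frame. -/
lemma toUnitary_eq_of_mul (L L' : LagrangianFrame m) (R : Matrix (Fin m) (Fin m) ℂ)
    (h : L.mat * R = L'.mat) : L.toUnitary = L'.toUnitary := by
  apply Subtype.ext
  have h' : Matrix.fromRows (L.X * R) (L.Y * R) = Matrix.fromRows L'.X L'.Y := by
    rw [← Matrix.fromRows_mul, ← mat_eq, ← mat_eq, h]
  obtain ⟨hX, hY⟩ := Matrix.fromRows_inj h'
  have hu := (Matrix.isUnit_iff_isUnit_det _).1 L.isUnit_sub
  have hu' := (Matrix.isUnit_iff_isUnit_det _).1 L'.isUnit_sub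
  have e1 : L'.X + Complex.I • L'.Y = (L.X + Complex.I • L.Y) * R := by
    rw [← hX, ← hY, Matrix.add_mul, Matrix.smul_mul]
  have e2 : L'.X - Complex.I • L'.Y = (L.X - Complex.I • L.Y) * R := by
    rw [← hX, ← hY, Matrix.sub_mul, Matrix.smul_mul]
  change (L.X + _) * (L.X - _)⁻¹ = (L'.X + _) * (L'.X - _)⁻¹
  have e3 : R * (L'.X - Complex.I • L'.Y)⁻¹ = (L.X - Complex.I • L.Y)⁻¹ := by
    rw [← Matrix.nonsing_inv_mul_cancel_left _ (R * _) hu, ← Matrix.mul_assoc _ R, ← e2,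
      Matrix.mul_nonsing_inv _ hu', Matrix.mul_one]
  rw [e1, Matrix.mul_assoc, e3]

/-- `W_{MΛ}` depends on the Lagrangian subspace only through `W_Λ`. -/
lemma toUnitary_act (M : HSp m) (L : LagrangianFrame m) :
    (act M (ofUnitary L.toUnitary)).toUnitary = (act M L).toUnitary := by
  apply toUnitary_eq_of_mul _ _ ((2 : ℂ)⁻¹ • (L.X - Complex.I • L.Y))
  change M.1 * (ofUnitary L.toUnitary).mat * _ = M.1 * L.mat
  rw [Matrix.mul_assoc, Matrix.mul_smul, ofUnitary_toUnitary, smul_smul]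
  norm_num

end LagrangianFrame

/-! ### Cocycles, lifts and the fibered rotation number -/

instance (m : ℕ) : MeasurableSpace (Matrix.unitaryGroup (Fin m) ℂ) := borel _

instance (m : ℕ) : BorelSpace (Matrix.unitaryGroup (Fin m) ℂ) := ⟨rfl⟩

section Cocycle

variable {Θ : Type*} [TopologicalSpace Θ] {m : ℕ}

/-- The action `(θ, W_Λ) ↦ (Tθ, W_{A(θ)Λ})` of the cocycle `(T, A)` on `Θ × U(m)`. -/
def cocycleMap (T : Θ ≃ₜ Θ) (A : C(Θ, HSp m)) (p : Θ × Matrix.unitaryGroup (Fin m) ℂ) :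
    Θ × Matrix.unitaryGroup (Fin m) ℂ :=
  (T p.1, (LagrangianFrame.act (A p.1) (LagrangianFrame.ofUnitary p.2)).toUnitary)

/-- The covering map `(θ, x, S) ↦ (θ, e^{2πix} S)` from `Θ × ℝ × SU(m)` onto `Θ × U(m)`. -/
def coverMap (p : Θ × ℝ × Matrix.specialUnitaryGroup (Fin m) ℂ) :
    Θ × Matrix.unitaryGroup (Fin m) ℂ :=
  (p.1, ⟨Complex.exp (2 * Real.pi * Complex.I * p.2.1) • p.2.2.1, by
    have hS : star p.2.2.1 * p.2.2.1 = 1 :=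
      Matrix.mem_unitaryGroup_iff'.1 (Matrix.mem_specialUnitaryGroup_iff.1 p.2.2.2).1
    rw [Matrix.mem_unitaryGroup_iff', star_smul, Matrix.smul_mul, Matrix.mul_smul, smul_smul, hS]
    have : star (Complex.exp (2 * Real.pi * Complex.I * p.2.1))
        * Complex.exp (2 * Real.pi * Complex.I * p.2.1) = 1 := by
      rw [RCLike.star_def, ← Complex.exp_conj, ← Complex.exp_add]
      have h2 : (starRingEnd ℂ) 2 = 2 := Complex.conj_ofNat 2
      simp [h2]
    rw [this, one_smul]⟩)

/-- A lift of `(T, A)`: a continuous self-map of `Θ × ℝ × SU(m)` that covers the action of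
`(T, A)` on `Θ × U(m)`. -/
structure IsLift (T : Θ ≃ₜ Θ) (A : C(Θ, HSp m))
    (F : Θ × ℝ × Matrix.specialUnitaryGroup (Fin m) ℂ →
      Θ × ℝ × Matrix.specialUnitaryGroup (Fin m) ℂ) : Prop where
  continuous : Continuous F
  semiconj : ∀ p, coverMap (F p) = cocycleMap T A (coverMap p)

/-- `g : Θ × U(m) → ℝ` is the continuous function to which `m (p₂ F(θ, x, S) - x)` descends. -/
structure IsDisplacement
    (F : Θ × ℝ × Matrix.specialUnitaryGroup (Fin m) ℂ →
      Θ × ℝ × Matrix.specialUnitaryGroup (Fin m) ℂ)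
    (g : Θ × Matrix.unitaryGroup (Fin m) ℂ → ℝ) : Prop where
  continuous : Continuous g
  descends : ∀ p, g (coverMap p) = m * ((F p).2.1 - p.2.1)

end Cocycle

section RotationNumber

variable {Θ : Type*} [MetricSpace Θ] [CompactSpace Θ] [MeasurableSpace Θ] [BorelSpace Θ] {m : ℕ}

/-- The subgroup `μ(C(Θ, ℤ)) = {∫ p dμ : p ∈ C(Θ, ℤ)}` of `ℝ`. -/
def integerMeans (μ : Measure Θ) [IsFiniteMeasure μ] : AddSubgroup ℝ where
  carrier := {c | ∃ p : C(Θ, ℤ), c = ∫ θ, (p θ : ℝ) ∂μ}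
  zero_mem' := ⟨0, by simp⟩
  add_mem' := by
    have hint : ∀ p : C(Θ, ℤ), Integrable (fun θ => (p θ : ℝ)) μ := fun p =>
      Continuous.integrable_of_hasCompactSupport (by fun_prop)
        (HasCompactSupport.of_compactSpace _)
    rintro _ _ ⟨p, rfl⟩ ⟨q, rfl⟩
    exact ⟨p + q, by simp [integral_add (hint p) (hint q)]⟩
  neg_mem' := by
    rintro _ ⟨p, rfl⟩
    exact ⟨-p, by simp [integral_neg]⟩

/-- The class `r ∈ ℝ / μ(C(Θ, ℤ))` is the fibered rotation number `rot_f(T, A)`: the map `A` is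
homotopic to the identity in `HSp(2m, ℂ)`, the cocycle has lifts, and for every lift the
displacement descends to a function `g` on `Θ × U(m)` whose Birkhoff averages along `(T, A)`
converge, for `μ`-almost every `θ` and all `W ∈ U(m)`, to a real number in the class `r`,
which is also the integral of `g` against every `(T, A)`-invariant probability measure that
projects to `μ`. -/
structure HasFiberedRotationNumber (T : Θ ≃ₜ Θ) (μ : Measure Θ) [IsFiniteMeasure μ]
    (A : C(Θ, HSp m)) (r : ℝ ⧸ integerMeans μ) : Prop where
  homotopic : A.Homotopic (ContinuousMap.const Θ (HSp.id m))
  exists_lift : ∃ F, IsLift T A F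
  of_lift : ∀ F, IsLift T A F → ∃ g, IsDisplacement F g ∧ ∃ ρ : ℝ,
    (QuotientAddGroup.mk ρ : ℝ ⧸ integerMeans μ) = r ∧
    (∀ᵐ θ ∂μ, ∀ W, Tendsto (fun n => birkhoffAverage ℝ (cocycleMap T A) g n (θ, W))
      atTop (𝓝 ρ)) ∧
    ∀ ν : Measure (Θ × Matrix.unitaryGroup (Fin m) ℂ), IsProbabilityMeasure ν →
      MeasurePreserving (cocycleMap T A) ν ν → ν.map Prod.fst = μ → ∫ p, g p ∂ν = ρ

end RotationNumber

/-! ### Spectral measures -/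

section Spectral

variable {K : Type*} [NormedAddCommGroup K] [InnerProductSpace ℂ K] [CompleteSpace K]

/-- The positive linear functional `g ↦ ⟨ψ, g(a) ψ⟩` on `C_c(ℝ)`, for `a` self-adjoint. -/
def spectralFunctional (a : K →L[ℂ] K) (ψ : K) : C_c(ℝ, ℝ) →ₚ[ℝ] ℝ :=
  PositiveLinearMap.mk₀
    { toFun := fun g => (inner ℂ ψ ((cfc (g : ℝ → ℝ) a) ψ)).re
      map_add' := fun g h => by
        have := cfc_add (a := a) (g : ℝ → ℝ) (h : ℝ → ℝ)
          g.continuous.continuousOn h.continuous.continuousOn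
        have e : ((g + h : C_c(ℝ, ℝ)) : ℝ → ℝ) = fun x => g x + h x := rfl
        rw [e, this]
        simp
      map_smul' := fun c g => by
        have := cfc_smul (a := a) c (g : ℝ → ℝ) g.continuous.continuousOn
        have e : ((c • g : C_c(ℝ, ℝ)) : ℝ → ℝ) = fun x => c • g x := rfl
        rw [e, this]
        simp [inner_smul_right_eq_smul] }
    (fun g hg => by
      have h : (0 : K →L[ℂ] K) ≤ cfc (g : ℝ → ℝ) a := cfc_nonneg fun x _ => hg x
      have := ((ContinuousLinearMap.nonneg_iff_isPositive _).1 h).inner_nonneg_right ψ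
      exact (Complex.le_def.1 this).1)

/-- The spectral measure of the self-adjoint operator `a` at the vector `ψ`, that is, the measure
with `∫ g = ⟨ψ, g(a) ψ⟩` for all `g ∈ C_c(ℝ)`. -/
def spectralMeasure (a : K →L[ℂ] K) (ψ : K) : Measure ℝ :=
  RealRMK.rieszMeasure (spectralFunctional a ψ)

end Spectral

/-! ### The operators and the integrated density of states -/

/-- The Hilbert space `ℓ²(ℤ, ℂ^m)`. -/
abbrev StripSpace (m : ℕ) : Type := lp (fun _ : ℤ => EuclideanSpace ℂ (Fin m)) 2

/-- The shift `(S_k u)_n = u_{n+k}`. -/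
def shift (m : ℕ) (k : ℤ) : StripSpace m →L[ℂ] StripSpace m :=
  LinearMap.mkContinuous
    { toFun := fun u => ⟨fun n => u (n + k), by
        have h := (lp.memℓp u).summable (by norm_num)
        exact memℓp_gen ((Equiv.addRight k).summable_iff.2 h)⟩
      map_add' := fun _ _ => rfl
      map_smul' := fun _ _ => rfl } 1 (fun u => by
      refine lp.norm_le_of_tsum_le (by norm_num) (by positivity) ?_
      rw [one_mul, lp.norm_rpow_eq_tsum (by norm_num) u]
      exact ((Equiv.addRight k).tsum_eq fun n => ‖u n‖ ^ (2 : ℝ≥0∞).toReal).le)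

@[simp] lemma shift_apply (m : ℕ) (k : ℤ) (u : StripSpace m) (n : ℤ) :
    shift m k u n = u (n + k) := rfl

/-- A bounded sequence of matrices acting diagonally on `ℓ²(ℤ, ℂ^m)`: `(D u)_n = D_n u_n`. -/
def blockDiag {m : ℕ} (D : ℤ → Matrix (Fin m) (Fin m) ℂ) (K : ℝ) (hK : 0 ≤ K)
    (hD : ∀ n, ‖Matrix.toEuclideanCLM (𝕜 := ℂ) (D n)‖ ≤ K) : StripSpace m →L[ℂ] StripSpace m :=
  lp.mapCLM 2 (fun n => Matrix.toEuclideanCLM (𝕜 := ℂ) (D n)) hK hD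

lemma inner_shift {m : ℕ} (k : ℤ) (u v : StripSpace m) :
    inner ℂ (shift m k u) v = inner ℂ u (shift m (-k) v) := by
  rw [lp.inner_eq_tsum, lp.inner_eq_tsum, ← (Equiv.addRight (-k)).tsum_eq]
  simp

lemma blockDiag_apply {m : ℕ} (D : ℤ → Matrix (Fin m) (Fin m) ℂ) (K : ℝ) (hK : 0 ≤ K)
    (hD : ∀ n, ‖Matrix.toEuclideanCLM (𝕜 := ℂ) (D n)‖ ≤ K) (u : StripSpace m) (n : ℤ) :
    blockDiag D K hK hD u n = Matrix.toEuclideanCLM (𝕜 := ℂ) (D n) (u n) := rfl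

lemma inner_blockDiag {m : ℕ} (D D' : ℤ → Matrix (Fin m) (Fin m) ℂ) (K K' : ℝ) (hK : 0 ≤ K)
    (hK' : 0 ≤ K') (hD : ∀ n, ‖Matrix.toEuclideanCLM (𝕜 := ℂ) (D n)‖ ≤ K)
    (hD' : ∀ n, ‖Matrix.toEuclideanCLM (𝕜 := ℂ) (D' n)‖ ≤ K') (h : ∀ n, (D n)ᴴ = D' n)
    (u v : StripSpace m) :
    inner ℂ (blockDiag D K hK hD u) v = inner ℂ u (blockDiag D' K' hK' hD' v) := by
  rw [lp.inner_eq_tsum, lp.inner_eq_tsum]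
  congr 1
  ext n
  rw [blockDiag_apply, blockDiag_apply, ← h n, ← Matrix.star_eq_conjTranspose, map_star,
    ContinuousLinearMap.star_eq_adjoint, ContinuousLinearMap.adjoint_inner_right]

section Operator

variable {Θ : Type*} [MetricSpace Θ] [CompactSpace Θ] {m : ℕ}

lemma continuous_toEuclideanCLM :
    Continuous (fun M : Matrix (Fin m) (Fin m) ℂ => Matrix.toEuclideanCLM (𝕜 := ℂ) M) :=
  LinearMap.continuous_of_finiteDimensional
    (Matrix.toEuclideanCLM (𝕜 := ℂ) (n := Fin m)).toAlgEquiv.toLinearMap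

/-- The function `f` as a continuous family of operators on `ℂ^m`. -/
def clmFamily (f : C(Θ, selfAdjoint (Matrix (Fin m) (Fin m) ℂ))) :
    C(Θ, EuclideanSpace ℂ (Fin m) →L[ℂ] EuclideanSpace ℂ (Fin m)) :=
  ⟨fun θ => Matrix.toEuclideanCLM (𝕜 := ℂ) (f θ).1,
    continuous_toEuclideanCLM.comp (continuous_subtype_val.comp f.continuous)⟩

lemma norm_clm_le (T : Θ ≃ₜ Θ) (f : C(Θ, selfAdjoint (Matrix (Fin m) (Fin m) ℂ))) (θ : Θ)
    (n : ℤ) : ‖Matrix.toEuclideanCLM (𝕜 := ℂ) (f ((T ^ n) θ)).1‖ ≤ ‖clmFamily f‖ :=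
  (clmFamily f).norm_coe_le_norm ((T ^ n) θ)

/-- The operator `(H_θ u)_n = C* u_{n-1} + f(T^n θ) u_n + C u_{n+1}` on `ℓ²(ℤ, ℂ^m)`. -/
def stripOperator (T : Θ ≃ₜ Θ) (C : GL (Fin m) ℂ)
    (f : C(Θ, selfAdjoint (Matrix (Fin m) (Fin m) ℂ))) (θ : Θ) :
    StripSpace m →L[ℂ] StripSpace m :=
  blockDiag (fun _ => (C : Matrix (Fin m) (Fin m) ℂ)ᴴ) _ (norm_nonneg _) (fun _ => le_rfl)
      ∘L shift m (-1)
    + blockDiag (fun n => (f ((T ^ n) θ)).1) ‖clmFamily f‖ (norm_nonneg (clmFamily f))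
        (norm_clm_le T f θ)
    + blockDiag (fun _ => (C : Matrix (Fin m) (Fin m) ℂ)) _ (norm_nonneg _) (fun _ => le_rfl)
      ∘L shift m 1

lemma stripOperator_apply (T : Θ ≃ₜ Θ) (C : GL (Fin m) ℂ)
    (f : C(Θ, selfAdjoint (Matrix (Fin m) (Fin m) ℂ))) (θ : Θ) (u : StripSpace m) (n : ℤ) :
    (stripOperator T C f θ u n : Fin m → ℂ) =
      (C : Matrix (Fin m) (Fin m) ℂ)ᴴ *ᵥ (u (n - 1) : Fin m → ℂ)
        + (f ((T ^ n) θ)).1 *ᵥ (u n : Fin m → ℂ)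
        + (C : Matrix (Fin m) (Fin m) ℂ) *ᵥ (u (n + 1) : Fin m → ℂ) := by
  simp [stripOperator, blockDiag_apply, sub_eq_add_neg]

lemma stripOperator_isSelfAdjoint (T : Θ ≃ₜ Θ) (C : GL (Fin m) ℂ)
    (f : C(Θ, selfAdjoint (Matrix (Fin m) (Fin m) ℂ))) (θ : Θ) :
    IsSelfAdjoint (stripOperator T C f θ) := by
  rw [ContinuousLinearMap.isSelfAdjoint_iff_isSymmetric]
  intro u v
  have comm : ∀ (M : Matrix (Fin m) (Fin m) ℂ) (K : ℝ) (hK hM) (k : ℤ) (w : StripSpace m),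
      shift m k (blockDiag (fun _ => M) K hK hM w) = blockDiag (fun _ => M) K hK hM (shift m k w) :=
    fun _ _ _ _ _ _ => rfl
  simp only [stripOperator, ContinuousLinearMap.coe_coe, add_apply,
    ContinuousLinearMap.comp_apply, inner_add_left, inner_add_right]
  rw [inner_blockDiag _ (fun _ => C.1) _ _ _ (norm_nonneg _) _ (fun _ => le_rfl) (by simp),
    inner_blockDiag (fun _ => C.1) (fun _ => C.1ᴴ) _ _ _ (norm_nonneg _) _ (fun _ => le_rfl)
      (by simp),
    inner_blockDiag (fun n => (f ((T ^ n) θ)).1) (fun n => (f ((T ^ n) θ)).1) _ _ _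
      (norm_nonneg (clmFamily f)) _ (norm_clm_le T f θ) (fun n => (f ((T ^ n) θ)).2),
    inner_shift, inner_shift, comm, comm, neg_neg]
  ring

/-- The vector `δ_{n,i}` of `ℓ²(ℤ, ℂ^m)`. -/
def delta (n : ℤ) (i : Fin m) : StripSpace m := lp.single 2 n (EuclideanSpace.single i (1 : ℂ))

/-- The density of states measure: the average over `i` and over `θ` of the spectral measures of
`H_θ` at `δ_{0,i}`. For measurable `g ≥ 0` its integral of `g` is the `μ`-mean of
`(1/m) ∑ᵢ ⟨δ_{0,i}, g(H_θ) δ_{0,i}⟩`; the spectral measures depend measurably on `θ`, because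
`θ ↦ H_θ` is strongly continuous and uniformly bounded. -/
def dosMeasure [MeasurableSpace Θ] (T : Θ ≃ₜ Θ) (μ : Measure Θ) (C : GL (Fin m) ℂ)
    (f : C(Θ, selfAdjoint (Matrix (Fin m) (Fin m) ℂ))) : Measure ℝ :=
  (m : ℝ≥0∞)⁻¹ • ∑ i : Fin m, μ.bind fun θ => spectralMeasure (stripOperator T C f θ) (delta 0 i)

/-- The integrated density of states `N(E)`. -/
def ids [MeasurableSpace Θ] (T : Θ ≃ₜ Θ) (μ : Measure Θ) (C : GL (Fin m) ℂ)
    (f : C(Θ, selfAdjoint (Matrix (Fin m) (Fin m) ℂ))) (E : ℝ) : ℝ :=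
  (dosMeasure T μ C f).real (Set.Iic E)

end Operator

/-! ### The Schrödinger cocycle and the fibered rotation function -/

section Schrodinger

variable {Θ : Type*} [MetricSpace Θ] [CompactSpace Θ] {m : ℕ}

/-- The Schrödinger cocycle matrix `[[(E - B) C⁻¹, -C*], [C⁻¹, 0]]`. -/
def transferMatrix (C : GL (Fin m) ℂ) (E : ℝ) (B : Matrix (Fin m) (Fin m) ℂ) :
    Matrix (Fin m ⊕ Fin m) (Fin m ⊕ Fin m) ℂ :=
  Matrix.fromBlocks (((E : ℂ) • (1 : Matrix (Fin m) (Fin m) ℂ) - B) * (C⁻¹ : GL (Fin m) ℂ).1)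
    (-(C.1)ᴴ) (C⁻¹ : GL (Fin m) ℂ).1 0

lemma transferMatrix_mem (C : GL (Fin m) ℂ) (E : ℝ) (B : selfAdjoint (Matrix (Fin m) (Fin m) ℂ)) :
    transferMatrix C E B.1 ∈ HSp m := by
  have hB : (B.1)ᴴ = B.1 := B.2
  have h1 : (C⁻¹ : GL (Fin m) ℂ).1 * C.1 = 1 := by rw [← Units.val_mul]; simp
  have h2 : C.1 * (C⁻¹ : GL (Fin m) ℂ).1 = 1 := by rw [← Units.val_mul]; simp
  have h3 : ((C⁻¹ : GL (Fin m) ℂ).1)ᴴ * (C.1)ᴴ = 1 := by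
    rw [← Matrix.conjTranspose_mul, h2, Matrix.conjTranspose_one]
  have hE : ((E : ℂ) • (1 : Matrix (Fin m) (Fin m) ℂ) - B.1)ᴴ = (E : ℂ) • 1 - B.1 := by
    simp [hB]
  change _ * _ * _ = _
  rw [transferMatrix, Matrix.J, Matrix.fromBlocks_conjTranspose, Matrix.fromBlocks_multiply,
    Matrix.fromBlocks_multiply, Matrix.conjTranspose_mul, hE]
  congr 1
  · simp [Matrix.mul_assoc]
  · rw [Matrix.mul_zero, Matrix.mul_neg, Matrix.mul_one, Matrix.mul_zero]
    simpa using h3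
  · simp
  · simp

/-- The map `A_E : Θ → HSp(2m, ℂ)` of the Schrödinger cocycle `(T, A_E)`. -/
def schrodingerCocycle (C : GL (Fin m) ℂ) (f : C(Θ, selfAdjoint (Matrix (Fin m) (Fin m) ℂ)))
    (E : ℝ) : C(Θ, HSp m) :=
  ⟨fun θ => ⟨transferMatrix C E (f θ).1, transferMatrix_mem C E (f θ)⟩, by
    have hf : Continuous fun θ => (f θ).1 := continuous_subtype_val.comp f.continuous
    refine Continuous.subtype_mk ?_ _
    unfold transferMatrix
    fun_prop⟩

/-- A fibered rotation function `rot_f(E)`: a continuous branch of `E ↦ rot_f(T, A_E)`. -/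
structure IsFiberedRotationFunction [MeasurableSpace Θ] [BorelSpace Θ] (T : Θ ≃ₜ Θ)
    (μ : Measure Θ) [IsFiniteMeasure μ] (C : GL (Fin m) ℂ)
    (f : C(Θ, selfAdjoint (Matrix (Fin m) (Fin m) ℂ))) (ρ : ℝ → ℝ) : Prop where
  continuous : Continuous ρ
  branch : ∀ E, HasFiberedRotationNumber T μ (schrodingerCocycle C f E)
    (QuotientAddGroup.mk (ρ E))

end Schrodinger

end StripSchrodinger

end

open MeasureTheory Filter Topology
open scoped Matrix CompactlySupported ENNReal

noncomputable section

namespace StripSchrodinger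

/-! ### Arguments of determinants -/

section ArgDet

variable {ι : Type*} [Fintype ι] [DecidableEq ι]

/-! The bridge between rotation and spectrum is an eigenvalue count in finite volume.

On `U(m)` an element of HSp acts as W ↦ (aW + b)(cW + d)⁻¹. It multiplies det W by a factor whose
phase depends on W only through the eigenvalues of 1 + QW, where Q = d⁻¹c is a strict contraction
(`det_act`). These eigenvalues lie in the right half-plane, so a continuous logarithm of the factor
oscillates by at most m over `U(m)` (`abs_displacement_sub_le`). Products along an orbit are again
in HSp, so the bound does not depend on the number of steps (`abs_birkhoffSum_sub_le`). Hence the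
initial Lagrangian subspace is irrelevant for averages, the displacement of the horizontal subspace
is almost additive over T, and its mean α(E) exists almost everywhere, with an error m/n for the
integrals (`exists_meanDisplacement`).

For the Schrödinger cocycle the horizontal subspace carries the solutions that vanish at the site
-1. Let H_n be the restriction of H_θ to n sites and P the inclusion of the last site. Schur
complements (`det_dirichletFrame`) express det W after n steps as the quotient of det(E - H_n +
iPPᵀ) by its conjugate. The displacement and the argument of this determinant divided by π are both
continuous in E and vanish as E → +∞, so they are equal (`totalDisplacement_eq_argDet`). Removing
the boundary term, which has rank at most m, costs a bounded error and leaves the number of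
eigenvalues of H_n above E (`exists_count`).

By finite propagation and polynomial approximation, these eigenvalues are distributed like the
Birkhoff sums of the spectral measures (`exists_abs_sum_eigenvalues_sub_le`). This squeezes m(1 - N)
between values of α at neighbouring energies. As a uniform limit α is continuous, so the two
coincide (`continuous_ids_and_ae_tendsto`).

The displacement of any lift differs from the chosen one by a continuous integer function on the
base, which changes the mean by an element of μ(C(Θ, ℤ))
(`hasFiberedRotationNumber_schrodingerCocycle`). This group is countable (`countable_integerMeans`),
so two continuous branches differ by a constant. -/

/-- The sum of the principal arguments of the eigenvalues, with algebraic multiplicity. -/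
def argDet (B : Matrix ι ι ℂ) : ℝ := (B.charpoly.roots.map Complex.arg).sum

lemma charpoly_eq_prod (B : Matrix ι ι ℂ) :
    B.charpoly = (B.charpoly.roots.map fun β => Polynomial.X - Polynomial.C β).prod :=
  (IsAlgClosed.splits B.charpoly).eq_prod_roots_of_monic B.charpoly_monic

lemma card_roots_charpoly (B : Matrix ι ι ℂ) :
    Multiset.card B.charpoly.roots = Fintype.card ι := by
  rw [← (IsAlgClosed.splits B.charpoly).natDegree_eq_card_roots, B.charpoly_natDegree_eq_dim]

lemma mem_roots_charpoly {B : Matrix ι ι ℂ} {β : ℂ} :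
    β ∈ B.charpoly.roots ↔ ∃ v, v ≠ 0 ∧ B *ᵥ v = β • v := by
  rw [Polynomial.mem_roots B.charpoly_monic.ne_zero, Polynomial.IsRoot, Matrix.eval_charpoly,
    ← Matrix.exists_mulVec_eq_zero_iff]
  simp [Matrix.sub_mulVec, sub_eq_zero, eq_comm]

lemma det_scalar_sub (B : Matrix ι ι ℂ) (z : ℂ) :
    (Matrix.scalar ι z - B).det = (B.charpoly.roots.map fun β => z - β).prod := by
  rw [← Matrix.eval_charpoly, charpoly_eq_prod B, Polynomial.eval_multiset_prod,
    Multiset.map_map, ← charpoly_eq_prod B]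
  simp

/-- Both characteristic polynomials are compared pointwise as products over the roots of B, which
keeps the multiplicities. With it `argDet` can be followed along the segment from 1 to B over one
fixed multiset. -/
lemma roots_charpoly_affine (B : Matrix ι ι ℂ) (c s : ℂ) :
    (c • (1 : Matrix ι ι ℂ) + s • B).charpoly.roots = B.charpoly.roots.map fun β => c + s * β := by
  have key : (c • (1 : Matrix ι ι ℂ) + s • B).charpoly
      = ((B.charpoly.roots.map fun β => c + s * β).map
          fun β => Polynomial.X - Polynomial.C β).prod := by
    apply Polynomial.funext
    intro z
    rw [Matrix.eval_charpoly, Polynomial.eval_multiset_prod, Multiset.map_map, Multiset.map_map]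
    simp only [Function.comp_def, Polynomial.eval_sub, Polynomial.eval_X, Polynomial.eval_C]
    -- The substitution z ↦ (z - c)/s needs s ≠ 0; for s = 0 the matrix is scalar.
    rcases eq_or_ne s 0 with rfl | hs
    · have : Matrix.scalar ι z - (c • (1 : Matrix ι ι ℂ) + (0 : ℂ) • B) = (z - c) • 1 := by
        ext i j; simp [Matrix.one_apply, Matrix.diagonal_apply]; split_ifs <;> simp
      rw [this, Matrix.det_smul]
      simp [card_roots_charpoly]
    · have : Matrix.scalar ι z - (c • (1 : Matrix ι ι ℂ) + s • B)
          = s • (Matrix.scalar ι ((z - c) / s) - B) := by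
        ext i j
        simp only [Matrix.scalar_apply, Matrix.sub_apply, Matrix.diagonal_apply, Matrix.add_apply,
          Matrix.smul_apply, Matrix.one_apply, smul_eq_mul]
        split_ifs <;> field_simp <;> ring
      rw [this, Matrix.det_smul, det_scalar_sub, ← card_roots_charpoly B,
        ← Multiset.prod_replicate, ← Multiset.map_const', ← Multiset.prod_map_mul]
      refine congrArg Multiset.prod (Multiset.map_congr rfl fun β _ => ?_)
      field_simp
      ring
  rw [key, Polynomial.roots_multiset_prod_X_sub_C]
lemma prod_eq_norm_mul_exp_arg (s : Multiset ℂ) :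
    s.prod = ‖s.prod‖ * Complex.exp ((s.map Complex.arg).sum * Complex.I) := by
  induction s using Multiset.induction with
  | empty => simp
  | cons a s ih =>
    rw [Multiset.prod_cons, Multiset.map_cons, Multiset.sum_cons, norm_mul, Complex.ofReal_add,
      add_mul, Complex.exp_add]
    conv_lhs => rw [ih, ← Complex.norm_mul_exp_arg_mul_I a]
    push_cast
    ring

lemma det_eq_norm_mul_exp_argDet (B : Matrix ι ι ℂ) :
    B.det = ‖B.det‖ * Complex.exp (argDet B * Complex.I) := by
  rw [argDet, Matrix.det_eq_prod_roots_charpoly]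
  exact prod_eq_norm_mul_exp_arg _

lemma exp_argDet {B : Matrix ι ι ℂ} (h : B.det ≠ 0) :
    Complex.exp (argDet B * Complex.I) = B.det / ‖B.det‖ := by
  rw [eq_div_iff (by simpa using h), mul_comm]
  exact (det_eq_norm_mul_exp_argDet B).symm

/-- Doubling the argument cancels the modulus. The determinants of the unitary matrices below appear
as quotients of conjugate numbers, which is this form. -/
lemma exp_two_mul_argDet {B : Matrix ι ι ℂ} (h : B.det ≠ 0) :
    Complex.exp (2 * argDet B * Complex.I) = B.det / star B.det := by
  rw [mul_assoc, two_mul, Complex.exp_add, exp_argDet h]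
  have h1 : (‖B.det‖ : ℂ) ≠ 0 := by simpa using h
  have h2 : star B.det ≠ 0 := by simpa using h
  have h3 : B.det * star B.det = ‖B.det‖ * ‖B.det‖ := by
    rw [← sq, ← Complex.mul_conj']; rfl
  field_simp
  linear_combination h3

/-- The matrices without eigenvalues on the closed negative half-line. -/
def slitMatrices (ι : Type*) [Fintype ι] [DecidableEq ι] : Set (Matrix ι ι ℂ) :=
  {B | ∀ β ∈ B.charpoly.roots, β ∈ Complex.slitPlane}

lemma affine_mem_slitPlane {β : ℂ} (h : β ∈ Complex.slitPlane) {t : ℝ} (ht : t ∈ Set.Icc (0 : ℝ) 1) :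
    ((1 - t : ℝ) : ℂ) + (t : ℝ) * β ∈ Complex.slitPlane := by
  have := Complex.starConvex_one_slitPlane h (sub_nonneg.2 ht.2) ht.1 (by ring)
  simpa using this

lemma det_ne_zero_of_mem_slitMatrices {B : Matrix ι ι ℂ} (h : B ∈ slitMatrices ι) : B.det ≠ 0 := by
  rw [Matrix.det_eq_prod_roots_charpoly]
  exact Multiset.prod_ne_zero fun h0 => Complex.zero_notMem_slitPlane (h 0 h0)

lemma affine_mem_slitMatrices {B : Matrix ι ι ℂ} (h : B ∈ slitMatrices ι) {t : ℝ}
    (ht : t ∈ Set.Icc (0 : ℝ) 1) :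
    (((1 - t : ℝ) : ℂ) • (1 : Matrix ι ι ℂ) + ((t : ℝ) : ℂ) • B) ∈ slitMatrices ι := by
  intro β hβ
  rw [roots_charpoly_affine] at hβ
  obtain ⟨γ, hγ, rfl⟩ := Multiset.mem_map.1 hβ
  exact affine_mem_slitPlane (h γ hγ) ht

lemma argDet_affine (B : Matrix ι ι ℂ) (c s : ℂ) :
    argDet (c • (1 : Matrix ι ι ℂ) + s • B)
      = (B.charpoly.roots.map fun β => (c + s * β).arg).sum := by
  rw [argDet, roots_charpoly_affine, Multiset.map_map]; rfl

lemma continuous_multiset_sum_map {X : Type*} [TopologicalSpace X] (s : Multiset ℂ)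
    {F : ℂ → X → ℝ} (hF : ∀ β ∈ s, Continuous (F β)) :
    Continuous fun x => (s.map fun β => F β x).sum := by
  induction s using Multiset.induction with
  | empty => simpa using continuous_const
  | cons a s ih =>
    simp only [Multiset.map_cons, Multiset.sum_cons]
    exact (hF a (by simp)).add (ih fun β hβ => hF β (by simp [hβ]))

/-- The argument of the determinant is continuous away from eigenvalues `≤ 0`. -/
lemma continuousOn_argDet : ContinuousOn (argDet (ι := ι)) (slitMatrices ι) := by
  rw [continuousOn_iff_continuous_domRestrict]
  -- The segment from 1 to B stays among the slit matrices because the slit plane is star-shaped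
  -- about 1. So `argDet ∘ M` lifts the continuous phase of the determinant through the covering of
  -- the circle. A lift that is continuous at time 0 and along each segment is jointly continuous,
  -- so no continuity of roots is needed.
  let M : unitInterval × slitMatrices ι → Matrix ι ι ℂ := fun p =>
    ((1 - p.1.1 : ℝ) : ℂ) • (1 : Matrix ι ι ℂ) + ((p.1.1 : ℝ) : ℂ) • p.2.1
  have hM : Continuous M := by fun_prop
  have hM' : ∀ p, M p ∈ slitMatrices ι := fun p => affine_mem_slitMatrices p.2.2 p.1.2
  have hdet : ∀ p, (M p).det ≠ 0 := fun p => det_ne_zero_of_mem_slitMatrices (hM' p)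
  let H : C(unitInterval × slitMatrices ι, Circle) :=
    ⟨fun p => ⟨(M p).det / ‖(M p).det‖, by
        have := hdet p
        simp [Submonoid.unitSphere, this]⟩, by
      refine Continuous.subtype_mk ?_ _
      exact (hM.matrix_det).div (Complex.continuous_ofReal.comp hM.matrix_det.norm)
        fun p => by simpa using hdet p⟩
  have key : Continuous fun p => argDet (M p) := by
    refine Circle.isCoveringMap_exp.isLocalHomeomorph.continuous_lift
      Circle.isCoveringMap_exp.isSeparatedMap H (g := fun p => argDet (M p)) ?_ ?_ ?_
    · ext p
      simp only [Function.comp_apply, Circle.coe_exp]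
      exact exp_argDet (hdet p)
    · have : (fun B : slitMatrices ι => argDet (M (0, B))) = fun _ => argDet (1 : Matrix ι ι ℂ) := by
        ext B; simp [M]
      simpa [this] using continuous_const
    · intro B
      have e : (fun t => argDet (M (t, B))) = fun t : unitInterval =>
          (B.1.charpoly.roots.map fun β =>
            (((1 - t.1 : ℝ) : ℂ) + (t.1 : ℝ) * β).arg).sum := by
        ext t; exact argDet_affine _ _ _
      change Continuous fun t => argDet (M (t, B))
      rw [e]
      refine continuous_multiset_sum_map _ fun β hβ => ?_
      rw [continuous_iff_continuousAt]
      intro t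
      have hc : ContinuousAt (fun t : unitInterval => ((1 - t.1 : ℝ) : ℂ) + (t.1 : ℝ) * β) t := by
        fun_prop
      exact ContinuousAt.comp' (f := fun t : unitInterval => ((1 - t.1 : ℝ) : ℂ) + (t.1 : ℝ) * β)
        (Complex.continuousAt_arg (affine_mem_slitPlane (B.2 β hβ) t.2)) hc
  have := key.comp (Continuous.prodMk_right (1 : unitInterval))
  refine this.congr fun B => ?_
  simp [M]

/-- Used with r = E⁻¹: arguments of matrices that grow like E are read off from their normalised
limits. -/
lemma argDet_smul {r : ℝ} (hr : 0 < r) (B : Matrix ι ι ℂ) :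
    argDet ((r : ℂ) • B) = argDet B := by
  have := argDet_affine B 0 r
  rw [zero_smul, zero_add] at this
  rw [this, argDet]
  congr 1
  refine Multiset.map_congr rfl fun β _ => ?_
  rw [zero_add, Complex.arg_real_mul _ hr]

lemma argDet_one : argDet (1 : Matrix ι ι ℂ) = 0 := by
  have := argDet_affine (0 : Matrix ι ι ℂ) 1 0
  simpa using this

lemma smul_mem_slitMatrices {r : ℝ} (hr : 0 < r) {B : Matrix ι ι ℂ} (hB : B ∈ slitMatrices ι) :
    (r : ℂ) • B ∈ slitMatrices ι := by
  intro β hβ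
  have := roots_charpoly_affine B 0 r
  rw [zero_smul, zero_add] at this
  rw [this] at hβ
  obtain ⟨γ, hγ, rfl⟩ := Multiset.mem_map.1 hβ
  have h := hB γ hγ
  rw [Complex.mem_slitPlane_iff] at h ⊢
  rcases h with h | h
  · left; simpa using mul_pos hr h
  · right; simpa using ⟨hr.ne', h⟩

lemma one_mem_slitMatrices : (1 : Matrix ι ι ℂ) ∈ slitMatrices ι := by
  intro β hβ
  obtain ⟨v, hv, h⟩ := mem_roots_charpoly.1 hβ
  rw [Matrix.one_mulVec] at h
  have : (1 - β) • v = 0 := by rw [sub_smul, one_smul, ← h, sub_self]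
  rcases smul_eq_zero.1 this with h | h
  · rw [← sub_eq_zero.1 h]; simp
  · exact absurd h hv

lemma abs_argDet_le {B : Matrix ι ι ℂ} (h : ∀ β ∈ B.charpoly.roots, 0 < β.re) :
    |argDet B| ≤ Fintype.card ι * (Real.pi / 2) := by
  have h1 : ∀ s : Multiset ℂ, (∀ β ∈ s, 0 < β.re) →
      |(s.map Complex.arg).sum| ≤ Multiset.card s * (Real.pi / 2) := by
    intro s
    induction s using Multiset.induction with
    | empty => simp
    | cons a s ih =>
      intro hs
      simp only [Multiset.map_cons, Multiset.sum_cons, Multiset.card_cons]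
      push_cast
      have h2 := ih fun β hβ => hs β (by simp [hβ])
      have h3 : |a.arg| ≤ Real.pi / 2 := Complex.abs_arg_le_pi_div_two_iff.2 (hs a (by simp)).le
      calc _ ≤ |a.arg| + |(s.map Complex.arg).sum| := abs_add_le _ _
        _ ≤ _ := by linarith
  rw [← card_roots_charpoly B]
  exact h1 _ h

lemma mem_slitMatrices_of_re_pos {B : Matrix ι ι ℂ} (h : ∀ β ∈ B.charpoly.roots, 0 < β.re) :
    B ∈ slitMatrices ι := fun β hβ => Or.inl (h β hβ)

end ArgDet

/-- A continuous real function on a preconnected space is constant if its image on the circle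
is. -/
lemma eq_of_exp_eq {X : Type*} [TopologicalSpace X] [PreconnectedSpace X] {u : X → ℝ}
    (hu : Continuous u) {c : ℂ} (h : ∀ x, Complex.exp (u x * Complex.I) = c) (x y : X) :
    u x = u y := by
  have := Circle.isCoveringMap_exp.isSeparatedMap.eq_of_comp_eq
    Circle.isCoveringMap_exp.isLocalHomeomorph.isLocallyInjective (g₁ := u) (g₂ := fun _ => u y)
    hu continuous_const (by
      ext z
      simp only [Function.comp_apply, Circle.coe_exp]
      rw [h, h]) y rfl
  exact congrFun this x

/-! ### The topology of the unitary groups -/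

section Unitary

variable {m : ℕ}

lemma continuous_toUnitary {X : Type*} [TopologicalSpace X] {L : X → LagrangianFrame m}
    (h : Continuous fun x => (L x).mat) : Continuous fun x => (L x).toUnitary := by
  have hX : Continuous fun x => (L x).X :=
    continuous_matrix fun i j => h.matrix_elem (Sum.inl i) j
  have hY : Continuous fun x => (L x).Y :=
    continuous_matrix fun i j => h.matrix_elem (Sum.inr i) j
  refine Continuous.subtype_mk ?_ _
  refine Continuous.matrix_mul (hX.add (hY.const_smul Complex.I)) ?_
  have h1 : Continuous fun x => (L x).X - Complex.I • (L x).Y := hX.sub (hY.const_smul Complex.I)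
  simp only [Matrix.inv_def, Ring.inverse_eq_inv']
  refine Continuous.smul (h1.matrix_det.inv₀ fun x => ?_) h1.matrix_adjugate
  exact ((Matrix.isUnit_iff_isUnit_det _).1 (L x).isUnit_sub).ne_zero

lemma continuous_ofUnitary_mat :
    Continuous fun W : Matrix.unitaryGroup (Fin m) ℂ => (LagrangianFrame.ofUnitary W).mat := by
  refine continuous_matrix fun i j => ?_
  have : Continuous fun W : Matrix.unitaryGroup (Fin m) ℂ => W.1 := continuous_subtype_val
  rcases i with i | i
  · exact (this.add continuous_const).matrix_elem i j
  · exact ((continuous_const.sub this).const_smul Complex.I).matrix_elem i j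

lemma continuous_act_toUnitary {X : Type*} [TopologicalSpace X] {A : X → HSp m}
    {W : X → Matrix.unitaryGroup (Fin m) ℂ} (hA : Continuous A) (hW : Continuous W) :
    Continuous fun x => (LagrangianFrame.act (A x) (LagrangianFrame.ofUnitary (W x))).toUnitary :=
  continuous_toUnitary (Continuous.matrix_mul (continuous_subtype_val.comp hA)
    (continuous_ofUnitary_mat.comp hW))

lemma continuous_cocycleMap {Θ : Type*} [TopologicalSpace Θ] (T : Θ ≃ₜ Θ) (A : C(Θ, HSp m)) :
    Continuous (cocycleMap T A) :=
  (T.continuous.comp continuous_fst).prodMk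
    (continuous_act_toUnitary (A.continuous.comp continuous_fst) continuous_snd)

/-- The frame `[W + 1; i t (1 - W)]`. -/
def scaledFrame (W : Matrix.unitaryGroup (Fin m) ℂ) (hW : ∀ v, (W.1 + 1) *ᵥ v = 0 → v = 0)
    (t : ℝ) : LagrangianFrame m where
  mat := Matrix.fromRows (W.1 + 1) ((t : ℂ) • (Complex.I • (1 - W.1)))
  isotropic := by
    have h := (LagrangianFrame.isotropic_iff _ _).1 (LagrangianFrame.ofUnitary W).isotropic
    rw [LagrangianFrame.isotropic_iff, Matrix.mul_smul, h, Matrix.conjTranspose_smul,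
      Matrix.smul_mul]
    simp
  injective v hv := by
    apply hW
    have := congrArg (fun w => w ∘ Sum.inl) hv
    simpa [Matrix.fromRows_mulVec] using this

lemma toUnitary_scaledFrame_zero (W : Matrix.unitaryGroup (Fin m) ℂ)
    (hW : ∀ v, (W.1 + 1) *ᵥ v = 0 → v = 0) : (scaledFrame W hW 0).toUnitary = 1 := by
  apply Subtype.ext
  have hX : (scaledFrame W hW 0).X = W.1 + 1 := Matrix.toRows₁_fromRows _ _
  have hY : (scaledFrame W hW 0).Y = 0 := by
    have : (scaledFrame W hW 0).Y = ((0 : ℝ) : ℂ) • (Complex.I • (1 - W.1)) :=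
      Matrix.toRows₂_fromRows _ _
    rw [this]; simp
  have hu := (Matrix.isUnit_iff_isUnit_det _).1 (scaledFrame W hW 0).isUnit_sub
  change ((scaledFrame W hW 0).X + _) * ((scaledFrame W hW 0).X - _)⁻¹ = 1
  rw [hX, hY] at *
  rw [smul_zero, sub_zero] at *
  rw [add_zero, Matrix.mul_nonsing_inv _ hu]

lemma toUnitary_scaledFrame_one (W : Matrix.unitaryGroup (Fin m) ℂ)
    (hW : ∀ v, (W.1 + 1) *ᵥ v = 0 → v = 0) : (scaledFrame W hW 1).toUnitary = W := by
  refine Eq.trans ?_ (LagrangianFrame.toUnitary_ofUnitary W)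
  apply LagrangianFrame.toUnitary_eq_of_mul _ _ 1
  rw [Matrix.mul_one]
  simp [scaledFrame, LagrangianFrame.ofUnitary]

/-- If -1 is not an eigenvalue of W, the Lagrangian subspace is a graph over the horizontal one, and
shrinking the lower block to zero moves it there. -/
lemma joined_one_of_injective (W : Matrix.unitaryGroup (Fin m) ℂ)
    (hW : ∀ v, (W.1 + 1) *ᵥ v = 0 → v = 0) : Joined 1 W := by
  have hc : Continuous fun t : unitInterval => (scaledFrame W hW t).toUnitary := by
    apply continuous_toUnitary
    refine continuous_matrix fun i j => ?_
    rcases i with i | i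
    · exact continuous_const
    · change Continuous fun t : unitInterval => ((t : ℝ) : ℂ) * (Complex.I • (1 - W.1)) i j
      fun_prop
  exact ⟨⟨⟨_, hc⟩, by simpa using toUnitary_scaledFrame_zero W hW,
    by simpa using toUnitary_scaledFrame_one W hW⟩⟩

/-- Rotation of a unitary matrix by `e^{is}`. -/
def rotate (s : ℝ) (W : Matrix.unitaryGroup (Fin m) ℂ) : Matrix.unitaryGroup (Fin m) ℂ :=
  ⟨Complex.exp (s * Complex.I) • W.1, by
    have hW : star W.1 * W.1 = 1 := Matrix.mem_unitaryGroup_iff'.1 W.2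
    rw [Matrix.mem_unitaryGroup_iff', star_smul, Matrix.smul_mul, Matrix.mul_smul, smul_smul, hW]
    have : star (Complex.exp (s * Complex.I)) * Complex.exp (s * Complex.I) = 1 := by
      rw [RCLike.star_def, ← Complex.exp_conj, ← Complex.exp_add]
      simp
    rw [this, one_smul]⟩

lemma continuous_rotate {X : Type*} [TopologicalSpace X] {s : X → ℝ}
    {W : X → Matrix.unitaryGroup (Fin m) ℂ} (hs : Continuous s) (hW : Continuous W) :
    Continuous fun x => rotate (s x) (W x) := by
  refine Continuous.subtype_mk ?_ _
  have : Continuous fun x => (W x).1 := continuous_subtype_val.comp hW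
  fun_prop

lemma joined_rotate (s : ℝ) (W : Matrix.unitaryGroup (Fin m) ℂ) : Joined W (rotate s W) := by
  have hc : Continuous fun t : unitInterval => rotate (t * s) W :=
    continuous_rotate (by fun_prop) continuous_const
  exact ⟨⟨⟨_, hc⟩, by simp [rotate], by simp⟩⟩

/-- Only finitely many phases make -1 an eigenvalue, while the angles in (0, 1) give infinitely many
distinct phases. -/
lemma exists_rotate_injective (W : Matrix.unitaryGroup (Fin m) ℂ) :
    ∃ s : ℝ, ∀ v, ((rotate s W).1 + 1) *ᵥ v = 0 → v = 0 := by
  have hfin : {z : ℂ | z ∈ (-W.1).charpoly.roots}.Finite :=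
    (-W.1).charpoly.roots.toFinset.finite_toSet.subset fun z hz => by simpa using hz
  have hinj : Set.InjOn (fun s : ℝ => Complex.exp (-(s * Complex.I))) (Set.Ioo 0 1) := by
    intro s hs t ht hst
    have : Circle.exp (-s) = Circle.exp (-t) := by
      ext
      rw [Circle.coe_exp, Circle.coe_exp]
      push_cast
      rw [neg_mul, neg_mul]
      exact hst
    have := Circle.injective_arg.eq_iff.2 this
    rw [Circle.arg_exp (by linarith [hs.2, Real.pi_gt_three]) (by linarith [hs.1, Real.pi_pos]),
      Circle.arg_exp (by linarith [ht.2, Real.pi_gt_three]) (by linarith [ht.1, Real.pi_pos])]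
      at this
    linarith
  have hinf : ((fun s : ℝ => Complex.exp (-(s * Complex.I))) '' Set.Ioo 0 1).Infinite :=
    (Set.Ioo_infinite one_pos).image hinj
  obtain ⟨z, ⟨s, -, rfl⟩, hz⟩ := hinf.exists_notMem_finite hfin
  refine ⟨s, fun v hv => ?_⟩
  by_contra hv0
  apply hz
  refine mem_roots_charpoly.2 ⟨v, hv0, ?_⟩
  have h1 : Complex.exp (s * Complex.I) • (W.1 *ᵥ v) = -v := by
    rw [Matrix.add_mulVec, Matrix.one_mulVec] at hv
    rw [← Matrix.smul_mulVec]
    exact eq_neg_of_add_eq_zero_left hv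
  have h2 : W.1 *ᵥ v = Complex.exp (-(s * Complex.I)) • (-v) := by
    rw [← h1, smul_smul, ← Complex.exp_add]
    simp
  rw [Matrix.neg_mulVec, h2, smul_neg, neg_neg]

/-- Connectedness of `U(m)` is what makes a continuous real function on it constant as soon as its
exponential is. -/
instance : PathConnectedSpace (Matrix.unitaryGroup (Fin m) ℂ) where
  nonempty := ⟨1⟩
  joined := by
    have h : ∀ W : Matrix.unitaryGroup (Fin m) ℂ, Joined 1 W := fun W => by
      obtain ⟨s, hs⟩ := exists_rotate_injective W
      exact (joined_one_of_injective _ hs).trans (joined_rotate s W).symm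
    exact fun V W => (h V).symm.trans (h W)

lemma star_det_mul_det (W : Matrix.unitaryGroup (Fin m) ℂ) : star W.1.det * W.1.det = 1 := by
  have hW : star W.1 * W.1 = 1 := Matrix.mem_unitaryGroup_iff'.1 W.2
  have := congrArg Matrix.det hW
  rwa [Matrix.det_mul, Matrix.det_one, Matrix.star_eq_conjTranspose, Matrix.det_conjTranspose]
    at this

lemma det_ne_zero_of_unitary (W : Matrix.unitaryGroup (Fin m) ℂ) : W.1.det ≠ 0 :=
  right_ne_zero_of_mul_eq_one (star_det_mul_det W)

/-- Multiplication of the first column by the inverse of the determinant. -/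
def normalizeDet (i : Fin m) (W : Matrix.unitaryGroup (Fin m) ℂ) :
    Matrix.specialUnitaryGroup (Fin m) ℂ :=
  ⟨W.1 * Matrix.diagonal (Function.update 1 i (star W.1.det)), by
    rw [Matrix.mem_specialUnitaryGroup_iff]
    constructor
    · refine mul_mem W.2 ?_
      rw [Matrix.mem_unitaryGroup_iff', Matrix.star_eq_conjTranspose,
        Matrix.diagonal_conjTranspose, Matrix.diagonal_mul_diagonal, ← Matrix.diagonal_one]
      congr 1
      ext j
      rcases eq_or_ne j i with rfl | h
      · have := star_det_mul_det W
        simpa [mul_comm] using this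
      · simp [h]
    · rw [Matrix.det_mul, Matrix.det_diagonal, Finset.prod_update_of_mem (Finset.mem_univ i)]
      simpa [mul_comm] using star_det_mul_det W⟩

/-- `SU(m)` is a continuous image of `U(m)` under a retraction that rescales one column; m = 0 has
no column and is separate. -/
instance : PreconnectedSpace (Matrix.specialUnitaryGroup (Fin m) ℂ) := by
  rcases Nat.eq_zero_or_pos m with rfl | hm
  · have : Subsingleton (Matrix.specialUnitaryGroup (Fin 0) ℂ) :=
      ⟨fun a b => Subtype.ext (Subsingleton.elim _ _)⟩
    infer_instance
  · have hc : Continuous (normalizeDet (⟨0, hm⟩ : Fin m)) := by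
      refine Continuous.subtype_mk ?_ _
      have : Continuous fun W : Matrix.unitaryGroup (Fin m) ℂ => W.1 := continuous_subtype_val
      refine this.matrix_mul (Continuous.matrix_diagonal ?_)
      exact continuous_const.update _ this.matrix_det.star
    have hs : Function.Surjective (normalizeDet (⟨0, hm⟩ : Fin m)) := fun S => by
      obtain ⟨h1, h2⟩ := Matrix.mem_specialUnitaryGroup_iff.1 S.2
      refine ⟨⟨S.1, h1⟩, Subtype.ext ?_⟩
      simp [normalizeDet, h2]
    exact ⟨hs.range_eq ▸ isPreconnected_range hc⟩

lemma continuous_coverMap {Θ : Type*} [TopologicalSpace Θ] :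
    Continuous (coverMap : Θ × ℝ × Matrix.specialUnitaryGroup (Fin m) ℂ → _) := by
  refine continuous_fst.prodMk (Continuous.subtype_mk ?_ _)
  have : Continuous fun p : Θ × ℝ × Matrix.specialUnitaryGroup (Fin m) ℂ => p.2.2.1 :=
    continuous_subtype_val.comp (continuous_snd.comp continuous_snd)
  fun_prop

end Unitary

/-! ### The action on the unitary group as a fractional linear map -/

section FractionalLinear

variable {m : ℕ}

lemma star_dotProduct_self {ι : Type*} [Fintype ι] (x : ι → ℂ) :
    star x ⬝ᵥ x = ((∑ i, ‖x i‖ ^ 2 : ℝ) : ℂ) := by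
  simp [dotProduct, Complex.conj_mul']

lemma sum_norm_sq_pos {ι : Type*} [Fintype ι] {x : ι → ℂ} (hx : x ≠ 0) :
    0 < ∑ i, ‖x i‖ ^ 2 := by
  obtain ⟨i, hi⟩ := Function.ne_iff.1 hx
  exact Finset.sum_pos' (fun _ _ => by positivity)
    ⟨i, Finset.mem_univ i, by have : 0 < ‖x i‖ := norm_pos_iff.2 hi; positivity⟩

lemma star_dotProduct_mulVec_mulVec {ι κ : Type*} [Fintype ι] [Fintype κ] (A : Matrix κ ι ℂ)
    (x : ι → ℂ) : star (A *ᵥ x) ⬝ᵥ (A *ᵥ x) = star x ⬝ᵥ ((Aᴴ * A) *ᵥ x) := by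
  rw [Matrix.star_mulVec, ← Matrix.dotProduct_mulVec, Matrix.mulVec_mulVec]

/-- The coefficient `a` in `W_{MΛ} = (a W + b)(c W + d)⁻¹`. -/
def coeffA (M : Matrix (Fin m ⊕ Fin m) (Fin m ⊕ Fin m) ℂ) : Matrix (Fin m) (Fin m) ℂ :=
  M.toBlocks₁₁ - Complex.I • M.toBlocks₁₂ + Complex.I • M.toBlocks₂₁ + M.toBlocks₂₂

/-- The coefficient `b` in `W_{MΛ} = (a W + b)(c W + d)⁻¹`. -/
def coeffB (M : Matrix (Fin m ⊕ Fin m) (Fin m ⊕ Fin m) ℂ) : Matrix (Fin m) (Fin m) ℂ :=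
  M.toBlocks₁₁ + Complex.I • M.toBlocks₁₂ + Complex.I • M.toBlocks₂₁ - M.toBlocks₂₂

/-- The coefficient `c` in `W_{MΛ} = (a W + b)(c W + d)⁻¹`. -/
def coeffC (M : Matrix (Fin m ⊕ Fin m) (Fin m ⊕ Fin m) ℂ) : Matrix (Fin m) (Fin m) ℂ :=
  M.toBlocks₁₁ - Complex.I • M.toBlocks₁₂ - Complex.I • M.toBlocks₂₁ - M.toBlocks₂₂

/-- The coefficient `d` in `W_{MΛ} = (a W + b)(c W + d)⁻¹`. -/
def coeffD (M : Matrix (Fin m ⊕ Fin m) (Fin m ⊕ Fin m) ℂ) : Matrix (Fin m) (Fin m) ℂ :=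
  M.toBlocks₁₁ + Complex.I • M.toBlocks₁₂ - Complex.I • M.toBlocks₂₁ + M.toBlocks₂₂

lemma act_ofUnitary_mat (M : HSp m) (W : Matrix.unitaryGroup (Fin m) ℂ) :
    (LagrangianFrame.act M (LagrangianFrame.ofUnitary W)).mat = Matrix.fromRows
      (M.1.toBlocks₁₁ * (W.1 + 1) + M.1.toBlocks₁₂ * (Complex.I • (1 - W.1)))
      (M.1.toBlocks₂₁ * (W.1 + 1) + M.1.toBlocks₂₂ * (Complex.I • (1 - W.1))) := by
  change M.1 * Matrix.fromRows _ _ = _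
  conv_lhs => rw [← Matrix.fromBlocks_toBlocks M.1, Matrix.fromBlocks_mul_fromRows]

lemma act_add (M : HSp m) (W : Matrix.unitaryGroup (Fin m) ℂ) :
    (LagrangianFrame.act M (LagrangianFrame.ofUnitary W)).X
      + Complex.I • (LagrangianFrame.act M (LagrangianFrame.ofUnitary W)).Y
      = coeffA M.1 * W.1 + coeffB M.1 := by
  simp only [LagrangianFrame.X, LagrangianFrame.Y, act_ofUnitary_mat, Matrix.toRows₁_fromRows,
    Matrix.toRows₂_fromRows, coeffA, coeffB, mul_add, add_mul, sub_mul, mul_sub, smul_add, smul_sub,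
    Matrix.mul_smul, Matrix.smul_mul, smul_smul, Complex.I_mul_I, mul_one]
  module

lemma act_sub (M : HSp m) (W : Matrix.unitaryGroup (Fin m) ℂ) :
    (LagrangianFrame.act M (LagrangianFrame.ofUnitary W)).X
      - Complex.I • (LagrangianFrame.act M (LagrangianFrame.ofUnitary W)).Y
      = coeffC M.1 * W.1 + coeffD M.1 := by
  simp only [LagrangianFrame.X, LagrangianFrame.Y, act_ofUnitary_mat, Matrix.toRows₁_fromRows,
    Matrix.toRows₂_fromRows, coeffC, coeffD, mul_add, sub_mul, mul_sub, smul_add, smul_sub,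
    Matrix.mul_smul, Matrix.smul_mul, smul_smul, Complex.I_mul_I, mul_one]
  module

lemma det_toUnitary_mul (L : LagrangianFrame m) :
    L.toUnitary.1.det * (L.X - Complex.I • L.Y).det = (L.X + Complex.I • L.Y).det := by
  have hu := (Matrix.isUnit_iff_isUnit_det _).1 L.isUnit_sub
  rw [← Matrix.det_mul]
  change ((L.X + _) * (L.X - _)⁻¹ * _).det = _
  rw [Matrix.mul_assoc, Matrix.nonsing_inv_mul _ hu, Matrix.mul_one]

/-- The defining relation makes -J Mᴴ J a left inverse of M. For square matrices it is also a right
inverse, so the group is closed under adjoints. -/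
lemma HSp.mul_J_mul (M : HSp m) : M.1 * Matrix.J (Fin m) ℂ * M.1ᴴ = Matrix.J (Fin m) ℂ := by
  have hM : M.1ᴴ * Matrix.J (Fin m) ℂ * M.1 = Matrix.J (Fin m) ℂ := M.2
  have h1 : (-(Matrix.J (Fin m) ℂ) * M.1ᴴ * Matrix.J (Fin m) ℂ) * M.1 = 1 := by
    rw [Matrix.mul_assoc, Matrix.mul_assoc, ← Matrix.mul_assoc _ _ M.1, hM, Matrix.neg_mul,
      Matrix.J_squared, neg_neg]
  have h2 := mul_eq_one_comm.1 h1
  have h3 : M.1 * Matrix.J (Fin m) ℂ * M.1ᴴ * Matrix.J (Fin m) ℂ = -1 := by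
    rw [← h2]; simp only [Matrix.neg_mul, Matrix.mul_neg, neg_neg, Matrix.mul_assoc]
  have h4 : M.1 * Matrix.J (Fin m) ℂ * M.1ᴴ * (Matrix.J (Fin m) ℂ * Matrix.J (Fin m) ℂ)
      = -1 * Matrix.J (Fin m) ℂ := by rw [← Matrix.mul_assoc, h3]
  rw [Matrix.J_squared] at h4
  simpa using h4

lemma HSp.block_relations (M : HSp m) :
    M.1.toBlocks₁₂ * M.1.toBlocks₁₁ᴴ = M.1.toBlocks₁₁ * M.1.toBlocks₁₂ᴴ ∧
    M.1.toBlocks₂₂ * M.1.toBlocks₂₁ᴴ = M.1.toBlocks₂₁ * M.1.toBlocks₂₂ᴴ ∧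
    M.1.toBlocks₂₂ * M.1.toBlocks₁₁ᴴ = 1 + M.1.toBlocks₂₁ * M.1.toBlocks₁₂ᴴ ∧
    M.1.toBlocks₁₁ * M.1.toBlocks₂₂ᴴ = 1 + M.1.toBlocks₁₂ * M.1.toBlocks₂₁ᴴ := by
  have h := HSp.mul_J_mul M
  rw [← Matrix.fromBlocks_toBlocks M.1, Matrix.J, Matrix.fromBlocks_conjTranspose,
    Matrix.fromBlocks_multiply, Matrix.fromBlocks_multiply, Matrix.fromBlocks_inj] at h
  simp only [Matrix.mul_zero, Matrix.mul_one, zero_add, add_zero, Matrix.mul_neg,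
    Matrix.neg_mul] at h
  obtain ⟨h1, h2, h3, h4⟩ := h
  refine ⟨?_, ?_, ?_, ?_⟩
  · rwa [← sub_eq_add_neg, sub_eq_zero] at h1
  · rwa [← sub_eq_add_neg, sub_eq_zero] at h4
  · rw [← h3]; abel
  · rw [← neg_eq_iff_eq_neg.2 h2]; abel

/-- The Cayley transform turns the symplectic form into one of signature (m, m). The coefficients a,
b, c, d omit the factor 1/2, hence the 4. This makes d invertible and d⁻¹c a strict contraction. -/
lemma coeffD_mul_conjTranspose (M : HSp m) :
    coeffD M.1 * (coeffD M.1)ᴴ = coeffC M.1 * (coeffC M.1)ᴴ + (4 : ℂ) • 1 := by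
  obtain ⟨h1, h2, h3, h4⟩ := HSp.block_relations M
  simp only [coeffC, coeffD, Matrix.conjTranspose_add, Matrix.conjTranspose_sub,
    Matrix.conjTranspose_smul, mul_add, add_mul, sub_mul, mul_sub, RCLike.star_def, Complex.conj_I,
    Matrix.mul_smul, Matrix.smul_mul, smul_smul, Complex.I_mul_I, h1, h2, h3, h4,
    neg_mul]
  module

/-- The off-diagonal relation of the same transform; it yields b = a Qᴴ with Q = d⁻¹c. -/
lemma coeffA_mul_conjTranspose (M : HSp m) :
    coeffA M.1 * (coeffC M.1)ᴴ = coeffB M.1 * (coeffD M.1)ᴴ := by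
  obtain ⟨h1, h2, h3, h4⟩ := HSp.block_relations M
  simp only [coeffA, coeffB, coeffC, coeffD, Matrix.conjTranspose_add, Matrix.conjTranspose_sub,
    Matrix.conjTranspose_smul, mul_add, add_mul, sub_mul, mul_sub, RCLike.star_def, Complex.conj_I,
    Matrix.mul_smul, Matrix.smul_mul, smul_smul, Complex.I_mul_I, h1, h2, h3, h4,
    neg_mul]
  module

lemma det_coeffD_ne_zero (M : HSp m) : (coeffD M.1).det ≠ 0 := by
  intro h0
  have h1 : ((coeffD M.1)ᴴ).det = 0 := by rw [Matrix.det_conjTranspose, h0, star_zero]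
  obtain ⟨v, hv, h2⟩ := Matrix.exists_mulVec_eq_zero_iff.2 h1
  have h3 := star_dotProduct_mulVec_mulVec (coeffD M.1)ᴴ v
  have h4 := star_dotProduct_mulVec_mulVec (coeffC M.1)ᴴ v
  rw [Matrix.conjTranspose_conjTranspose] at h3 h4
  rw [coeffD_mul_conjTranspose, Matrix.add_mulVec, dotProduct_add, ← h4, h2, Matrix.smul_mulVec,
    Matrix.one_mulVec, dotProduct_smul, star_dotProduct_self, star_dotProduct_self] at h3
  have h5 := sum_norm_sq_pos hv
  have h6 : 0 ≤ ∑ i, ‖((coeffC M.1)ᴴ *ᵥ v) i‖ ^ 2 := by positivity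
  rw [star_dotProduct_self, smul_eq_mul] at h3
  have h7 : ∑ i, ‖(0 : Fin m → ℂ) i‖ ^ 2 = ∑ i, ‖((coeffC M.1)ᴴ *ᵥ v) i‖ ^ 2 + 4 * ∑ i, ‖v i‖ ^ 2 := by
    exact_mod_cast h3
  simp only [Pi.zero_apply, norm_zero, ne_eq, OfNat.ofNat_ne_zero, not_false_eq_true, zero_pow,
    Finset.sum_const_zero] at h7
  linarith

/-- The contraction `Q = d⁻¹ c`. -/
def contraction (M : Matrix (Fin m ⊕ Fin m) (Fin m ⊕ Fin m) ℂ) : Matrix (Fin m) (Fin m) ℂ :=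
  (coeffD M)⁻¹ * coeffC M

lemma coeffD_mul_contraction (M : HSp m) : coeffD M.1 * contraction M.1 = coeffC M.1 := by
  rw [contraction, ← Matrix.mul_assoc, Matrix.mul_nonsing_inv _ (det_coeffD_ne_zero M).isUnit,
    Matrix.one_mul]

/-- Since Q is a strict contraction and W is unitary, the eigenvalues of QW lie in the open unit
disc. -/
lemma re_pos_of_mem_roots (M : HSp m) (W : Matrix.unitaryGroup (Fin m) ℂ) {μ : ℂ}
    (h : μ ∈ (1 + contraction M.1 * W.1).charpoly.roots) : 0 < μ.re := by
  rw [Polynomial.mem_roots (Matrix.charpoly_monic _).ne_zero, Polynomial.IsRoot,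
    Matrix.eval_charpoly] at h
  by_contra hμ
  -- The adjoint is taken because d dᴴ = c cᴴ + 4 compares the norms of dᴴv and cᴴv. A kernel vector
  -- gives |μ - 1| ‖dᴴv‖ = ‖cᴴv‖, which is impossible when |μ - 1| ≥ 1.
  have hdet : ((((μ - 1) • coeffD M.1 - coeffC M.1 * W.1))ᴴ).det = 0 := by
    have : (μ - 1) • coeffD M.1 - coeffC M.1 * W.1
        = coeffD M.1 * (Matrix.scalar (Fin m) μ - (1 + contraction M.1 * W.1)) := by
      rw [mul_sub, mul_add, ← Matrix.mul_assoc, coeffD_mul_contraction, mul_one, sub_smul,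
        one_smul, Matrix.scalar_apply, ← Matrix.smul_one_eq_diagonal, Matrix.mul_smul, mul_one]
      abel
    rw [Matrix.det_conjTranspose, this, Matrix.det_mul, h, mul_zero, star_zero]
  obtain ⟨v, hv, hv0⟩ := Matrix.exists_mulVec_eq_zero_iff.2 hdet
  have e1 : star (μ - 1) • ((coeffD M.1)ᴴ *ᵥ v) = W.1ᴴ *ᵥ ((coeffC M.1)ᴴ *ᵥ v) := by
    rw [Matrix.conjTranspose_sub, Matrix.conjTranspose_smul, Matrix.conjTranspose_mul,
      Matrix.sub_mulVec, sub_eq_zero, Matrix.smul_mulVec, ← Matrix.mulVec_mulVec] at hv0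
    exact hv0
  have hW : W.1 * W.1ᴴ = 1 := Matrix.mem_unitaryGroup_iff.1 W.2
  have e2 := star_dotProduct_mulVec_mulVec W.1ᴴ ((coeffC M.1)ᴴ *ᵥ v)
  rw [Matrix.conjTranspose_conjTranspose, hW, Matrix.one_mulVec, ← e1, star_dotProduct_self,
    star_dotProduct_self] at e2
  have h3 := star_dotProduct_mulVec_mulVec (coeffD M.1)ᴴ v
  have h4 := star_dotProduct_mulVec_mulVec (coeffC M.1)ᴴ v
  rw [Matrix.conjTranspose_conjTranspose] at h3 h4
  rw [coeffD_mul_conjTranspose, Matrix.add_mulVec, dotProduct_add, ← h4, Matrix.smul_mulVec,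
    Matrix.one_mulVec, dotProduct_smul, star_dotProduct_self, star_dotProduct_self,
    star_dotProduct_self, smul_eq_mul] at h3
  have h7 : ∑ i, ‖((coeffD M.1)ᴴ *ᵥ v) i‖ ^ 2
      = ∑ i, ‖((coeffC M.1)ᴴ *ᵥ v) i‖ ^ 2 + 4 * ∑ i, ‖v i‖ ^ 2 := by exact_mod_cast h3
  have h8 : ∑ i, ‖(star (μ - 1) • ((coeffD M.1)ᴴ *ᵥ v)) i‖ ^ 2
      = ∑ i, ‖((coeffC M.1)ᴴ *ᵥ v) i‖ ^ 2 := by exact_mod_cast e2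
  simp only [Pi.smul_apply, norm_smul, mul_pow, ← Finset.mul_sum, norm_star] at h8
  have h5 := sum_norm_sq_pos hv
  have h6 : 0 ≤ ∑ i, ‖((coeffC M.1)ᴴ *ᵥ v) i‖ ^ 2 := by positivity
  have h9 : 1 ≤ ‖μ - 1‖ ^ 2 := by
    have : ‖μ - 1‖ ^ 2 = (μ.re - 1) ^ 2 + μ.im ^ 2 := by
      rw [← Complex.normSq_eq_norm_sq, Complex.normSq_apply]; simp; ring
    rw [this]
    nlinarith [sq_nonneg μ.im]
  rw [h7] at h8
  nlinarith

lemma one_add_contraction_mem (M : HSp m) (W : Matrix.unitaryGroup (Fin m) ℂ) :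
    1 + contraction M.1 * W.1 ∈ slitMatrices (Fin m) :=
  mem_slitMatrices_of_re_pos fun _ h => re_pos_of_mem_roots M W h

lemma abs_argDet_contraction_le (M : HSp m) (W : Matrix.unitaryGroup (Fin m) ℂ) :
    |argDet (1 + contraction M.1 * W.1)| ≤ m * (Real.pi / 2) := by
  simpa using abs_argDet_le fun _ h => re_pos_of_mem_roots M W h

/-- From b = a Qᴴ one gets aW + b = a(1 + QᴴWᴴ)W, and det(1 + QᴴWᴴ) is the conjugate of det(1 + QW)
by the Sylvester identity. So the W-dependent factors of numerator and denominator are conjugate, up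
to det W. -/
lemma star_det_one_add_contraction (M : HSp m) (W : Matrix.unitaryGroup (Fin m) ℂ) :
    (coeffA M.1 * W.1 + coeffB M.1).det
      = W.1.det * (coeffA M.1).det * star (1 + contraction M.1 * W.1).det := by
  have hW : W.1ᴴ * W.1 = 1 := Matrix.mem_unitaryGroup_iff'.1 W.2
  have hB : coeffB M.1 = coeffA M.1 * (contraction M.1)ᴴ := by
    have hu : IsUnit ((coeffD M.1)ᴴ).det := by
      rw [Matrix.det_conjTranspose]; exact (star_ne_zero.2 (det_coeffD_ne_zero M)).isUnit
    rw [contraction, Matrix.conjTranspose_mul, ← Matrix.mul_assoc, coeffA_mul_conjTranspose,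
      Matrix.conjTranspose_nonsing_inv, Matrix.mul_assoc, Matrix.mul_nonsing_inv _ hu,
      Matrix.mul_one]
  have h1 : coeffA M.1 * W.1 + coeffB M.1
      = coeffA M.1 * (1 + (contraction M.1)ᴴ * W.1ᴴ) * W.1 := by
    rw [mul_add, add_mul, mul_one, hB, Matrix.mul_assoc (coeffA M.1) _ W.1,
      Matrix.mul_assoc _ _ W.1, hW, Matrix.mul_one]
  rw [h1, Matrix.det_mul, Matrix.det_mul, ← Matrix.det_conjTranspose, Matrix.conjTranspose_add,
    Matrix.conjTranspose_mul, Matrix.conjTranspose_one, Matrix.det_one_add_mul_comm]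
  ring

/-- The determinant of `W_{MΛ}` in terms of that of `W_Λ`. -/
lemma det_act (M : HSp m) (W : Matrix.unitaryGroup (Fin m) ℂ) :
    (LagrangianFrame.act M (LagrangianFrame.ofUnitary W)).toUnitary.1.det
      = W.1.det * ((coeffA M.1).det / (coeffD M.1).det
        / Complex.exp (2 * argDet (1 + contraction M.1 * W.1) * Complex.I)) := by
  have h1 := det_toUnitary_mul (LagrangianFrame.act M (LagrangianFrame.ofUnitary W))
  have h2 : coeffC M.1 * W.1 + coeffD M.1 = coeffD M.1 * (1 + contraction M.1 * W.1) := by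
    rw [mul_add, ← Matrix.mul_assoc, coeffD_mul_contraction, mul_one, add_comm]
  have hq := det_ne_zero_of_mem_slitMatrices (one_add_contraction_mem M W)
  have hd := det_coeffD_ne_zero M
  rw [act_sub, act_add, star_det_one_add_contraction, h2, Matrix.det_mul] at h1
  rw [exp_two_mul_argDet hq]
  have hq' := star_ne_zero.2 hq
  field_simp
  linear_combination h1

/-- A continuous displacement on `U(m)` of an element of `HSp(2m, ℂ)` oscillates by at most
`m`. -/
lemma abs_displacement_sub_le (M : HSp m) {D : Matrix.unitaryGroup (Fin m) ℂ → ℝ}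
    (hD : Continuous D)
    (h : ∀ W, (LagrangianFrame.act M (LagrangianFrame.ofUnitary W)).toUnitary.1.det
      = W.1.det * Complex.exp (2 * Real.pi * D W * Complex.I))
    (V W : Matrix.unitaryGroup (Fin m) ℂ) : |D V - D W| ≤ m := by
  -- By `det_act`, u is an argument of det a / det d, which does not involve W. On the connected
  -- group `U(m)` it is constant, so πD oscillates exactly as `argDet`, which stays within mπ/2 of
  -- zero.
  let u : Matrix.unitaryGroup (Fin m) ℂ → ℝ := fun W =>
    2 * Real.pi * D W + 2 * argDet (1 + contraction M.1 * W.1)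
  have hu : Continuous u := by
    refine (hD.const_mul _).add (Continuous.const_mul ?_ _)
    refine continuousOn_argDet.comp_continuous ?_ (one_add_contraction_mem M)
    exact continuous_const.add (continuous_const.matrix_mul continuous_subtype_val)
  have hc : ∀ W, Complex.exp (u W * Complex.I) = (coeffA M.1).det / (coeffD M.1).det := by
    intro W
    have h1 := h W
    rw [det_act, mul_right_inj' (det_ne_zero_of_unitary W), div_eq_iff (Complex.exp_ne_zero _),
      ← Complex.exp_add] at h1
    rw [h1]
    congr 1
    simp only [u]
    push_cast
    ring
  have h1 := eq_of_exp_eq hu hc V W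
  have h2 := abs_le.1 (abs_argDet_contraction_le M V)
  have h3 := abs_le.1 (abs_argDet_contraction_le M W)
  simp only [u] at h1
  have hpi := Real.pi_pos
  have h4 : Real.pi * (D V - D W) = argDet (1 + contraction M.1 * W.1)
      - argDet (1 + contraction M.1 * V.1) := by linarith
  rw [abs_le]
  constructor
  · by_contra hlt
    push Not at hlt
    nlinarith
  · by_contra hlt
    push Not at hlt
    nlinarith

end FractionalLinear

/-! ### Lifts of cocycles with a displacement function -/

section Lifts

lemma det_coverMap {Θ : Type*} {m : ℕ} (p : Θ × ℝ × Matrix.specialUnitaryGroup (Fin m) ℂ) :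
    (coverMap p).2.1.det = Complex.exp (2 * Real.pi * (m * p.2.1 : ℝ) * Complex.I) := by
  change (Complex.exp (2 * Real.pi * Complex.I * p.2.1) • p.2.2.1).det = _
  rw [Matrix.det_smul, (Matrix.mem_specialUnitaryGroup_iff.1 p.2.2.2).2, mul_one, Fintype.card_fin,
    ← Complex.exp_nat_mul]
  congr 1
  push_cast
  ring

variable {Θ : Type*} [TopologicalSpace Θ] {m : ℕ} {T : Θ ≃ₜ Θ} {A : C(Θ, HSp m)}
  {g : Θ × Matrix.unitaryGroup (Fin m) ℂ → ℝ}

/-- A continuous logarithm of the determinant of the fibre maps yields a lift. -/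
lemma exists_isLift (hm : 1 ≤ m) (hg : Continuous g)
    (h : ∀ p, (cocycleMap T A p).2.1.det
      = p.2.1.det * Complex.exp (2 * Real.pi * g p * Complex.I)) :
    ∃ F, IsLift T A F := by
  have hm' : (m : ℂ) ≠ 0 := by exact_mod_cast (by omega : m ≠ 0)
  -- Multiplication of a matrix by e^{2πix} shifts the logarithm of its determinant by mx, so g is
  -- divided by m. Removing the phase e^{2πiy} then leaves determinant one.
  let y : Θ × ℝ × Matrix.specialUnitaryGroup (Fin m) ℂ → ℝ := fun p => p.2.1 + g (coverMap p) / m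
  have hy : Continuous y := by
    have := hg.comp (continuous_coverMap (Θ := Θ) (m := m))
    have h2 : Continuous fun p : Θ × ℝ × Matrix.specialUnitaryGroup (Fin m) ℂ => p.2.1 := by
      fun_prop
    exact h2.add (this.div_const _)
  let V : Θ × ℝ × Matrix.specialUnitaryGroup (Fin m) ℂ → Matrix.unitaryGroup (Fin m) ℂ := fun p =>
    rotate (-(2 * Real.pi * y p)) (cocycleMap T A (coverMap p)).2
  have hV : Continuous V := continuous_rotate (by fun_prop)
    (continuous_snd.comp ((continuous_cocycleMap T A).comp continuous_coverMap))
  have hdet : ∀ p, (V p).1.det = 1 := fun p => by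
    change Matrix.det (Complex.exp _ • (cocycleMap T A (coverMap p)).2.1) = 1
    rw [Matrix.det_smul, h, det_coverMap, Fintype.card_fin, ← Complex.exp_nat_mul, ← Complex.exp_add,
      ← Complex.exp_add, Complex.exp_eq_one_iff]
    refine ⟨0, ?_⟩
    simp only [y]
    push_cast
    field_simp
    ring
  refine ⟨fun p => (T p.1, y p, ⟨(V p).1,
    Matrix.mem_specialUnitaryGroup_iff.2 ⟨(V p).2, hdet p⟩⟩), ⟨?_, fun p => ?_⟩⟩
  · exact (T.continuous.comp continuous_fst).prodMk
      (hy.prodMk (Continuous.subtype_mk (continuous_subtype_val.comp hV) _))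
  · refine Prod.ext rfl (Subtype.ext ?_)
    change Complex.exp _ • (Complex.exp _ • (cocycleMap T A (coverMap p)).2.1) = _
    rw [smul_smul, ← Complex.exp_add]
    have : 2 * (Real.pi : ℂ) * Complex.I * (y p : ℝ)
        + ((-(2 * Real.pi * y p) : ℝ) : ℂ) * Complex.I = 0 := by push_cast; ring
    change Complex.exp (2 * (Real.pi : ℂ) * Complex.I * (y p : ℝ)
        + ((-(2 * Real.pi * y p) : ℝ) : ℂ) * Complex.I) • _ = _
    rw [this, Complex.exp_zero, one_smul]

lemma exists_int_of_exp_eq_one {u : ℝ} (h : Complex.exp (2 * Real.pi * u * Complex.I) = 1) :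
    ∃ n : ℤ, u = n := by
  obtain ⟨n, hn⟩ := Complex.exp_eq_one_iff.1 h
  refine ⟨n, ?_⟩
  have h1 : (2 * Real.pi * Complex.I : ℂ) ≠ 0 := Complex.two_pi_I_ne_zero
  have h2 : (u : ℂ) = n := by
    apply mul_right_cancel₀ h1
    linear_combination hn
  exact_mod_cast h2

/-- The displacement of any lift differs from a given continuous logarithm by a continuous
integer-valued function on the base. -/
lemma exists_isDisplacement (hg : Continuous g)
    (h : ∀ p, (cocycleMap T A p).2.1.det
      = p.2.1.det * Complex.exp (2 * Real.pi * g p * Complex.I))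
    {F : Θ × ℝ × Matrix.specialUnitaryGroup (Fin m) ℂ →
      Θ × ℝ × Matrix.specialUnitaryGroup (Fin m) ℂ} (hF : IsLift T A F) :
    ∃ k : C(Θ, ℤ), IsDisplacement F (fun p => g p + k p.1) := by
  let u : Θ × ℝ × Matrix.specialUnitaryGroup (Fin m) ℂ → ℝ := fun p =>
    m * ((F p).2.1 - p.2.1) - g (coverMap p)
  have hu : Continuous u := by
    have h1 : Continuous fun p => (F p).2.1 :=
      continuous_fst.comp (continuous_snd.comp hF.continuous)
    have h2 := hg.comp (continuous_coverMap (Θ := Θ) (m := m))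
    exact ((h1.sub (by fun_prop)).const_mul _).sub h2
  have hexp : ∀ p, Complex.exp (2 * Real.pi * u p * Complex.I) = 1 := fun p => by
    have h1 := h (coverMap p)
    rw [← hF.semiconj, det_coverMap, det_coverMap, ← Complex.exp_add] at h1
    have h2 : 2 * Real.pi * u p * Complex.I = 2 * Real.pi * (m * (F p).2.1 : ℝ) * Complex.I
        - (2 * Real.pi * (m * p.2.1 : ℝ) * Complex.I
          + 2 * Real.pi * g (coverMap p) * Complex.I) := by
      simp only [u]; push_cast; ring
    rw [h2, Complex.exp_sub, h1, div_self (Complex.exp_ne_zero _)]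
  -- The fibre ℝ × SU(m) is connected, so the integer by which the two logarithms differ depends on
  -- θ alone and can be read off at (0, 1).
  have hconst : ∀ θ q q', u (θ, q) = u (θ, q') := fun θ q q' => by
    have hc : Continuous fun q : ℝ × Matrix.specialUnitaryGroup (Fin m) ℂ =>
        2 * Real.pi * u (θ, q) := by
      have := hu.comp (Continuous.prodMk_right θ)
      exact this.const_mul _
    have := eq_of_exp_eq hc (c := 1) (fun q => by
      have := hexp (θ, q)
      push_cast
      exact this) q q'
    exact mul_left_cancel₀ (by positivity : 2 * Real.pi ≠ 0) this
  choose k hk using fun θ => exists_int_of_exp_eq_one (hexp (θ, 0, 1))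
  have hkc : Continuous k := by
    rw [Int.isClosedEmbedding_coe_real.isInducing.continuous_iff]
    have : (fun θ => u (θ, 0, 1)) = ((↑) : ℤ → ℝ) ∘ k := funext hk
    rw [← this]
    exact hu.comp (Continuous.prodMk_left _)
  refine ⟨⟨k, hkc⟩, ⟨?_, fun p => ?_⟩⟩
  · refine hg.add ?_
    exact (continuous_of_discreteTopology (f := ((↑) : ℤ → ℝ))).comp (hkc.comp continuous_fst)
  · have h1 : u p = k p.1 := (hconst p.1 p.2 (0, 1)).trans (hk p.1)
    change g (coverMap p) + k p.1 = _
    rw [← h1]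
    simp only [u]
    ring

end Lifts

/-! ### The displacement of the Schrödinger cocycle -/

section SchrodingerDisplacement

variable {m : ℕ}

lemma roots_im_pos {ι : Type*} [Fintype ι] [DecidableEq ι] {K : Matrix ι ι ℂ}
    (h : ∀ v, v ≠ 0 → 0 < (star v ⬝ᵥ (K *ᵥ v)).im) {μ : ℂ} (hμ : μ ∈ K.charpoly.roots) :
    0 < μ.im := by
  obtain ⟨v, hv, h1⟩ := mem_roots_charpoly.1 hμ
  have h2 := h v hv
  rw [h1, dotProduct_smul, star_dotProduct_self, smul_eq_mul, Complex.im_mul_ofReal] at h2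
  exact pos_of_mul_pos_left h2 (sum_norm_sq_pos hv).le

lemma mem_slitMatrices_of_im_pos {ι : Type*} [Fintype ι] [DecidableEq ι] {K : Matrix ι ι ℂ}
    (h : ∀ v, v ≠ 0 → 0 < (star v ⬝ᵥ (K *ᵥ v)).im) : K ∈ slitMatrices ι :=
  fun _ hμ => Or.inr (roots_im_pos h hμ).ne'

/-- The matrix `E - B + i (1 + C* C)`. -/
def dissipative (C : GL (Fin m) ℂ) (E : ℝ) (B : Matrix (Fin m) (Fin m) ℂ) :
    Matrix (Fin m) (Fin m) ℂ :=
  (E : ℂ) • 1 - B + Complex.I • (1 + C.1ᴴ * C.1)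

lemma im_dissipative_pos (C : GL (Fin m) ℂ) (E : ℝ) (B : selfAdjoint (Matrix (Fin m) (Fin m) ℂ))
    (v : Fin m → ℂ) (hv : v ≠ 0) : 0 < (star v ⬝ᵥ (dissipative C E B.1 *ᵥ v)).im := by
  have h1 : (star v ⬝ᵥ (B.1 *ᵥ v)).im = 0 :=
    Matrix.IsHermitian.im_star_dotProduct_mulVec_self (𝕜 := ℂ) B.2 v
  have h2 := star_dotProduct_mulVec_mulVec C.1 v
  rw [dissipative, Matrix.add_mulVec, Matrix.sub_mulVec, Matrix.smul_mulVec, Matrix.smul_mulVec,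
    Matrix.add_mulVec, Matrix.one_mulVec, dotProduct_add, dotProduct_sub, dotProduct_smul,
    dotProduct_smul, dotProduct_add, ← h2, star_dotProduct_self, star_dotProduct_self]
  have h3 := sum_norm_sq_pos hv
  have h4 : 0 ≤ ∑ i, ‖(C.1 *ᵥ v) i‖ ^ 2 := by positivity
  rw [Complex.add_im, Complex.sub_im, h1, smul_eq_mul, smul_eq_mul, ← Complex.ofReal_mul,
    Complex.ofReal_im, ← Complex.ofReal_add, Complex.I_mul_im, Complex.ofReal_re]
  linarith

lemma dissipative_mem (C : GL (Fin m) ℂ) (E : ℝ) (B : selfAdjoint (Matrix (Fin m) (Fin m) ℂ)) :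
    dissipative C E B.1 ∈ slitMatrices (Fin m) :=
  mem_slitMatrices_of_im_pos (im_dissipative_pos C E B)

lemma GL.conjTranspose_eq (C : GL (Fin m) ℂ) : C.1ᴴ = C.1ᴴ * C.1 * (C⁻¹ : GL (Fin m) ℂ).1 := by
  rw [Matrix.mul_assoc, ← Units.val_mul, mul_inv_cancel, Units.val_one, Matrix.mul_one]

/-- Writing Cᴴ = CᴴC C⁻¹ pulls C⁻¹ out to the right. With K = `dissipative`, a = K C⁻¹ and d = Kᴴ
C⁻¹. Hence det a / det d is det K over its conjugate, and 2 `argDet` K is a continuous branch of its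
argument because K has positive imaginary part. -/
lemma coeffA_transferMatrix (C : GL (Fin m) ℂ) (E : ℝ) (B : Matrix (Fin m) (Fin m) ℂ) :
    coeffA (transferMatrix C E B) = dissipative C E B * (C⁻¹ : GL (Fin m) ℂ).1 := by
  simp only [coeffA, transferMatrix, Matrix.toBlocks_fromBlocks₁₁, Matrix.toBlocks_fromBlocks₁₂,
    Matrix.toBlocks_fromBlocks₂₁, Matrix.toBlocks_fromBlocks₂₂, dissipative, add_mul,
    Matrix.smul_mul, ← GL.conjTranspose_eq, one_mul]
  module

lemma coeffD_transferMatrix (C : GL (Fin m) ℂ) (E : ℝ)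
    (B : selfAdjoint (Matrix (Fin m) (Fin m) ℂ)) :
    coeffD (transferMatrix C E B.1) = (dissipative C E B.1)ᴴ * (C⁻¹ : GL (Fin m) ℂ).1 := by
  have hB : (B.1)ᴴ = B.1 := B.2
  simp only [coeffD, transferMatrix, Matrix.toBlocks_fromBlocks₁₁, Matrix.toBlocks_fromBlocks₁₂,
    Matrix.toBlocks_fromBlocks₂₁, Matrix.toBlocks_fromBlocks₂₂, dissipative,
    Matrix.conjTranspose_add, Matrix.conjTranspose_sub, Matrix.conjTranspose_smul,
    Matrix.conjTranspose_one, Matrix.conjTranspose_mul, Matrix.conjTranspose_conjTranspose, hB,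
    RCLike.star_def, Complex.conj_I, Complex.conj_ofReal, add_mul,
    Matrix.smul_mul, ← GL.conjTranspose_eq, one_mul]
  module

/-- The displacement of the Schrödinger cocycle that vanishes at infinite energy. -/
def displacement (C : GL (Fin m) ℂ) (E : ℝ) (B : Matrix (Fin m) (Fin m) ℂ)
    (W : Matrix (Fin m) (Fin m) ℂ) : ℝ :=
  (argDet (dissipative C E B) - argDet (1 + contraction (transferMatrix C E B) * W)) / Real.pi

lemma det_act_transferMatrix (C : GL (Fin m) ℂ) (E : ℝ)
    (B : selfAdjoint (Matrix (Fin m) (Fin m) ℂ)) (W : Matrix.unitaryGroup (Fin m) ℂ) :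
    (LagrangianFrame.act ⟨transferMatrix C E B.1, transferMatrix_mem C E B⟩
      (LagrangianFrame.ofUnitary W)).toUnitary.1.det
      = W.1.det * Complex.exp (2 * Real.pi * displacement C E B.1 W.1 * Complex.I) := by
  rw [det_act]
  congr 1
  have hC : (C⁻¹ : GL (Fin m) ℂ).1.det ≠ 0 :=
    ((Matrix.isUnit_iff_isUnit_det _).1 (C⁻¹ : GL (Fin m) ℂ).isUnit).ne_zero
  have hK := det_ne_zero_of_mem_slitMatrices (dissipative_mem C E B)
  change (coeffA (transferMatrix C E B.1)).det / (coeffD (transferMatrix C E B.1)).det / _ = _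
  rw [coeffA_transferMatrix, coeffD_transferMatrix, Matrix.det_mul, Matrix.det_mul,
    mul_div_mul_right _ _ hC, Matrix.det_conjTranspose, ← exp_two_mul_argDet hK, ← Complex.exp_sub]
  congr 1
  have hpi : (Real.pi : ℂ) ≠ 0 := by exact_mod_cast Real.pi_ne_zero
  simp only [displacement]
  push_cast
  field_simp

lemma tendsto_matrix_inv {X : Type*} {l : Filter X} {M : X → Matrix (Fin m) (Fin m) ℂ}
    {N : Matrix (Fin m) (Fin m) ℂ} (h : Tendsto M l (𝓝 N)) (hN : N.det ≠ 0) :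
    Tendsto (fun x => (M x)⁻¹) l (𝓝 N⁻¹) := by
  simp only [Matrix.inv_def, Ring.inverse_eq_inv']
  have h1 : Tendsto (fun x => (M x).det) l (𝓝 N.det) :=
    (continuous_id.matrix_det.tendsto N).comp h
  have h2 : Tendsto (fun x => (M x).adjugate) l (𝓝 N.adjugate) :=
    (continuous_id.matrix_adjugate.tendsto N).comp h
  exact (h1.inv₀ hN).smul h2

lemma continuous_displacement (C : GL (Fin m) ℂ) {X : Type*} [TopologicalSpace X] {E : X → ℝ}
    {B : X → selfAdjoint (Matrix (Fin m) (Fin m) ℂ)} {W : X → Matrix.unitaryGroup (Fin m) ℂ}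
    (hE : Continuous E) (hB : Continuous B) (hW : Continuous W) :
    Continuous fun x => displacement C (E x) (B x).1 (W x).1 := by
  have hB' : Continuous fun x => (B x).1 := continuous_subtype_val.comp hB
  have hW' : Continuous fun x => (W x).1 := continuous_subtype_val.comp hW
  refine Continuous.div_const (Continuous.sub ?_ ?_) _
  · refine continuousOn_argDet.comp_continuous ?_ fun x => dissipative_mem C (E x) (B x)
    unfold dissipative
    fun_prop
  · refine continuousOn_argDet.comp_continuous ?_ fun x =>
      one_add_contraction_mem ⟨transferMatrix C (E x) (B x).1, transferMatrix_mem C (E x) (B x)⟩ (W x)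
    refine continuous_const.add (Continuous.matrix_mul (Continuous.matrix_mul ?_ ?_) hW')
    · rw [continuous_iff_continuousAt]
      intro x
      refine tendsto_matrix_inv ?_ (det_coeffD_ne_zero
        ⟨transferMatrix C (E x) (B x).1, transferMatrix_mem C (E x) (B x)⟩)
      refine Continuous.tendsto ?_ x
      simp only [coeffD, transferMatrix, Matrix.toBlocks_fromBlocks₁₁,
        Matrix.toBlocks_fromBlocks₁₂, Matrix.toBlocks_fromBlocks₂₁, Matrix.toBlocks_fromBlocks₂₂]
      fun_prop
    · simp only [coeffC, transferMatrix, Matrix.toBlocks_fromBlocks₁₁,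
        Matrix.toBlocks_fromBlocks₁₂, Matrix.toBlocks_fromBlocks₂₁, Matrix.toBlocks_fromBlocks₂₂]
      fun_prop

lemma tendsto_inv_smul_energy (R S P : Matrix (Fin m) (Fin m) ℂ) :
    Tendsto (fun E : ℝ => (E⁻¹ : ℂ) • (((E : ℂ) • 1 - R) * P + S)) atTop (𝓝 P) := by
  have h1 : Tendsto (fun E : ℝ => (E⁻¹ : ℂ)) atTop (𝓝 0) := by
    have := (Complex.continuous_ofReal.tendsto 0).comp (tendsto_inv_atTop_zero (𝕜 := ℝ))
    simpa [Function.comp_def] using this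
  have h2 : Tendsto (fun E : ℝ => P + (E⁻¹ : ℂ) • (S - R * P)) atTop
      (𝓝 (P + (0 : ℂ) • (S - R * P))) := tendsto_const_nhds.add (h1.smul_const _)
  rw [zero_smul, add_zero] at h2
  refine h2.congr' ?_
  filter_upwards [eventually_gt_atTop 0] with E hE
  have hE' : (E : ℂ) ≠ 0 := by exact_mod_cast hE.ne'
  simp only [sub_mul, Matrix.smul_mul, Matrix.one_mul, smul_add, smul_sub, smul_smul,
    inv_mul_cancel₀ hE', one_smul]
  abel

/-- Only the upper left block grows with E, and it enters all four coefficients with the same sign.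
-/
lemma tendsto_coeff (C : GL (Fin m) ℂ) (B : Matrix (Fin m) (Fin m) ℂ) :
    (Tendsto (fun E : ℝ => (E⁻¹ : ℂ) • coeffA (transferMatrix C E B)) atTop
        (𝓝 (C⁻¹ : GL (Fin m) ℂ).1) ∧
      Tendsto (fun E : ℝ => (E⁻¹ : ℂ) • coeffB (transferMatrix C E B)) atTop
        (𝓝 (C⁻¹ : GL (Fin m) ℂ).1)) ∧
    Tendsto (fun E : ℝ => (E⁻¹ : ℂ) • coeffC (transferMatrix C E B)) atTop
        (𝓝 (C⁻¹ : GL (Fin m) ℂ).1) ∧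
      Tendsto (fun E : ℝ => (E⁻¹ : ℂ) • coeffD (transferMatrix C E B)) atTop
        (𝓝 (C⁻¹ : GL (Fin m) ℂ).1) := by
  simp only [coeffA, coeffB, coeffC, coeffD, transferMatrix, Matrix.toBlocks_fromBlocks₁₁,
    Matrix.toBlocks_fromBlocks₁₂, Matrix.toBlocks_fromBlocks₂₁, Matrix.toBlocks_fromBlocks₂₂,
    sub_eq_add_neg _ (Complex.I • _), add_zero, sub_zero, add_assoc]
  exact ⟨⟨tendsto_inv_smul_energy _ _ _, tendsto_inv_smul_energy _ _ _⟩,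
    tendsto_inv_smul_energy _ _ _, tendsto_inv_smul_energy _ _ _⟩

lemma eq_inv_mul_of_smul {c : ℂ} (hc : c ≠ 0) {D X Y : Matrix (Fin m) (Fin m) ℂ}
    (hD : D.det ≠ 0) (h : D * X = Y) : X = (c • D)⁻¹ * (c • Y) := by
  have hu : IsUnit (c • D).det := by
    rw [Matrix.det_smul]; exact (mul_ne_zero (pow_ne_zero _ hc) hD).isUnit
  rw [← h, ← Matrix.smul_mul, Matrix.nonsing_inv_mul_cancel_left _ _ hu]

lemma smul_mul_smul_inv {c : ℂ} (hc : c ≠ 0) {D : Matrix (Fin m) (Fin m) ℂ}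
    (hD : D.det ≠ 0) (N : Matrix (Fin m) (Fin m) ℂ) : (c • N) * (c • D)⁻¹ = N * D⁻¹ := by
  have hu : IsUnit (c • D).det := by
    rw [Matrix.det_smul]; exact (mul_ne_zero (pow_ne_zero _ hc) hD).isUnit
  have h : c • N = N * D⁻¹ * (c • D) := by
    rw [Matrix.mul_smul, Matrix.mul_assoc, Matrix.nonsing_inv_mul _ hD.isUnit, Matrix.mul_one]
  rw [h, Matrix.mul_assoc, Matrix.mul_nonsing_inv _ hu, Matrix.mul_one]

/-- K/E tends to 1 and Q tends to 1, so 1 + QW tends to 2, and `argDet` vanishes at positive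
scalars. This normalisation at infinite energy fixes the branch of the displacement. -/
lemma tendsto_displacement (C : GL (Fin m) ℂ) (B : selfAdjoint (Matrix (Fin m) (Fin m) ℂ))
    {W : ℝ → Matrix.unitaryGroup (Fin m) ℂ} (hW : Tendsto W atTop (𝓝 1)) :
    Tendsto (fun E => displacement C E B.1 (W E).1) atTop (𝓝 0) := by
  have hW' : Tendsto (fun E => (W E).1) atTop (𝓝 1) :=
    (continuous_subtype_val.tendsto (1 : Matrix.unitaryGroup (Fin m) ℂ)).comp hW
  have hC : (C⁻¹ : GL (Fin m) ℂ).1.det ≠ 0 :=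
    ((Matrix.isUnit_iff_isUnit_det _).1 (C⁻¹ : GL (Fin m) ℂ).isUnit).ne_zero
  have h1 : Tendsto (fun E : ℝ => argDet (dissipative C E B.1)) atTop (𝓝 0) := by
    have := tendsto_inv_smul_energy B.1 (Complex.I • (1 + C.1ᴴ * C.1)) 1
    simp only [Matrix.mul_one] at this
    have h := (continuousOn_argDet 1 one_mem_slitMatrices).tendsto.comp
      (tendsto_nhdsWithin_iff.2 ⟨this, by
        filter_upwards [eventually_gt_atTop 0] with E hE
        have := smul_mem_slitMatrices (inv_pos.2 hE) (dissipative_mem C E B)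
        rwa [Complex.ofReal_inv] at this⟩)
    rw [argDet_one] at h
    refine h.congr' ?_
    filter_upwards [eventually_gt_atTop 0] with E hE
    have := argDet_smul (inv_pos.2 hE) (dissipative C E B.1)
    rw [Complex.ofReal_inv] at this
    exact this
  have h2 : Tendsto (fun E : ℝ => argDet (1 + contraction (transferMatrix C E B.1) * (W E).1))
      atTop (𝓝 0) := by
    obtain ⟨-, hc, hd⟩ := tendsto_coeff C B.1
    have h3 : Tendsto (fun E : ℝ => contraction (transferMatrix C E B.1)) atTop (𝓝 1) := by
      have h4 := (tendsto_matrix_inv hd hC).mul hc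
      rw [Matrix.nonsing_inv_mul _ hC.isUnit] at h4
      refine h4.congr' ?_
      filter_upwards [eventually_gt_atTop 0] with E hE
      have hE' : (E⁻¹ : ℂ) ≠ 0 := inv_ne_zero (by exact_mod_cast hE.ne')
      exact (eq_inv_mul_of_smul hE' (det_coeffD_ne_zero ⟨_, transferMatrix_mem C E B⟩)
        (coeffD_mul_contraction ⟨_, transferMatrix_mem C E B⟩)).symm
    -- The limit 2 is written as a positive real multiple of 1 so that `argDet_smul` applies.
    have h5 : Tendsto (fun E : ℝ => 1 + contraction (transferMatrix C E B.1) * (W E).1) atTop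
        (𝓝 (((2 : ℝ) : ℂ) • 1)) := by
      have := (tendsto_const_nhds (x := (1 : Matrix (Fin m) (Fin m) ℂ))).add (h3.mul hW')
      rw [mul_one, ← two_smul ℂ] at this
      simpa using this
    have h := (continuousOn_argDet _ (smul_mem_slitMatrices two_pos one_mem_slitMatrices)).tendsto.comp
      (tendsto_nhdsWithin_iff.2 ⟨h5, Eventually.of_forall fun E =>
        one_add_contraction_mem ⟨_, transferMatrix_mem C E B⟩ (W E)⟩)
    rw [argDet_smul two_pos, argDet_one] at h
    exact h
  have := (h1.sub h2).div_const Real.pi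
  simpa [displacement] using this

/-- After division by E, numerator and denominator have the same invertible limit 2C⁻¹. So the orbit
of the horizontal subspace returns to it at high energy, and the previous limit can be iterated. -/
lemma tendsto_act_transferMatrix (C : GL (Fin m) ℂ) (B : selfAdjoint (Matrix (Fin m) (Fin m) ℂ))
    {W : ℝ → Matrix.unitaryGroup (Fin m) ℂ} (hW : Tendsto W atTop (𝓝 1)) :
    Tendsto (fun E => (LagrangianFrame.act ⟨transferMatrix C E B.1, transferMatrix_mem C E B⟩
      (LagrangianFrame.ofUnitary (W E))).toUnitary) atTop (𝓝 1) := by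
  have hW' : Tendsto (fun E => (W E).1) atTop (𝓝 1) :=
    (continuous_subtype_val.tendsto (1 : Matrix.unitaryGroup (Fin m) ℂ)).comp hW
  have hC : (C⁻¹ : GL (Fin m) ℂ).1.det ≠ 0 :=
    ((Matrix.isUnit_iff_isUnit_det _).1 (C⁻¹ : GL (Fin m) ℂ).isUnit).ne_zero
  rw [tendsto_subtype_rng]
  obtain ⟨⟨ha, hb⟩, hc, hd⟩ := tendsto_coeff C B.1
  set P := (C⁻¹ : GL (Fin m) ℂ).1 with hP
  have h1 := (ha.mul hW').add hb
  have h2 := (hc.mul hW').add hd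
  have hPP : P * 1 + P = (2 : ℂ) • P := by rw [mul_one, two_smul]
  rw [hPP] at h1 h2
  have h2P : ((2 : ℂ) • P).det ≠ 0 := by
    rw [Matrix.det_smul]; exact mul_ne_zero (pow_ne_zero _ two_ne_zero) hC
  have h3 := h1.mul (tendsto_matrix_inv h2 h2P)
  rw [Matrix.mul_nonsing_inv _ h2P.isUnit] at h3
  refine h3.congr' ?_
  filter_upwards [eventually_gt_atTop 0] with E hE
  have hE' : (E⁻¹ : ℂ) ≠ 0 := inv_ne_zero (by exact_mod_cast hE.ne')
  set M : HSp m := ⟨transferMatrix C E B.1, transferMatrix_mem C E B⟩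
  change _ = (_ + _) * (_ - _)⁻¹
  have hu : (coeffC M.1 * (W E).1 + coeffD M.1).det ≠ 0 := by
    rw [← act_sub]
    exact ((Matrix.isUnit_iff_isUnit_det _).1 (LagrangianFrame.isUnit_sub _)).ne_zero
  have e : ∀ X Y : Matrix (Fin m) (Fin m) ℂ, (E⁻¹ : ℂ) • X * (W E).1 + (E⁻¹ : ℂ) • Y
      = (E⁻¹ : ℂ) • (X * (W E).1 + Y) := fun X Y => by rw [Matrix.smul_mul, smul_add]
  rw [act_add, act_sub, e, e]
  exact smul_mul_smul_inv hE' hu _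

end SchrodingerDisplacement

/-! ### Iterates of cocycles -/

section Iterates

variable {Θ : Type*} [TopologicalSpace Θ] {m : ℕ}

/-- The product `A(T^{n-1}θ) ⋯ A(θ)`. -/
def cocycleProd (T : Θ ≃ₜ Θ) (A : C(Θ, HSp m)) (θ : Θ) : ℕ → HSp m
  | 0 => HSp.id m
  | n + 1 => ⟨(A (T^[n] θ)).1 * (cocycleProd T A θ n).1, by
      have h1 : (A (T^[n] θ)).1ᴴ * Matrix.J (Fin m) ℂ * (A (T^[n] θ)).1 = Matrix.J (Fin m) ℂ :=
        (A (T^[n] θ)).2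
      have h2 : (cocycleProd T A θ n).1ᴴ * Matrix.J (Fin m) ℂ * (cocycleProd T A θ n).1
          = Matrix.J (Fin m) ℂ := (cocycleProd T A θ n).2
      change _ * _ * _ = _
      calc _ = (cocycleProd T A θ n).1ᴴ * ((A (T^[n] θ)).1ᴴ * Matrix.J (Fin m) ℂ
            * (A (T^[n] θ)).1) * (cocycleProd T A θ n).1 := by
            rw [Matrix.conjTranspose_mul]; simp only [Matrix.mul_assoc]
        _ = _ := by rw [h1, h2]⟩

lemma act_cocycleProd_succ (T : Θ ≃ₜ Θ) (A : C(Θ, HSp m)) (θ : Θ) (n : ℕ)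
    (L : LagrangianFrame m) :
    LagrangianFrame.act (cocycleProd T A θ (n + 1)) L
      = LagrangianFrame.act (A (T^[n] θ)) (LagrangianFrame.act (cocycleProd T A θ n) L) := by
  simp only [cocycleProd]
  unfold LagrangianFrame.act
  congr 1
  exact Matrix.mul_assoc _ _ _

lemma iterate_cocycleMap (T : Θ ≃ₜ Θ) (A : C(Θ, HSp m)) (θ : Θ)
    (W : Matrix.unitaryGroup (Fin m) ℂ) (n : ℕ) :
    (cocycleMap T A)^[n] (θ, W) = (T^[n] θ,
      (LagrangianFrame.act (cocycleProd T A θ n) (LagrangianFrame.ofUnitary W)).toUnitary) := by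
  induction n with
  | zero =>
    have : LagrangianFrame.act (cocycleProd T A θ 0) (LagrangianFrame.ofUnitary W)
        = LagrangianFrame.ofUnitary W := by
      simp only [cocycleProd, HSp.id, LagrangianFrame.act, Matrix.one_mul]
    rw [this, LagrangianFrame.toUnitary_ofUnitary]
    rfl
  | succ n ih =>
    rw [Function.iterate_succ_apply', ih, Function.iterate_succ_apply', act_cocycleProd_succ,
      ← LagrangianFrame.toUnitary_act (A _)]
    rfl

variable {T : Θ ≃ₜ Θ} {A : C(Θ, HSp m)} {g : Θ × Matrix.unitaryGroup (Fin m) ℂ → ℝ}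

lemma det_iterate_cocycleMap
    (h : ∀ p, (cocycleMap T A p).2.1.det
      = p.2.1.det * Complex.exp (2 * Real.pi * g p * Complex.I))
    (p : Θ × Matrix.unitaryGroup (Fin m) ℂ) (n : ℕ) :
    ((cocycleMap T A)^[n] p).2.1.det = p.2.1.det
      * Complex.exp (2 * Real.pi * birkhoffSum (cocycleMap T A) g n p * Complex.I) := by
  induction n with
  | zero => simp
  | succ n ih =>
    rw [Function.iterate_succ_apply', h, ih, birkhoffSum_succ, mul_assoc, ← Complex.exp_add]
    congr 2
    push_cast
    ring

lemma continuous_birkhoffSum {X : Type*} [TopologicalSpace X] {S : X → X} {φ : X → ℝ}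
    (hS : Continuous S) (hφ : Continuous φ) (n : ℕ) : Continuous (birkhoffSum S φ n) := by
  unfold birkhoffSum
  exact continuous_finsetSum _ fun k _ => hφ.comp (hS.iterate k)

/-- Displacements along an orbit depend on the initial Lagrangian subspace only up to `m`. -/
lemma abs_birkhoffSum_sub_le (hg : Continuous g)
    (h : ∀ p, (cocycleMap T A p).2.1.det
      = p.2.1.det * Complex.exp (2 * Real.pi * g p * Complex.I))
    (θ : Θ) (V W : Matrix.unitaryGroup (Fin m) ℂ) (n : ℕ) :
    |birkhoffSum (cocycleMap T A) g n (θ, V) - birkhoffSum (cocycleMap T A) g n (θ, W)| ≤ m := by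
  -- The Birkhoff sum is a continuous displacement of the single matrix A(T^{n-1}θ) ⋯ A(θ), so the
  -- bound does not grow with n.
  refine abs_displacement_sub_le (cocycleProd T A θ n)
    (D := fun W => birkhoffSum (cocycleMap T A) g n (θ, W)) ?_ (fun W => ?_) V W
  · exact (continuous_birkhoffSum (continuous_cocycleMap T A) hg n).comp
      (Continuous.prodMk_right θ)
  · have := det_iterate_cocycleMap h (θ, W) n
    rwa [iterate_cocycleMap] at this

end Iterates

/-! ### Finite volume operators -/

section FiniteVolume

variable {Θ : Type*} [TopologicalSpace Θ] {m : ℕ}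

/-- The restriction of `H_θ` to the sites `0, …, n - 1`. -/
def finiteOp (T : Θ ≃ₜ Θ) (C : GL (Fin m) ℂ) (f : C(Θ, selfAdjoint (Matrix (Fin m) (Fin m) ℂ)))
    (θ : Θ) (n : ℕ) : Matrix (Fin n × Fin m) (Fin n × Fin m) ℂ :=
  Matrix.of fun p q => (if (q.1 : ℕ) + 1 = p.1 then C.1ᴴ p.2 q.2 else 0)
    + (if (p.1 : ℕ) = q.1 then (f (T^[p.1] θ)).1 p.2 q.2 else 0)
    + (if (p.1 : ℕ) + 1 = q.1 then C.1 p.2 q.2 else 0)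

/-- The inclusion of the last site. -/
def lastSite (n m : ℕ) : Matrix (Fin n × Fin m) (Fin m) ℂ :=
  Matrix.of fun p j => if (p.1 : ℕ) + 1 = n ∧ p.2 = j then 1 else 0

/-- Splitting off the last of `n + 1` sites. -/
def splitLast (n m : ℕ) : (Fin n × Fin m) ⊕ Fin m ≃ Fin (n + 1) × Fin m :=
  Equiv.ofBijective (Sum.elim (fun p => (p.1.castSucc, p.2)) fun j => (Fin.last n, j)) (by
    constructor
    · rintro (p | j) (q | k) h
      · simp only [Sum.elim_inl, Prod.mk.injEq, Fin.castSucc_inj] at h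
        rw [Prod.ext h.1 h.2]
      · simp only [Sum.elim_inl, Sum.elim_inr, Prod.mk.injEq] at h
        exact absurd h.1 (Fin.castSucc_lt_last _).ne
      · simp only [Sum.elim_inl, Sum.elim_inr, Prod.mk.injEq] at h
        exact absurd h.1.symm (Fin.castSucc_lt_last _).ne
      · simp only [Sum.elim_inr, Prod.mk.injEq] at h
        rw [h.2]
    · rintro ⟨k, j⟩
      rcases Fin.eq_castSucc_or_eq_last k with ⟨k, rfl⟩ | rfl
      · exact ⟨Sum.inl (k, j), rfl⟩
      · exact ⟨Sum.inr j, rfl⟩)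

@[simp] lemma splitLast_inl (n : ℕ) (p : Fin n × Fin m) :
    splitLast n m (Sum.inl p) = (p.1.castSucc, p.2) := rfl

@[simp] lemma splitLast_inr (n : ℕ) (j : Fin m) :
    splitLast n m (Sum.inr j) = (Fin.last n, j) := rfl

variable (T : Θ ≃ₜ Θ) (C : GL (Fin m) ℂ) (f : C(Θ, selfAdjoint (Matrix (Fin m) (Fin m) ℂ)))
  (θ : Θ)

lemma lastSite_mul_apply {κ : Type*} (n : ℕ) (M : Matrix (Fin m) κ ℂ) (p : Fin n × Fin m)
    (j : κ) : (lastSite n m * M) p j = if (p.1 : ℕ) + 1 = n then M p.2 j else 0 := by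
  rw [Matrix.mul_apply]
  by_cases h : (p.1 : ℕ) + 1 = n <;> simp [lastSite, h]

lemma mul_lastSite_transpose_apply {κ : Type*} (n : ℕ) (M : Matrix κ (Fin m) ℂ)
    (q : Fin n × Fin m) (i : κ) :
    (M * (lastSite n m)ᵀ) i q = if (q.1 : ℕ) + 1 = n then M i q.2 else 0 := by
  rw [Matrix.mul_apply]
  by_cases h : (q.1 : ℕ) + 1 = n <;> simp [lastSite, h]

lemma finiteOp_submatrix (n : ℕ) :
    (finiteOp T C f θ (n + 1)).submatrix (splitLast n m) (splitLast n m)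
      = Matrix.fromBlocks (finiteOp T C f θ n) (lastSite n m * C.1)
        (C.1ᴴ * (lastSite n m)ᵀ) (f (T^[n] θ)).1 := by
  ext x y
  rcases x with p | i <;> rcases y with q | j
  · simp [finiteOp]
  · have h1 : ¬ (n + 1 = (p.1 : ℕ)) := by have := p.1.2; omega
    have h2 : ¬ ((p.1 : ℕ) = n) := by have := p.1.2; omega
    simp [finiteOp, lastSite_mul_apply, h1, h2]
  · have h1 : ¬ (n + 1 = (q.1 : ℕ)) := by have := q.1.2; omega
    have h2 : ¬ (n = (q.1 : ℕ)) := by have := q.1.2; omega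
    simp [finiteOp, mul_lastSite_transpose_apply, h1, h2]
  · simp [finiteOp]

lemma lastSite_submatrix (n : ℕ) :
    (lastSite (n + 1) m).submatrix (splitLast n m) id = Matrix.fromRows 0 1 := by
  ext x j
  rcases x with p | i
  · have h : ¬ ((p.1 : ℕ) = n) := by have := p.1.2; omega
    simp [lastSite, h]
  · simp [lastSite, Matrix.one_apply]

/-- The matrix `E - H_n - Z`, with `Z` acting at the last site. -/
def boundaryOp (n : ℕ) (E : ℂ) (Z : Matrix (Fin m) (Fin m) ℂ) :
    Matrix (Fin n × Fin m) (Fin n × Fin m) ℂ :=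
  E • 1 - finiteOp T C f θ n - lastSite n m * Z * (lastSite n m)ᵀ

lemma boundaryOp_submatrix (n : ℕ) (E : ℂ) (Z : Matrix (Fin m) (Fin m) ℂ) :
    (boundaryOp T C f θ (n + 1) E Z).submatrix (splitLast n m) (splitLast n m)
      = Matrix.fromBlocks (E • 1 - finiteOp T C f θ n) (-(lastSite n m * C.1))
        (-(C.1ᴴ * (lastSite n m)ᵀ)) (E • 1 - (f (T^[n] θ)).1 - Z) := by
  have h1 : (lastSite (n + 1) m * Z * (lastSite (n + 1) m)ᵀ).submatrix (splitLast n m)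
      (splitLast n m) = Matrix.fromBlocks 0 0 0 Z := by
    rw [← Matrix.submatrix_mul_equiv _ _ _ (Equiv.refl _), ← Matrix.submatrix_mul_equiv _ _ _
      (Equiv.refl _), ← Matrix.transpose_submatrix]
    change (lastSite (n + 1) m).submatrix (splitLast n m) id * Z
      * ((lastSite (n + 1) m).submatrix (splitLast n m) id)ᵀ = _
    rw [lastSite_submatrix, Matrix.fromRows_mul, Matrix.transpose_fromRows,
      Matrix.fromRows_mul_fromCols]
    simp
  rw [boundaryOp, Matrix.submatrix_sub, Matrix.submatrix_sub, Matrix.submatrix_smul]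
  simp only [Pi.sub_apply, Pi.smul_apply]
  rw [h1, finiteOp_submatrix, Matrix.submatrix_one_equiv, ← Matrix.fromBlocks_one,
    Matrix.fromBlocks_smul]
  simp [sub_eq_add_neg, Matrix.fromBlocks_neg, Matrix.fromBlocks_add]

end FiniteVolume

section FiniteVolume

variable {Θ : Type*} [MetricSpace Θ] {m : ℕ}

variable (T : Θ ≃ₜ Θ) (C : GL (Fin m) ℂ) (f : C(Θ, selfAdjoint (Matrix (Fin m) (Fin m) ℂ)))
  (θ : Θ)

/-- The frame at site `n` of the solutions that vanish at the site `-1`. -/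
def dirichletFrame (E : ℝ) (n : ℕ) : LagrangianFrame m :=
  LagrangianFrame.act (cocycleProd T (schrodingerCocycle C f E) θ n) (LagrangianFrame.ofUnitary 1)

lemma dirichletFrame_zero (E : ℝ) :
    (dirichletFrame T C f θ E 0).X = (2 : ℂ) • 1 ∧ (dirichletFrame T C f θ E 0).Y = 0 := by
  have h : (dirichletFrame T C f θ E 0).mat = Matrix.fromRows ((2 : ℂ) • 1) 0 := by
    have : (1 + 1 : Matrix (Fin m) (Fin m) ℂ) = (2 : ℂ) • 1 := (two_smul ℂ _).symm
    simp [dirichletFrame, LagrangianFrame.act, cocycleProd, HSp.id, LagrangianFrame.ofUnitary, this]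
  exact ⟨by rw [LagrangianFrame.X, h, Matrix.toRows₁_fromRows],
    by rw [LagrangianFrame.Y, h, Matrix.toRows₂_fromRows]⟩

lemma dirichletFrame_succ (E : ℝ) (n : ℕ) :
    (dirichletFrame T C f θ E (n + 1)).X
      = ((E : ℂ) • 1 - (f (T^[n] θ)).1) * (C⁻¹ : GL (Fin m) ℂ).1 * (dirichletFrame T C f θ E n).X
        - C.1ᴴ * (dirichletFrame T C f θ E n).Y ∧
    (dirichletFrame T C f θ E (n + 1)).Y
      = (C⁻¹ : GL (Fin m) ℂ).1 * (dirichletFrame T C f θ E n).X := by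
  have h : (dirichletFrame T C f θ E (n + 1)).mat
      = transferMatrix C E (f (T^[n] θ)).1 * (dirichletFrame T C f θ E n).mat := by
    rw [dirichletFrame, act_cocycleProd_succ]; rfl
  rw [LagrangianFrame.mat_eq (dirichletFrame T C f θ E n), transferMatrix,
    Matrix.fromBlocks_mul_fromRows] at h
  constructor
  · rw [LagrangianFrame.X, h, Matrix.toRows₁_fromRows, Matrix.neg_mul, ← sub_eq_add_neg]
  · rw [LagrangianFrame.Y, h, Matrix.toRows₂_fromRows, Matrix.zero_mul, add_zero]

lemma im_star_dotProduct_smul_one {ι : Type*} [Fintype ι] [DecidableEq ι] (z : ℂ) (v : ι → ℂ) :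
    (star v ⬝ᵥ ((z • (1 : Matrix ι ι ℂ)) *ᵥ v)).im = z.im * ∑ i, ‖v i‖ ^ 2 := by
  rw [Matrix.smul_mulVec, Matrix.one_mulVec, dotProduct_smul, star_dotProduct_self, smul_eq_mul,
    Complex.im_mul_ofReal]

lemma im_hermitian {ι : Type*} [Fintype ι] {B : Matrix ι ι ℂ} (hB : B.IsHermitian) (v : ι → ℂ) :
    (star v ⬝ᵥ (B *ᵥ v)).im = 0 :=
  Matrix.IsHermitian.im_star_dotProduct_mulVec_self (𝕜 := ℂ) hB v

/-- The boundary relation between determinants of finite volume operators and frames. -/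
lemma det_dirichletFrame (E σ : ℝ) (n : ℕ) :
    ∀ Z : Matrix (Fin m) (Fin m) ℂ, (∀ v, v ≠ 0 → 0 < σ * (star v ⬝ᵥ (Z *ᵥ v)).im) →
      C.1.det ^ n * ((dirichletFrame T C f θ E n).X - Z * (dirichletFrame T C f θ E n).Y).det
        = 2 ^ m * (boundaryOp T C f θ n E Z).det := by
  -- The induction runs over all Z whose imaginary part has the sign of σ. This condition makes the
  -- Schur complements invertible and is inherited by the new boundary matrix. The base case is
  -- det(2) = 2^m against an empty determinant.
  induction n with
  | zero =>
    intro Z _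
    obtain ⟨hX, hY⟩ := dirichletFrame_zero T C f θ E
    rw [hX, hY]
    simp
  | succ n ih =>
    intro Z hZ
    set D : Matrix (Fin m) (Fin m) ℂ := (E : ℂ) • 1 - (f (T^[n] θ)).1 - Z with hD
    have hfh : (f (T^[n] θ)).1.IsHermitian := (f (T^[n] θ)).2
    have hDim : ∀ v, (star v ⬝ᵥ (D *ᵥ v)).im = -(star v ⬝ᵥ (Z *ᵥ v)).im := fun v => by
      rw [hD, Matrix.sub_mulVec, Matrix.sub_mulVec, dotProduct_sub, dotProduct_sub, Complex.sub_im,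
        Complex.sub_im, im_star_dotProduct_smul_one, im_hermitian hfh]
      simp
    have hDdet : D.det ≠ 0 := fun h0 => by
      obtain ⟨v, hv, h1⟩ := Matrix.exists_mulVec_eq_zero_iff.2 h0
      have h2 := hDim v
      have h3 := hZ v hv
      rw [h1, dotProduct_zero, Complex.zero_im] at h2
      rw [neg_eq_zero.1 h2.symm, mul_zero] at h3
      exact lt_irrefl _ h3
    have hCdet : C.1.det ≠ 0 := ((Matrix.isUnit_iff_isUnit_det _).1 C.isUnit).ne_zero
    -- With Dw = Cᴴv the form of C D⁻¹ Cᴴ at v is the conjugate of that of D at w, and D carries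
    -- minus the imaginary part of Z. The two sign changes cancel.
    have hZ' : ∀ v, v ≠ 0 → 0 < σ * (star v ⬝ᵥ ((C.1 * D⁻¹ * C.1ᴴ) *ᵥ v)).im := fun v hv => by
      set w := (D⁻¹ * C.1ᴴ) *ᵥ v with hw
      have hDw : D *ᵥ w = C.1ᴴ *ᵥ v := by
        rw [hw, Matrix.mulVec_mulVec, ← Matrix.mul_assoc, Matrix.mul_nonsing_inv _ hDdet.isUnit,
          Matrix.one_mul]
      have hw0 : w ≠ 0 := fun h0 => by
        rw [h0, Matrix.mulVec_zero] at hDw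
        have hCd : (C.1ᴴ).det ≠ 0 := by
          rw [Matrix.det_conjTranspose]; exact star_ne_zero.2 hCdet
        exact hCd (Matrix.exists_mulVec_eq_zero_iff.1 ⟨v, hv, hDw.symm⟩)
      have h1 : star v ⬝ᵥ ((C.1 * D⁻¹ * C.1ᴴ) *ᵥ v) = star (star w ⬝ᵥ (D *ᵥ w)) := by
        rw [Matrix.mul_assoc, ← Matrix.mulVec_mulVec, ← hw, Matrix.dotProduct_mulVec,
          ← Matrix.star_dotProduct_star, star_star, hDw, Matrix.star_mulVec,
          Matrix.conjTranspose_conjTranspose, dotProduct_comm]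
      have h2 := hZ w hw0
      rw [h1, RCLike.star_def, Complex.conj_im, hDim, neg_neg]
      exact h2
    have hI := ih _ hZ'
    obtain ⟨hX, hY⟩ := dirichletFrame_succ T C f θ E n
    set X := (dirichletFrame T C f θ E n).X
    set Y := (dirichletFrame T C f θ E n).Y
    -- One transfer step replaces the boundary matrix Z by C D⁻¹ Cᴴ. Eliminating the last site by a
    -- Schur complement, in `hdet`, does the same on the operator side.
    have hXY : (dirichletFrame T C f θ E (n + 1)).X - Z * (dirichletFrame T C f θ E (n + 1)).Y
        = D * (C⁻¹ : GL (Fin m) ℂ).1 * (X - C.1 * D⁻¹ * C.1ᴴ * Y) := by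
      have h1 : D * (C⁻¹ : GL (Fin m) ℂ).1 * (C.1 * D⁻¹ * C.1ᴴ * Y) = C.1ᴴ * Y := by
        calc _ = D * ((C⁻¹ : GL (Fin m) ℂ).1 * C.1) * D⁻¹ * C.1ᴴ * Y := by
              simp only [Matrix.mul_assoc]
          _ = _ := by
              rw [← Units.val_mul, inv_mul_cancel, Units.val_one, Matrix.mul_one,
                Matrix.mul_nonsing_inv _ hDdet.isUnit, Matrix.one_mul]
      rw [hX, hY, mul_sub, h1, hD, sub_mul _ Z, sub_mul _ (Z * _), Matrix.mul_assoc Z]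
      abel
    have hdet : (boundaryOp T C f θ (n + 1) E Z).det
        = D.det * (boundaryOp T C f θ n E (C.1 * D⁻¹ * C.1ᴴ)).det := by
      have : Invertible D := Matrix.invertibleOfIsUnitDet D hDdet.isUnit
      rw [← Matrix.det_submatrix_equiv_self (splitLast n m), boundaryOp_submatrix, ← hD,
        Matrix.det_fromBlocks₂₂, Matrix.invOf_eq_nonsing_inv]
      congr 2
      simp only [boundaryOp, Matrix.neg_mul, Matrix.mul_neg, neg_neg, Matrix.mul_assoc]
    have hCinv : C.1.det * (C⁻¹ : GL (Fin m) ℂ).1.det = 1 := by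
      rw [← Matrix.det_mul, ← Units.val_mul, mul_inv_cancel, Units.val_one, Matrix.det_one]
    rw [hXY, hdet, Matrix.det_mul, Matrix.det_mul, pow_succ]
    calc _ = (C.1.det * (C⁻¹ : GL (Fin m) ℂ).1.det) * D.det
          * (C.1.det ^ n * (X - C.1 * D⁻¹ * C.1ᴴ * Y).det) := by ring
      _ = _ := by rw [hCinv, hI]; ring

lemma finiteOp_isHermitian (n : ℕ) : (finiteOp T C f θ n).IsHermitian := by
  ext p q
  have hf : ∀ x, (f x).1ᴴ = (f x).1 := fun x => (f x).2
  have h1 : star (if (p.1 : ℕ) + 1 = q.1 then C.1ᴴ q.2 p.2 else 0)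
      = if (p.1 : ℕ) + 1 = q.1 then C.1 p.2 q.2 else 0 := by
    split_ifs <;> simp
  have h2 : star (if (q.1 : ℕ) = p.1 then (f (T^[q.1] θ)).1 q.2 p.2 else 0)
      = if (p.1 : ℕ) = q.1 then (f (T^[p.1] θ)).1 p.2 q.2 else 0 := by
    by_cases h : (q.1 : ℕ) = p.1
    · rw [if_pos h, if_pos h.symm, h, ← Matrix.conjTranspose_apply, hf]
    · rw [if_neg h, if_neg (Ne.symm h), star_zero]
  have h3 : star (if (q.1 : ℕ) + 1 = p.1 then C.1 q.2 p.2 else 0)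
      = if (q.1 : ℕ) + 1 = p.1 then C.1ᴴ p.2 q.2 else 0 := by
    split_ifs <;> simp
  simp only [finiteOp, Matrix.conjTranspose_apply, Matrix.of_apply, star_add] at h1 h2 h3 ⊢
  rw [h1, h2, h3]
  ring

/-- The finite volume operator with a dissipative boundary condition. -/
def dissipativeOp (n : ℕ) (E : ℂ) : Matrix (Fin n × Fin m) (Fin n × Fin m) ℂ :=
  E • 1 - finiteOp T C f θ n + Complex.I • (lastSite n m * (lastSite n m)ᵀ)

lemma dissipativeOp_eq (n : ℕ) (E : ℂ) :
    dissipativeOp T C f θ n E = boundaryOp T C f θ n E (-Complex.I • 1) := by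
  simp [dissipativeOp, boundaryOp]

lemma conjTranspose_lastSite (n : ℕ) : (lastSite n m)ᴴ = (lastSite n m)ᵀ := by
  ext i p
  simp only [lastSite, Matrix.conjTranspose_apply, Matrix.transpose_apply, Matrix.of_apply]
  split_ifs <;> simp

lemma conjTranspose_dissipativeOp (n : ℕ) (E : ℝ) :
    (dissipativeOp T C f θ n E)ᴴ = boundaryOp T C f θ n E (Complex.I • 1) := by
  have h := finiteOp_isHermitian T C f θ n
  rw [Matrix.IsHermitian] at h
  have h2 := conjTranspose_lastSite n (m := m)
  have h3 : ((lastSite n m)ᵀ)ᴴ = lastSite n m := by rw [← h2, Matrix.conjTranspose_conjTranspose]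
  simp [dissipativeOp, boundaryOp, h, h2, h3, sub_eq_add_neg]

/-- The boundary matrices Z = -i and Z = i turn X - ZY into X + iY and X - iY, and the two boundary
operators are adjoint to each other. So det W of the frame is a quotient of conjugate numbers. -/
lemma det_frame_eq (E : ℝ) (n : ℕ) :
    C.1.det ^ n * ((dirichletFrame T C f θ E n).X
        + Complex.I • (dirichletFrame T C f θ E n).Y).det
      = 2 ^ m * (dissipativeOp T C f θ n E).det ∧
    C.1.det ^ n * ((dirichletFrame T C f θ E n).X
        - Complex.I • (dirichletFrame T C f θ E n).Y).det
      = 2 ^ m * star (dissipativeOp T C f θ n E).det := by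
  constructor
  · have := det_dirichletFrame T C f θ E (-1) n (-Complex.I • 1) fun v hv => by
      rw [im_star_dotProduct_smul_one]
      simpa using sum_norm_sq_pos hv
    rw [← dissipativeOp_eq] at this
    rw [← this]
    simp
  · have := det_dirichletFrame T C f θ E 1 n (Complex.I • 1) fun v hv => by
      rw [im_star_dotProduct_smul_one]
      simpa using sum_norm_sq_pos hv
    rw [← conjTranspose_dissipativeOp, Matrix.det_conjTranspose] at this
    rw [← this]
    simp

/-- X - iY is invertible for every Lagrangian frame; through the determinant identity this replaces
a unique continuation argument. -/
lemma det_dissipativeOp_ne_zero (E : ℝ) (n : ℕ) : (dissipativeOp T C f θ n E).det ≠ 0 := by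
  intro h0
  have h := (det_frame_eq T C f θ E n).2
  have hC : C.1.det ≠ 0 := ((Matrix.isUnit_iff_isUnit_det _).1 C.isUnit).ne_zero
  rw [h0, star_zero, mul_zero] at h
  exact mul_ne_zero (pow_ne_zero _ hC) ((Matrix.isUnit_iff_isUnit_det _).1
    (LagrangianFrame.isUnit_sub _)).ne_zero h

lemma im_dissipativeOp (n : ℕ) (E : ℂ) (v : Fin n × Fin m → ℂ) :
    (star v ⬝ᵥ (dissipativeOp T C f θ n E *ᵥ v)).im
      = E.im * ∑ p, ‖v p‖ ^ 2 + ∑ j, ‖((lastSite n m)ᵀ *ᵥ v) j‖ ^ 2 := by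
  have h3 : ((lastSite n m)ᵀ)ᴴ = lastSite n m := by
    rw [← conjTranspose_lastSite, Matrix.conjTranspose_conjTranspose]
  have h := star_dotProduct_mulVec_mulVec (lastSite n m)ᵀ v
  rw [h3] at h
  rw [dissipativeOp, Matrix.add_mulVec, Matrix.sub_mulVec, dotProduct_add, dotProduct_sub,
    Complex.add_im, Complex.sub_im, im_star_dotProduct_smul_one,
    im_hermitian (finiteOp_isHermitian T C f θ n), Matrix.smul_mulVec, dotProduct_smul, ← h,
    star_dotProduct_self, smul_eq_mul, Complex.I_mul_im, Complex.ofReal_re, sub_zero]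

/-- There is no real eigenvalue at all. A real eigenvalue μ forces Im E = 0, and then the operator
at the real energy E - μ would be singular. -/
lemma dissipativeOp_mem (n : ℕ) (E : ℂ) (hE : 0 ≤ E.im) :
    dissipativeOp T C f θ n E ∈ slitMatrices (Fin n × Fin m) := by
  intro μ hμ
  refine Or.inr fun hμ0 => ?_
  obtain ⟨v, hv, h1⟩ := mem_roots_charpoly.1 hμ
  have h2 := im_dissipativeOp T C f θ n E v
  rw [h1, dotProduct_smul, star_dotProduct_self, smul_eq_mul, Complex.im_mul_ofReal, hμ0,
    zero_mul] at h2
  have h3 := sum_norm_sq_pos hv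
  have h4 : 0 ≤ ∑ j, ‖((lastSite n m)ᵀ *ᵥ v) j‖ ^ 2 := by positivity
  have hE0 : E.im = 0 := by
    by_contra h
    have : 0 < E.im := lt_of_le_of_ne hE (Ne.symm h)
    nlinarith [mul_pos this h3]
  have h5 : dissipativeOp T C f θ n ((E - μ).re : ℂ) *ᵥ v = 0 := by
    have e : ((E - μ).re : ℂ) = E - μ := by
      apply Complex.ext <;> simp [hE0, hμ0]
    have e2 : dissipativeOp T C f θ n (E - μ) = dissipativeOp T C f θ n E - μ • 1 := by
      simp only [dissipativeOp, sub_smul]; abel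
    rw [e, e2, Matrix.sub_mulVec, h1, Matrix.smul_mulVec, Matrix.one_mulVec, sub_self]
  exact det_dissipativeOp_ne_zero T C f θ (E - μ).re n
    (Matrix.exists_mulVec_eq_zero_iff.1 ⟨v, hv, h5⟩)

end FiniteVolume

/-! ### Displacements and eigenvalue counts -/

section Counting

variable {Θ : Type*} [MetricSpace Θ] {m : ℕ}

variable (T : Θ ≃ₜ Θ) (C : GL (Fin m) ℂ) (f : C(Θ, selfAdjoint (Matrix (Fin m) (Fin m) ℂ)))

/-- The displacement of the Schrödinger cocycle as a function on `Θ × U(m)`. -/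
def schrodingerDisplacement (E : ℝ) (p : Θ × Matrix.unitaryGroup (Fin m) ℂ) : ℝ :=
  displacement C E (f p.1).1 p.2.1

lemma continuous_schrodingerDisplacement (E : ℝ) :
    Continuous (schrodingerDisplacement C f E) :=
  continuous_displacement C continuous_const (f.continuous.comp continuous_fst) continuous_snd

lemma det_schrodingerCocycle (E : ℝ) (p : Θ × Matrix.unitaryGroup (Fin m) ℂ) :
    (cocycleMap T (schrodingerCocycle C f E) p).2.1.det
      = p.2.1.det * Complex.exp (2 * Real.pi * schrodingerDisplacement C f E p * Complex.I) :=
  det_act_transferMatrix C E (f p.1) p.2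

/-- The total displacement along `n` steps of the orbit of the horizontal Lagrangian subspace. -/
def totalDisplacement (n : ℕ) (E : ℝ) (θ : Θ) : ℝ :=
  birkhoffSum (cocycleMap T (schrodingerCocycle C f E)) (schrodingerDisplacement C f E) n (θ, 1)

lemma iterate_cocycleMap_fst {A : C(Θ, HSp m)} (n : ℕ) (p : Θ × Matrix.unitaryGroup (Fin m) ℂ) :
    ((cocycleMap T A)^[n] p).1 = T^[n] p.1 := by
  rw [← Prod.mk.eta (p := p), iterate_cocycleMap]

lemma continuous_iterate_energy (θ : Θ) (n : ℕ) :
    Continuous fun E : ℝ => ((cocycleMap T (schrodingerCocycle C f E))^[n] (θ, 1)).2 := by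
  induction n with
  | zero => exact continuous_const
  | succ n ih =>
    simp only [Function.iterate_succ_apply']
    refine continuous_act_toUnitary (A := fun E => (schrodingerCocycle C f E) _) ?_ ih
    simp only [iterate_cocycleMap_fst]
    refine Continuous.subtype_mk ?_ _
    unfold transferMatrix
    fun_prop

lemma tendsto_iterate_energy (θ : Θ) (n : ℕ) :
    Tendsto (fun E : ℝ => ((cocycleMap T (schrodingerCocycle C f E))^[n] (θ, 1)).2) atTop
      (𝓝 1) := by
  induction n with
  | zero => exact tendsto_const_nhds
  | succ n ih =>
    have := tendsto_act_transferMatrix C (f (T^[n] θ)) ih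
    refine this.congr fun E => ?_
    rw [Function.iterate_succ_apply', ← iterate_cocycleMap_fst T (A := schrodingerCocycle C f E) n
      (θ, 1)]
    rfl

lemma totalDisplacement_eq (n : ℕ) (E : ℝ) (θ : Θ) :
    totalDisplacement T C f n E θ = ∑ k ∈ Finset.range n, displacement C E (f (T^[k] θ)).1
      ((cocycleMap T (schrodingerCocycle C f E))^[k] (θ, 1)).2.1 := by
  simp only [totalDisplacement, birkhoffSum, schrodingerDisplacement, iterate_cocycleMap_fst]

lemma continuous_totalDisplacement (n : ℕ) (θ : Θ) :
    Continuous fun E => totalDisplacement T C f n E θ := by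
  simp only [totalDisplacement_eq]
  exact continuous_finsetSum _ fun k _ => continuous_displacement C continuous_id
    continuous_const (continuous_iterate_energy T C f θ k)

lemma tendsto_totalDisplacement (n : ℕ) (θ : Θ) :
    Tendsto (fun E => totalDisplacement T C f n E θ) atTop (𝓝 0) := by
  simp only [totalDisplacement_eq]
  rw [← Finset.sum_const_zero (s := Finset.range n)]
  exact tendsto_finsetSum _ fun k _ =>
    tendsto_displacement C _ (tendsto_iterate_energy T C f θ k)

lemma continuous_dissipativeOp {X : Type*} [TopologicalSpace X] (n : ℕ) (θ : Θ) {z : X → ℂ}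
    (hz : Continuous z) : Continuous fun x => dissipativeOp T C f θ n (z x) := by
  unfold dissipativeOp
  fun_prop

lemma tendsto_argDet_dissipativeOp (n : ℕ) (θ : Θ) :
    Tendsto (fun E : ℝ => argDet (dissipativeOp T C f θ n E)) atTop (𝓝 0) := by
  have h1 : Tendsto (fun E : ℝ => (E⁻¹ : ℂ)) atTop (𝓝 0) := by
    have := (Complex.continuous_ofReal.tendsto 0).comp (tendsto_inv_atTop_zero (𝕜 := ℝ))
    simpa [Function.comp_def] using this
  have h2 : Tendsto (fun E : ℝ => (E⁻¹ : ℂ) • dissipativeOp T C f θ n E) atTop (𝓝 1) := by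
    have h3 : Tendsto (fun E : ℝ => 1 + (E⁻¹ : ℂ) • dissipativeOp T C f θ n 0) atTop
        (𝓝 (1 + (0 : ℂ) • dissipativeOp T C f θ n 0)) := tendsto_const_nhds.add (h1.smul_const _)
    rw [zero_smul, add_zero] at h3
    refine h3.congr' ?_
    filter_upwards [eventually_gt_atTop 0] with E hE
    have hE' : (E : ℂ) ≠ 0 := by exact_mod_cast hE.ne'
    have : dissipativeOp T C f θ n E = (E : ℂ) • 1 + dissipativeOp T C f θ n 0 := by
      simp only [dissipativeOp, zero_smul]; abel
    rw [this, smul_add, smul_smul, inv_mul_cancel₀ hE', one_smul]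
  have h := (continuousOn_argDet 1 one_mem_slitMatrices).tendsto.comp
    (tendsto_nhdsWithin_iff.2 ⟨h2, by
      filter_upwards [eventually_gt_atTop 0] with E hE
      have := smul_mem_slitMatrices (inv_pos.2 hE) (dissipativeOp_mem T C f θ n E (by simp))
      rwa [Complex.ofReal_inv] at this⟩)
  rw [argDet_one] at h
  refine h.congr' ?_
  filter_upwards [eventually_gt_atTop 0] with E hE
  have := argDet_smul (inv_pos.2 hE) (dissipativeOp T C f θ n E)
  rw [Complex.ofReal_inv] at this
  exact this

/-- Both sides are logarithms of det W along the orbit, so twice their difference times π lies in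
2πℤ. Continuity in E makes it constant, and both sides vanish as E → +∞. This removes the integer
ambiguity. -/
lemma totalDisplacement_eq_argDet (n : ℕ) (E : ℝ) (θ : Θ) :
    totalDisplacement T C f n E θ = argDet (dissipativeOp T C f θ n E) / Real.pi := by
  let u : ℝ → ℝ := fun E => 2 * Real.pi * totalDisplacement T C f n E θ
    - 2 * argDet (dissipativeOp T C f θ n E)
  have hu : Continuous u := by
    refine ((continuous_totalDisplacement T C f n θ).const_mul _).sub (Continuous.const_mul ?_ _)
    exact continuousOn_argDet.comp_continuous
      (continuous_dissipativeOp T C f n θ Complex.continuous_ofReal)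
      fun E => dissipativeOp_mem T C f θ n E (by simp)
  have hexp : ∀ E, Complex.exp (u E * Complex.I) = 1 := fun E => by
    have h1 := det_iterate_cocycleMap (det_schrodingerCocycle T C f E) (θ, 1) n
    have h2 := det_toUnitary_mul (dirichletFrame T C f θ E n)
    obtain ⟨h3, h4⟩ := det_frame_eq T C f θ E n
    have h5 := det_dissipativeOp_ne_zero T C f θ E n
    have hs := ((Matrix.isUnit_iff_isUnit_det _).1
      (dirichletFrame T C f θ E n).isUnit_sub).ne_zero
    have hC : C.1.det ^ n ≠ 0 :=
      pow_ne_zero _ ((Matrix.isUnit_iff_isUnit_det _).1 C.isUnit).ne_zero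
    rw [iterate_cocycleMap] at h1
    change (dirichletFrame T C f θ E n).toUnitary.1.det = (1 : Matrix (Fin m) (Fin m) ℂ).det * _
      at h1
    rw [Matrix.det_one, one_mul] at h1
    have h6 : (u E : ℂ) * Complex.I = 2 * Real.pi * (totalDisplacement T C f n E θ : ℝ) * Complex.I
        - 2 * argDet (dissipativeOp T C f θ n E) * Complex.I := by
      simp only [u]; push_cast; ring
    rw [h6, Complex.exp_sub, exp_two_mul_argDet h5, totalDisplacement, ← h1,
      div_eq_one_iff_eq (div_ne_zero h5 (star_ne_zero.2 h5)), eq_div_iff (star_ne_zero.2 h5)]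
    have h7 : (2 : ℂ) ^ m ≠ 0 := pow_ne_zero _ two_ne_zero
    apply mul_left_cancel₀ h7
    rw [← h3, ← h2]
    -- With W the unitary matrix of the frame, both determinant identities carry the same factors
    -- (det C)^n and 2^m, so these cancel in det W.
    linear_combination (-(dirichletFrame T C f θ E n).toUnitary.1.det) * h4
  have hconst : ∀ E', u E' = u E := fun E' => eq_of_exp_eq hu hexp E' E
  have hlim : Tendsto u atTop (𝓝 0) := by
    have := ((tendsto_totalDisplacement T C f n θ).const_mul (2 * Real.pi)).sub
      ((tendsto_argDet_dissipativeOp T C f n θ).const_mul 2)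
    simpa using this
  have h0 : u E = 0 := by
    have : u = fun _ => u E := funext hconst
    rw [this] at hlim
    exact tendsto_nhds_unique tendsto_const_nhds hlim
  have hpi := Real.pi_ne_zero
  simp only [u] at h0
  field_simp
  linarith

/-- The boundary condition changes the argument of the determinant by at most `m π / 2`. -/
lemma abs_argDet_sub_le (n : ℕ) (θ : Θ) {z : ℂ} (hz : 0 < z.im) :
    |argDet (dissipativeOp T C f θ n z) - argDet (z • 1 - finiteOp T C f θ n)|
      ≤ m * (Real.pi / 2) := by
  set P := lastSite n m with hP
  have hPP : Pᵀᴴ = P := by rw [hP, ← conjTranspose_lastSite, Matrix.conjTranspose_conjTranspose]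
  set R := z • 1 - finiteOp T C f θ n with hR
  have hRim : ∀ v, (star v ⬝ᵥ (R *ᵥ v)).im = z.im * ∑ p, ‖v p‖ ^ 2 := fun v => by
    rw [hR, Matrix.sub_mulVec, dotProduct_sub, Complex.sub_im, im_star_dotProduct_smul_one,
      im_hermitian (finiteOp_isHermitian T C f θ n), sub_zero]
  have hRdet : R.det ≠ 0 := det_ne_zero_of_mem_slitMatrices (mem_slitMatrices_of_im_pos fun v hv => by
    rw [hRim]; exact mul_pos hz (sum_norm_sq_pos hv))
  -- Since R = z - H_n is invertible, det(R + s i PPᵀ) = det R · det(1 + s i K) with K of size m.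
  -- The imaginary part of R is positive, so that of K is nonpositive and iK has nonnegative real
  -- part.
  set K := Pᵀ * R⁻¹ * P with hK
  have hKim : ∀ v, 0 ≤ (star v ⬝ᵥ ((Complex.I • K) *ᵥ v)).re := fun v => by
    set w := (R⁻¹ * P) *ᵥ v with hw
    have hRw : R *ᵥ w = P *ᵥ v := by
      rw [hw, Matrix.mulVec_mulVec, ← Matrix.mul_assoc, Matrix.mul_nonsing_inv _ hRdet.isUnit,
        Matrix.one_mul]
    have h1 : star v ⬝ᵥ (K *ᵥ v) = star (star w ⬝ᵥ (R *ᵥ w)) := by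
      rw [hK, Matrix.mul_assoc, ← Matrix.mulVec_mulVec, ← hw, Matrix.dotProduct_mulVec,
        ← Matrix.star_dotProduct_star, star_star, hRw, Matrix.star_mulVec,
        ← conjTranspose_lastSite, dotProduct_comm]
    rw [Matrix.smul_mulVec, dotProduct_smul, smul_eq_mul, Complex.I_mul_re, h1, RCLike.star_def,
      Complex.conj_im, neg_neg, hRim]
    positivity
  have hre : ∀ s : unitInterval, ∀ μ ∈ (1 + ((s : ℝ) : ℂ) • (Complex.I • K)).charpoly.roots,
      0 < μ.re := fun s μ hμ => by
    obtain ⟨v, hv, h1⟩ := mem_roots_charpoly.1 hμ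
    have h2 := congrArg (fun x => (star v ⬝ᵥ x).re) h1
    simp only [Matrix.add_mulVec, Matrix.one_mulVec, dotProduct_add, Matrix.smul_mulVec _ (_ • K),
      dotProduct_smul, star_dotProduct_self, smul_eq_mul, Complex.add_re, Complex.re_ofReal_mul,
      Complex.re_mul_ofReal, Complex.ofReal_re] at h2
    have h3 := sum_norm_sq_pos hv
    have h4 := mul_nonneg s.2.1 (hKim v)
    exact pos_of_mul_pos_left (by linarith) h3.le
  have hslit : ∀ s : unitInterval, R + ((s : ℝ) : ℂ) • (Complex.I • (P * Pᵀ)) ∈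
      slitMatrices (Fin n × Fin m) := fun s => mem_slitMatrices_of_im_pos fun v hv => by
    have h := star_dotProduct_mulVec_mulVec Pᵀ v
    rw [hPP] at h
    rw [Matrix.add_mulVec, dotProduct_add, Complex.add_im, hRim, Matrix.smul_mulVec,
      Matrix.smul_mulVec, dotProduct_smul, dotProduct_smul, ← h, star_dotProduct_self, smul_eq_mul,
      smul_eq_mul, Complex.im_ofReal_mul, Complex.I_mul_im, Complex.ofReal_re]
    have h1 := mul_pos hz (sum_norm_sq_pos hv)
    have h2 := mul_nonneg s.2.1 (by positivity : 0 ≤ ∑ j, ‖(Pᵀ *ᵥ v) j‖ ^ 2)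
    linarith
  -- Along s ∈ [0, 1] the difference of the two arguments is an argument of det R, hence constant.
  -- Comparing s = 1 with s = 0 identifies the wanted difference with `argDet` of an m × m matrix
  -- with spectrum in the right half-plane.
  let u : unitInterval → ℝ := fun s => argDet (R + ((s : ℝ) : ℂ) • (Complex.I • (P * Pᵀ)))
    - argDet (1 + ((s : ℝ) : ℂ) • (Complex.I • K))
  have hu : Continuous u := by
    refine Continuous.sub ?_ ?_
    · exact continuousOn_argDet.comp_continuous (by fun_prop) hslit
    · exact continuousOn_argDet.comp_continuous (by fun_prop)
        fun s => mem_slitMatrices_of_re_pos (hre s)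
  have hdet : ∀ s : unitInterval, (R + ((s : ℝ) : ℂ) • (Complex.I • (P * Pᵀ))).det
      = R.det * (1 + ((s : ℝ) : ℂ) • (Complex.I • K)).det := fun s => by
    have h1 : R + ((s : ℝ) : ℂ) • (Complex.I • (P * Pᵀ))
        = R * (1 + (((s : ℝ) : ℂ) • Complex.I • (R⁻¹ * P)) * Pᵀ) := by
      rw [mul_add, mul_one, Matrix.smul_mul, Matrix.smul_mul, Matrix.mul_smul, Matrix.mul_smul,
        ← Matrix.mul_assoc, ← Matrix.mul_assoc, Matrix.mul_nonsing_inv _ hRdet.isUnit,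
        Matrix.one_mul]
    rw [h1, Matrix.det_mul, Matrix.det_one_add_mul_comm, Matrix.mul_smul, Matrix.mul_smul,
      ← Matrix.mul_assoc]
  have hexp : ∀ s, Complex.exp (u s * Complex.I) = R.det / ‖R.det‖ := fun s => by
    have h1 := det_ne_zero_of_mem_slitMatrices (hslit s)
    have h2 := det_ne_zero_of_mem_slitMatrices (mem_slitMatrices_of_re_pos (hre s))
    have h3 : ((u s : ℝ) : ℂ) * Complex.I
        = argDet (R + ((s : ℝ) : ℂ) • (Complex.I • (P * Pᵀ))) * Complex.I
          - argDet (1 + ((s : ℝ) : ℂ) • (Complex.I • K)) * Complex.I := by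
      simp only [u]; push_cast; ring
    rw [h3, Complex.exp_sub, exp_argDet h1, exp_argDet h2, hdet, norm_mul]
    have h4 : (‖(1 + ((s : ℝ) : ℂ) • (Complex.I • K)).det‖ : ℂ) ≠ 0 := by simpa using h2
    push_cast
    field_simp
  have h1 := eq_of_exp_eq hu hexp 1 0
  have h2 : argDet (1 + (((1 : unitInterval) : ℝ) : ℂ) • (Complex.I • K))
      = argDet (dissipativeOp T C f θ n z) - argDet R := by
    simp only [u, Set.Icc.coe_zero, Set.Icc.coe_one, Complex.ofReal_zero, zero_smul,
      add_zero, argDet_one, sub_zero, Complex.ofReal_one, one_smul] at h1 ⊢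
    rw [dissipativeOp, ← hR, ← hP]
    linarith
  rw [← h2]
  simpa using abs_argDet_le (hre 1)

/-- From the upper half-plane the argument tends to π on the negative axis and to 0 on the positive
one. At h = E it is π/2, of which only the bounds are needed. -/
lemma tendsto_arg_sub (E h : ℝ) :
    ∃ l, Tendsto (fun y : ℝ => (((E : ℂ) + y * Complex.I) - h).arg) (𝓝[>] 0) (𝓝 l) ∧
      0 ≤ l ∧ l ≤ Real.pi ∧ (h < E → l = 0) ∧ (E < h → l = Real.pi) := by
  have hc : Tendsto (fun y : ℝ => ((E : ℂ) + y * Complex.I) - h) (𝓝[>] 0) (𝓝 ((E - h : ℝ) : ℂ)) := by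
    have : Continuous fun y : ℝ => ((E : ℂ) + y * Complex.I) - h := by fun_prop
    have := this.tendsto 0
    simp only [Complex.ofReal_zero, zero_mul, add_zero, ← Complex.ofReal_sub] at this
    exact this.mono_left nhdsWithin_le_nhds
  rcases lt_trichotomy h E with hE | rfl | hE
  · refine ⟨0, ?_, le_rfl, Real.pi_pos.le, fun _ => rfl, fun h' => absurd h' hE.not_gt⟩
    have h0 := (Complex.continuousAt_arg (x := ((E - h : ℝ) : ℂ))
      (Complex.ofReal_mem_slitPlane.2 (sub_pos.2 hE))).tendsto.comp hc
    rwa [Complex.arg_ofReal_of_nonneg (sub_pos.2 hE).le] at h0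
  · refine ⟨Real.pi / 2, ?_, by positivity, by linarith [Real.pi_pos],
      fun h' => absurd h' (lt_irrefl _), fun h' => absurd h' (lt_irrefl _)⟩
    refine tendsto_const_nhds.congr' ?_
    filter_upwards [self_mem_nhdsWithin] with y hy
    rw [add_sub_cancel_left, Complex.arg_real_mul _ hy, Complex.arg_I]
  · refine ⟨Real.pi, ?_, Real.pi_pos.le, le_rfl, fun h' => absurd h' hE.not_gt, fun _ => rfl⟩
    have h0 := (Complex.continuousWithinAt_arg_of_re_neg_of_im_zero (z := ((E - h : ℝ) : ℂ))
      (by simpa using hE) (by simp)).tendsto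
    have h1 := h0.comp (tendsto_nhdsWithin_iff.2 ⟨hc, by
      filter_upwards [self_mem_nhdsWithin] with y hy
      simpa using (le_of_lt hy)⟩)
    rwa [Complex.arg_ofReal_of_neg (sub_neg.2 hE)] at h1

lemma argDet_resolvent (n : ℕ) (θ : Θ) (z : ℂ) :
    argDet (z • 1 - finiteOp T C f θ n)
      = ∑ j, (z - (finiteOp_isHermitian T C f θ n).eigenvalues j).arg := by
  have h1 : z • 1 - finiteOp T C f θ n = z • 1 + (-1 : ℂ) • finiteOp T C f θ n := by
    rw [neg_one_smul, sub_eq_add_neg]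
  rw [h1, argDet_affine, (finiteOp_isHermitian T C f θ n).roots_charpoly_eq_eigenvalues,
    Multiset.map_map, Finset.sum]
  congr 1
  refine Multiset.map_congr rfl fun j _ => ?_
  simp [sub_eq_add_neg]

/-- The displacement counts the eigenvalues above `E`, up to a bounded error. -/
lemma exists_count (n : ℕ) (θ : Θ) (E : ℝ) :
    ∃ l : Fin n × Fin m → ℝ, |totalDisplacement T C f n E θ - ∑ j, l j| ≤ m ∧
      ∀ j, 0 ≤ l j ∧ l j ≤ 1 ∧
        ((finiteOp_isHermitian T C f θ n).eigenvalues j < E → l j = 0) ∧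
        (E < (finiteOp_isHermitian T C f θ n).eigenvalues j → l j = 1) := by
  choose l hl h0 hpi hlt hgt using fun j =>
    tendsto_arg_sub E ((finiteOp_isHermitian T C f θ n).eigenvalues j)
  have hpi0 := Real.pi_pos
  refine ⟨fun j => l j / Real.pi, ?_, fun j => ⟨div_nonneg (h0 j) hpi0.le,
    (div_le_one hpi0).2 (hpi j), fun h => by simp [hlt j h],
    fun h => by simp [hgt j h, hpi0.ne']⟩⟩
  have h1 : Tendsto (fun y : ℝ => argDet (((E : ℂ) + y * Complex.I) • 1 - finiteOp T C f θ n))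
      (𝓝[>] 0) (𝓝 (∑ j, l j)) := by
    simp only [argDet_resolvent]
    exact tendsto_finsetSum _ fun j _ => hl j
  have h2 : Tendsto (fun y : ℝ => argDet (dissipativeOp T C f θ n ((E : ℂ) + y * Complex.I)))
      (𝓝[>] 0) (𝓝 (argDet (dissipativeOp T C f θ n E))) := by
    have hc := (continuous_dissipativeOp T C f n θ (X := ℝ)
      (z := fun y : ℝ => (E : ℂ) + y * Complex.I) (by fun_prop)).tendsto 0
    simp only [Complex.ofReal_zero, zero_mul, add_zero] at hc
    refine (continuousOn_argDet _ (dissipativeOp_mem T C f θ n E (by simp))).tendsto.comp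
      (tendsto_nhdsWithin_iff.2 ⟨hc.mono_left nhdsWithin_le_nhds, ?_⟩)
    filter_upwards [self_mem_nhdsWithin] with y hy
    exact dissipativeOp_mem T C f θ n _ (by simpa using le_of_lt hy)
  -- At y = 0 the dissipative operator is still a slit matrix, so `argDet` is continuous there. The
  -- operator z - H_n may become singular, and only its limiting arguments are used. Division by π
  -- gives the error m/2.
  have h3 : |argDet (dissipativeOp T C f θ n E) - ∑ j, l j| ≤ m * (Real.pi / 2) := by
    refine le_of_tendsto (h2.sub h1).abs ?_
    filter_upwards [self_mem_nhdsWithin] with y hy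
    exact abs_argDet_sub_le T C f n θ (by simpa using hy)
  rw [totalDisplacement_eq_argDet, ← Finset.sum_div, ← sub_div, abs_div, abs_of_pos hpi0,
    div_le_iff₀ hpi0]
  have : (0 : ℝ) ≤ m := by positivity
  nlinarith

end Counting

/-! ### Pointwise ergodic theorems -/

section Ergodic

variable {X : Type*} [MeasurableSpace X] {μ : Measure X} [IsProbabilityMeasure μ] {T : X → X}

/-- The maximum of `0` and the first `n` Birkhoff sums. -/
def maximalSum (T : X → X) (φ : X → ℝ) : ℕ → X → ℝ
  | 0 => fun _ => 0
  | n + 1 => fun x => max 0 (φ x + maximalSum T φ n (T x))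

lemma maximalSum_nonneg {X : Type*} (T : X → X) (φ : X → ℝ) (n : ℕ) (x : X) :
    0 ≤ maximalSum T φ n x := by
  cases n with
  | zero => exact le_rfl
  | succ n => exact le_max_left _ _

lemma maximalSum_le_succ {X : Type*} (T : X → X) (φ : X → ℝ) (n : ℕ) (x : X) :
    maximalSum T φ n x ≤ maximalSum T φ (n + 1) x := by
  induction n generalizing x with
  | zero => exact maximalSum_nonneg _ _ _ _
  | succ n ih => exact max_le_max le_rfl (by linarith [ih (T x)])

lemma birkhoffSum_le_maximalSum {X : Type*} (T : X → X) (φ : X → ℝ) (n : ℕ) (x : X) :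
    birkhoffSum T φ n x ≤ maximalSum T φ n x := by
  induction n generalizing x with
  | zero => simp [maximalSum]
  | succ n ih =>
    rw [birkhoffSum_succ']
    exact le_max_of_le_right (by linarith [ih (T x)])

/-- The maximal ergodic inequality. -/
lemma integral_nonneg_of_exists_birkhoffSum_pos (hT : MeasurePreserving T μ μ) {φ : X → ℝ}
    (hφ : Measurable φ) {B : ℝ} (hB : ∀ x, |φ x| ≤ B)
    (h : ∀ᵐ x ∂μ, ∃ n, 0 < birkhoffSum T φ n x) : 0 ≤ ∫ x, φ x ∂μ := by
  have hmeas : ∀ n, Measurable (maximalSum T φ n) := fun n => by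
    induction n with
    | zero => exact measurable_const
    | succ n ih => exact measurable_const.max (hφ.add (ih.comp hT.measurable))
  have hbd : ∀ n x, |maximalSum T φ n x| ≤ n * B := fun n => by
    induction n with
    | zero => intro x; simp [maximalSum]
    | succ n ih =>
      intro x
      have hB0 : 0 ≤ B := (abs_nonneg _).trans (hB x)
      rw [abs_of_nonneg (maximalSum_nonneg _ _ _ _)]
      push_cast
      refine max_le (by positivity) ?_
      have h1 := (abs_le.1 (hB x)).2
      have h2 := (abs_le.1 (ih (T x))).2
      linarith
  have hint : ∀ n, Integrable (maximalSum T φ n) μ := fun n =>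
    Integrable.of_bound (hmeas n).aestronglyMeasurable (n * B)
      (Eventually.of_forall fun x => hbd n x)
  -- The maxima increase with n, and composition with T does not change their integrals.
  have hnonneg : ∀ n, 0 ≤ ∫ x, (maximalSum T φ (n + 1) x - maximalSum T φ n (T x)) ∂μ := fun n => by
    have hi : Integrable (fun x => maximalSum T φ n (T x)) μ := hT.integrable_comp_of_integrable (hint n)
    rw [integral_sub (hint _) hi]
    have h1 : ∫ x, maximalSum T φ n (T x) ∂μ = ∫ x, maximalSum T φ n x ∂μ := by
      have h2 := integral_map (μ := μ) (f := maximalSum T φ n) hT.measurable.aemeasurable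
        (by rw [hT.map_eq]; exact (hmeas n).aestronglyMeasurable)
      rw [hT.map_eq] at h2
      exact h2.symm
    rw [h1, sub_nonneg]
    exact integral_mono (hint _) (hint _) fun x => maximalSum_le_succ _ _ _ _
  refine ge_of_tendsto' (x := atTop) (f := fun n =>
    ∫ x, (maximalSum T φ (n + 1) x - maximalSum T φ n (T x)) ∂μ) ?_ hnonneg
  refine tendsto_integral_of_dominated_convergence (fun _ => B) (fun n =>
    ((hmeas _).sub ((hmeas _).comp hT.measurable)).aestronglyMeasurable) (integrable_const _)
    (fun n => Eventually.of_forall fun x => ?_) ?_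
  · have h1 := maximalSum_nonneg T φ n (T x)
    have h2 := abs_le.1 (hB x)
    simp only [maximalSum, Real.norm_eq_abs]
    rw [abs_le]
    rcases max_cases 0 (φ x + maximalSum T φ n (T x)) with ⟨h3, h4⟩ | ⟨h3, h4⟩ <;>
      rw [h3] <;> constructor <;> linarith
  -- Once some Birkhoff sum is positive, the next maximum is positive, so the integrand equals φ x
  -- exactly from then on.
  · filter_upwards [h] with x hx
    obtain ⟨N, hN⟩ := hx
    have hmono : Monotone fun n => maximalSum T φ n x :=
      monotone_nat_of_le_succ fun n => maximalSum_le_succ T φ n x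
    refine tendsto_const_nhds.congr' ?_
    filter_upwards [eventually_ge_atTop N] with n hn
    have h1 : 0 < maximalSum T φ (n + 1) x := hN.trans_le
      ((birkhoffSum_le_maximalSum T φ N x).trans (hmono (by omega)))
    simp only [maximalSum] at h1 ⊢
    rcases max_cases 0 (φ x + maximalSum T φ n (T x)) with ⟨h3, h4⟩ | ⟨h3, h4⟩
    · rw [h3] at h1; exact absurd h1 (lt_irrefl _)
    · rw [h3]; ring

/-- The set where the limsup of the averages is at least c is invariant, hence null or of full
measure. Full measure contradicts the maximal inequality for φ minus a constant slightly below c but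
above the mean of φ. -/
lemma ae_eventually_birkhoffAverage_le (hT : Ergodic T μ) {φ : X → ℝ} (hφ : Measurable φ) {B : ℝ}
    (hB : ∀ x, |φ x| ≤ B) {c : ℝ} (hc : ∫ x, φ x ∂μ < c) :
    ∀ᵐ x ∂μ, ∀ᶠ n in atTop, birkhoffAverage ℝ T φ n x ≤ c := by
  have hTm := hT.measurable
  have hmeas : ∀ n, Measurable (birkhoffAverage ℝ T φ n) := fun n => by
    change Measurable fun x => (n : ℝ)⁻¹ * ∑ k ∈ Finset.range n, φ (T^[k] x)
    exact (Finset.measurable_fun_sum _ fun k _ => hφ.comp (hTm.iterate k)).const_mul _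
  let S : Set X := {x | ∀ j : ℕ, ∃ᶠ n in atTop, c - 1 / ((j : ℝ) + 1) < birkhoffAverage ℝ T φ n x}
  have hS : MeasurableSet S := by
    have : S = ⋂ j : ℕ, ⋂ N : ℕ, ⋃ n : ℕ, ⋃ _ : N ≤ n,
        {x | c - 1 / ((j : ℝ) + 1) < birkhoffAverage ℝ T φ n x} := by
      ext x
      simp [S, frequently_atTop]
    rw [this]
    exact MeasurableSet.iInter fun j => MeasurableSet.iInter fun N => MeasurableSet.iUnion fun n =>
      MeasurableSet.iUnion fun _ => measurableSet_lt measurable_const (hmeas n)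
  have hbdd : Bornology.IsBounded (Set.range φ) := by
    refine (Metric.isBounded_iff_subset_closedBall 0).2 ⟨B, ?_⟩
    rintro _ ⟨x, rfl⟩
    simpa using hB x
  have hshift : ∀ x, Tendsto (fun n => birkhoffAverage ℝ T φ n (T x) - birkhoffAverage ℝ T φ n x)
      atTop (𝓝 0) := fun x => tendsto_birkhoffAverage_apply_sub_birkhoffAverage' ℝ hbdd T x
  have hinv : T ⁻¹' S = S := by
    -- Averages at x and T x differ by o(1), which the gap between the thresholds for j + 1 and j
    -- absorbs. Quantifying over all j therefore makes S exactly invariant.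
    have key : ∀ u v : ℕ → ℝ, Tendsto (fun n => u n - v n) atTop (𝓝 0) →
        (∀ j : ℕ, ∃ᶠ n in atTop, c - 1 / ((j : ℝ) + 1) < v n) →
        ∀ j : ℕ, ∃ᶠ n in atTop, c - 1 / ((j : ℝ) + 1) < u n := by
      intro u v huv hv j
      have hj : 0 < 1 / ((j : ℝ) + 1) - 1 / (((j + 1 : ℕ) : ℝ) + 1) := by
        rw [sub_pos]
        exact one_div_lt_one_div_of_lt (by positivity) (by push_cast; linarith)
      have h1 := huv.eventually (lt_mem_nhds (neg_lt_zero.2 hj))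
      refine ((hv (j + 1)).and_eventually h1).mono fun n hn => ?_
      linarith [hn.1, hn.2]
    ext x
    refine ⟨fun hx => key _ _ ?_ hx, fun hx => key _ _ (hshift x) hx⟩
    simpa using (hshift x).neg
  rcases hT.toPreErgodic.ae_mem_or_ae_notMem hS hinv with h | h
  · exfalso
    obtain ⟨j, hj⟩ := exists_nat_one_div_lt (sub_pos.2 hc)
    have hB' : ∀ x, |φ x - (c - 1 / ((j : ℝ) + 1))| ≤ B + |c - 1 / ((j : ℝ) + 1)| := fun x =>
      (abs_sub _ _).trans (by linarith [hB x])
    have h0 := integral_nonneg_of_exists_birkhoffSum_pos hT.toMeasurePreserving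
      (hφ.sub_const (c - 1 / ((j : ℝ) + 1))) hB' (by
        filter_upwards [h] with x hx
        obtain ⟨n, hn, hn0⟩ := ((hx j).and_eventually (eventually_gt_atTop 0)).exists
        refine ⟨n, ?_⟩
        have hn' : (0 : ℝ) < n := by exact_mod_cast hn0
        have e : birkhoffSum T (fun x => φ x - (c - 1 / ((j : ℝ) + 1))) n x
            = birkhoffSum T φ n x - n * (c - 1 / ((j : ℝ) + 1)) := by
          simp [birkhoffSum, Finset.sum_sub_distrib, mul_sub]
        rw [e, sub_pos]
        rw [birkhoffAverage, smul_eq_mul, ← div_eq_inv_mul, lt_div_iff₀ hn'] at hn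
        linarith)
    have hint : Integrable φ μ := Integrable.of_bound hφ.aestronglyMeasurable B
      (Eventually.of_forall hB)
    rw [integral_sub hint (integrable_const _)] at h0
    simp at h0
    simp at hj
    linarith
  · filter_upwards [h] with x hx
    simp only [S, Set.mem_ofPred_eq, not_forall, not_frequently] at hx
    obtain ⟨j, hj⟩ := hx
    refine hj.mono fun n hn => ?_
    have : 0 < 1 / ((j : ℝ) + 1) := by positivity
    linarith

/-- The pointwise ergodic theorem for bounded functions. -/
lemma ae_tendsto_birkhoffAverage (hT : Ergodic T μ) {φ : X → ℝ} (hφ : Measurable φ) {B : ℝ}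
    (hB : ∀ x, |φ x| ≤ B) :
    ∀ᵐ x ∂μ, Tendsto (fun n => birkhoffAverage ℝ T φ n x) atTop (𝓝 (∫ x, φ x ∂μ)) := by
  have h1 : ∀ j : ℕ, ∀ᵐ x ∂μ, ∀ᶠ n in atTop,
      birkhoffAverage ℝ T φ n x ≤ ∫ x, φ x ∂μ + 1 / ((j : ℝ) + 1) := fun j =>
    ae_eventually_birkhoffAverage_le hT hφ hB (by have : 0 < 1 / ((j : ℝ) + 1) := by positivity
                                                  linarith)
  have h2 : ∀ j : ℕ, ∀ᵐ x ∂μ, ∀ᶠ n in atTop,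
      birkhoffAverage ℝ T (-φ) n x ≤ ∫ x, (-φ) x ∂μ + 1 / ((j : ℝ) + 1) := fun j =>
    ae_eventually_birkhoffAverage_le hT hφ.neg (B := B) (by simpa using hB)
      (by have : 0 < 1 / ((j : ℝ) + 1) := by positivity
          linarith)
  filter_upwards [ae_all_iff.2 h1, ae_all_iff.2 h2] with x hx1 hx2
  rw [Metric.tendsto_nhds]
  intro ε hε
  obtain ⟨j, hj⟩ := exists_nat_one_div_lt hε
  filter_upwards [hx1 j, hx2 j] with n hn1 hn2
  have e1 : birkhoffAverage ℝ T (-φ) n x = -birkhoffAverage ℝ T φ n x := by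
    simp [birkhoffAverage, birkhoffSum]
  have e2 : ∫ x, (-φ) x ∂μ = -∫ x, φ x ∂μ := by simp [integral_neg]
  rw [e1, e2] at hn2
  rw [Real.dist_eq, abs_lt]
  constructor <;> linarith

/-- Almost additive sequences of real numbers have means. -/
lemma exists_mean_of_almost_additive {c : ℕ → ℝ} {K : ℝ}
    (h : ∀ n k, |c (n + k) - c n - c k| ≤ K) :
    ∃ α, ∀ n : ℕ, 0 < n → |c n / n - α| ≤ K / n := by
  have hK : 0 ≤ K := (abs_nonneg _).trans (h 0 0)
  have hmul : ∀ n k : ℕ, |c ((k + 1) * n) - (k + 1 : ℕ) * c n| ≤ (k + 1 : ℕ) * K := fun n k => by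
    induction k with
    | zero => simpa using hK
    | succ k ih =>
      have h1 := abs_le.1 (h ((k + 1) * n) n)
      have h2 := abs_le.1 ih
      have e : (k + 1 + 1) * n = (k + 1) * n + n := by ring
      rw [e]
      push_cast at h2 ⊢
      rw [abs_le]
      constructor <;> linarith
  -- Both quotients are compared with c(kn)/(kn), reached by k blocks of length n and by n blocks of
  -- length k.
  have hdist : ∀ n k : ℕ, 0 < n → 0 < k → |c n / n - c k / k| ≤ K / n + K / k := by
    intro n k hn hk
    have h1 := hmul n (k - 1)
    have h2 := hmul k (n - 1)
    rw [Nat.sub_add_cancel hk] at h1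
    rw [Nat.sub_add_cancel hn, mul_comm n k] at h2
    have hn' : (0 : ℝ) < n := by exact_mod_cast hn
    have hk' : (0 : ℝ) < k := by exact_mod_cast hk
    have e : c n / n - c k / k = (k * c n - n * c k) / (n * k) := by field_simp
    have e2 : K / n + K / k = (k * K + n * K) / (n * k) := by field_simp
    rw [e, e2, abs_div, abs_of_pos (mul_pos hn' hk')]
    gcongr
    rw [abs_le] at h1 h2 ⊢
    constructor <;> linarith
  have hlim : Tendsto (fun n : ℕ => K / ((n + 1 : ℕ) : ℝ)) atTop (𝓝 0) :=
    (tendsto_const_div_atTop_nhds_zero_nat K).comp (tendsto_add_atTop_nat 1)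
  have hcauchy : CauchySeq fun n : ℕ => c (n + 1) / ((n + 1 : ℕ) : ℝ) := by
    refine cauchySeq_of_le_tendsto_0 (fun N : ℕ => K / ((N + 1 : ℕ) : ℝ) + K / ((N + 1 : ℕ) : ℝ))
      (fun n k N hn hk => ?_) (by simpa using hlim.add hlim)
    refine (hdist (n + 1) (k + 1) (by omega) (by omega)).trans ?_
    gcongr
  obtain ⟨α, hα⟩ := cauchySeq_tendsto_of_complete hcauchy
  refine ⟨α, fun n hn => ?_⟩
  have h1 : Tendsto (fun k : ℕ => |c n / n - c (k + 1) / ((k + 1 : ℕ) : ℝ)|) atTop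
      (𝓝 |c n / n - α|) := (tendsto_const_nhds.sub hα).abs
  have h2 : Tendsto (fun k : ℕ => K / n + K / ((k + 1 : ℕ) : ℝ)) atTop (𝓝 (K / n)) := by
    simpa using tendsto_const_nhds.add hlim
  exact le_of_tendsto_of_tendsto' h1 h2 fun k => hdist n (k + 1) hn (by omega)

/-- The pointwise ergodic theorem for almost additive cocycles. -/
lemma ae_tendsto_of_almost_additive (hT : Ergodic T μ) {a : ℕ → X → ℝ} {B : ℕ → ℝ} {K : ℝ}
    (ha : ∀ n, Measurable (a n)) (hB : ∀ n x, |a n x| ≤ B n)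
    (hK : ∀ n k x, |a (n + k) x - a n x - a k (T^[n] x)| ≤ K) :
    ∃ α, (∀ n : ℕ, 0 < n → |(∫ x, a n x ∂μ) / n - α| ≤ K / n) ∧
      ∀ᵐ x ∂μ, Tendsto (fun n : ℕ => a n x / n) atTop (𝓝 α) := by
  have hint : ∀ n, Integrable (a n) μ := fun n =>
    Integrable.of_bound (ha n).aestronglyMeasurable (B n) (Eventually.of_forall (hB n))
  have hTn : ∀ n, MeasurePreserving T^[n] μ μ := fun n => hT.toMeasurePreserving.iterate n
  have hintT : ∀ n k, Integrable (fun x => a k (T^[n] x)) μ := fun n k =>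
    (hTn n).integrable_comp_of_integrable (hint k)
  have hshift : ∀ n k, ∫ x, a k (T^[n] x) ∂μ = ∫ x, a k x ∂μ := fun n k => by
    have h2 := integral_map (μ := μ) (f := a k) (hTn n).measurable.aemeasurable
      (by rw [(hTn n).map_eq]; exact (ha k).aestronglyMeasurable)
    rw [(hTn n).map_eq] at h2
    exact h2.symm
  have hadd : ∀ n k, |(∫ x, a (n + k) x ∂μ) - ∫ x, a n x ∂μ - ∫ x, a k x ∂μ| ≤ K := fun n k => by
    have e1 := integral_sub (hint (n + k)) (hint n)
    have e2 := integral_sub (f := fun x => a (n + k) x - a n x) ((hint _).sub (hint _)) (hintT n k)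
    rw [← hshift n k, ← e1, ← e2]
    have := norm_integral_le_of_norm_le_const (μ := μ)
      (f := fun x => a (n + k) x - a n x - a k (T^[n] x)) (C := K)
      (Eventually.of_forall (hK n k))
    simpa using this
  obtain ⟨α, hα⟩ := exists_mean_of_almost_additive (c := fun n => ∫ x, a n x ∂μ) hadd
  refine ⟨α, hα, ?_⟩
  have hbirk : ∀ N, ∀ᵐ x ∂μ, Tendsto (fun n => birkhoffAverage ℝ T (a N) n x) atTop
      (𝓝 (∫ x, a N x ∂μ)) := fun N => ae_tendsto_birkhoffAverage hT (ha N) (hB N)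
  have hK0 : 0 ≤ K := (abs_nonneg _).trans (hadd 0 0)
  filter_upwards [ae_all_iff.2 hbirk] with x hx
  -- a_N ∘ T^k is within K of a_{k+N} - a_k. Summing over k < n and telescoping leaves N a_n up to
  -- terms bounded in n. After division by nN the error is K/N in the limit, and the ergodic theorem
  -- for the single function a_N applies.
  have hcomp : ∀ N n : ℕ, |birkhoffSum T (a N) n x - N * a n x|
      ≤ n * K + ∑ j ∈ Finset.range N, (K + B j + B j) := fun N n => by
    have h1 : |birkhoffSum T (a N) n x - ∑ k ∈ Finset.range n, (a (k + N) x - a k x)| ≤ n * K := by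
      rw [birkhoffSum, ← Finset.sum_sub_distrib]
      refine (Finset.abs_sum_le_sum_abs _ _).trans ?_
      rw [← nsmul_eq_mul, ← Finset.card_range n, ← Finset.sum_const, Finset.card_range]
      refine Finset.sum_le_sum fun k _ => ?_
      rw [abs_sub_comm]
      exact hK k N x
    have h2 : ∑ k ∈ Finset.range n, (a (k + N) x - a k x)
        = ∑ j ∈ Finset.range N, (a (n + j) x - a j x) := by
      have e1 := Finset.sum_range_add (fun k => a k x) n N
      have e2 := Finset.sum_range_add (fun k => a k x) N n
      rw [add_comm N n, e1] at e2
      simp only [Finset.sum_sub_distrib, add_comm _ N]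
      linarith
    have h3 : |∑ j ∈ Finset.range N, (a (n + j) x - a j x) - N * a n x|
        ≤ ∑ j ∈ Finset.range N, (K + B j + B j) := by
      have : (N : ℝ) * a n x = ∑ j ∈ Finset.range N, a n x := by simp
      rw [this, ← Finset.sum_sub_distrib]
      refine (Finset.abs_sum_le_sum_abs _ _).trans (Finset.sum_le_sum fun j _ => ?_)
      have g1 := abs_le.1 (hK n j x)
      have g2 := abs_le.1 (hB j x)
      have g3 := abs_le.1 (hB j (T^[n] x))
      rw [abs_le]
      constructor <;> linarith
    rw [h2] at h1
    rw [abs_le] at h1 h3 ⊢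
    constructor <;> linarith
  rw [Metric.tendsto_nhds]
  intro ε hε
  obtain ⟨N, hN⟩ := exists_nat_gt (max 0 (4 * K / ε))
  have hN0 : (0 : ℝ) < N := (le_max_left _ _).trans_lt hN
  have hNK : K / N < ε / 4 := by
    have := (le_max_right _ _).trans_lt hN
    rw [div_lt_iff₀ hε] at this
    rw [div_lt_iff₀ hN0]
    linarith
  have h1 := Metric.tendsto_nhds.1 (hx N) (N * (ε / 4)) (by positivity)
  have h2 := (tendsto_const_div_atTop_nhds_zero_nat
    (∑ j ∈ Finset.range N, (K + B j + B j))).eventually (gt_mem_nhds (show 0 < N * (ε / 4) by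
      positivity))
  filter_upwards [h1, h2, eventually_gt_atTop 0] with n hn1 hn2 hn0
  have hn' : (0 : ℝ) < n := by exact_mod_cast hn0
  have h3 := hcomp N n
  have h4 := hα N (by exact_mod_cast hN0)
  rw [Real.dist_eq, birkhoffAverage, smul_eq_mul, ← div_eq_inv_mul] at hn1
  have e1 : |birkhoffSum T (a N) n x / n - N * (a n x / n)| < N * (ε / 4) + N * (ε / 4) := by
    have : birkhoffSum T (a N) n x / n - N * (a n x / n)
        = (birkhoffSum T (a N) n x - N * a n x) / n := by field_simp
    rw [this, abs_div, abs_of_pos hn']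
    calc _ ≤ (n * K + ∑ j ∈ Finset.range N, (K + B j + B j)) / n := by gcongr
      _ = K + (∑ j ∈ Finset.range N, (K + B j + B j)) / n := by field_simp
      _ < _ := by
        rw [div_lt_iff₀ hN0] at hNK
        linarith
  have e2 : |(∫ x, a N x ∂μ) - N * α| ≤ N * (ε / 4) := by
    have : (∫ x, a N x ∂μ) - N * α = N * ((∫ x, a N x ∂μ) / N - α) := by field_simp
    rw [this, abs_mul, abs_of_pos hN0]
    gcongr
    exact h4.trans hNK.le
  rw [Real.dist_eq]
  have e3 : N * |a n x / n - α| < N * ε := by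
    rw [← abs_of_pos hN0, ← abs_mul, abs_of_pos hN0]
    rw [abs_lt] at hn1 e1 ⊢
    rw [abs_le] at e2
    constructor <;> linarith
  exact lt_of_mul_lt_mul_left e3 hN0.le

end Ergodic

/-! ### Spectral measures of bounded self-adjoint operators -/

section SpectralMeasure

variable {K : Type*} [NormedAddCommGroup K] [InnerProductSpace ℂ K] [CompleteSpace K]
  {a : K →L[ℂ] K} {R : ℝ}

lemma spectrum_subset_Icc (hR : ‖a‖ ≤ R) : spectrum ℝ a ⊆ Set.Icc (-R) R := fun x hx => by
  have h1 := spectrum.norm_le_norm_mul_of_mem hx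
  have h2 : ‖(1 : K →L[ℂ] K)‖ ≤ 1 := ContinuousLinearMap.norm_id_le
  rw [Real.norm_eq_abs] at h1
  exact abs_le.1 (h1.trans (((mul_le_of_le_one_right (norm_nonneg _) h2)).trans hR))

lemma integral_spectralMeasure_of_compactSupport (ψ : K) {g : ℝ → ℝ} (hg : Continuous g)
    (hs : HasCompactSupport g) :
    ∫ t, g t ∂(spectralMeasure a ψ) = (inner ℂ ψ (cfc g a ψ)).re :=
  RealRMK.integral_rieszMeasure (spectralFunctional a ψ) ⟨⟨g, hg⟩, hs⟩

/-- The functional calculus only sees the spectrum, so the functional vanishes on bump functions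
supported off [-R, R]. Regularity exhausts the open complement by compact sets. -/
lemma spectralMeasure_compl_Icc (ψ : K) (hR : ‖a‖ ≤ R) :
    spectralMeasure a ψ (Set.Icc (-R) R)ᶜ = 0 := by
  have : (spectralMeasure a ψ).Regular := RealRMK.regular_rieszMeasure _
  rw [isClosed_Icc.isOpen_compl.measure_eq_iSup_isCompact]
  simp only [ENNReal.iSup_eq_zero]
  intro k hk hkc
  obtain ⟨χ, h1, h0, hc, h01⟩ := exists_continuous_one_zero_of_isCompact hkc isClosed_Icc
    (Set.disjoint_left.2 fun x hx => hk hx)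
  have h := RealRMK.rieszMeasure_le_of_eq_one (spectralFunctional a ψ) (f := ⟨χ, hc⟩)
    (fun x => (h01 x).1) hkc (fun x hx => h1 hx)
  have e : spectralFunctional a ψ ⟨χ, hc⟩ = 0 := by
    change (inner ℂ ψ (cfc (χ : ℝ → ℝ) a ψ)).re = 0
    rw [cfc_congr (g := fun _ => (0 : ℝ)) fun x hx => h0 (spectrum_subset_Icc hR hx)]
    rw [cfc_const_zero]
    simp
  rw [e, ENNReal.ofReal_zero] at h
  exact le_antisymm h bot_le

lemma ae_mem_Icc_spectralMeasure (ψ : K) (hR : ‖a‖ ≤ R) :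
    ∀ᵐ t ∂(spectralMeasure a ψ), t ∈ Set.Icc (-R) R :=
  spectralMeasure_compl_Icc ψ hR

/-- The Riesz measure is tested on compactly supported functions only. A cutoff equal to 1 on [-‖a‖,
‖a‖] changes neither side. -/
lemma integral_spectralMeasure (ψ : K) {g : ℝ → ℝ} (hg : Continuous g) :
    ∫ t, g t ∂(spectralMeasure a ψ) = (inner ℂ ψ (cfc g a ψ)).re := by
  obtain ⟨χ, h1, -, hc, -⟩ := exists_continuous_one_zero_of_isCompact
    (isCompact_Icc (a := -‖a‖) (b := ‖a‖)) isClosed_empty (Set.disjoint_empty _)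
  have h := integral_spectralMeasure_of_compactSupport (a := a) ψ (g := fun t => g t * χ t)
    (hg.mul χ.continuous) hc.mul_left
  rw [cfc_congr (g := g) fun x hx => by
    simp [h1 (spectrum_subset_Icc le_rfl hx)]] at h
  rw [← h]
  refine integral_congr_ae ?_
  filter_upwards [ae_mem_Icc_spectralMeasure ψ (le_refl ‖a‖)] with t ht
  simp [h1 ht]

lemma isProbabilityMeasure_spectralMeasure (ha : IsSelfAdjoint a) {ψ : K} (hψ : ‖ψ‖ = 1) :
    IsProbabilityMeasure (spectralMeasure a ψ) := by
  have h := integral_spectralMeasure (a := a) ψ (g := fun _ => (1 : ℝ)) continuous_const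
  rw [cfc_const_one ℝ a] at h
  have h2 : (inner ℂ ψ ψ).re = 1 := by
    have := inner_self_eq_norm_sq (𝕜 := ℂ) ψ
    rw [hψ] at this
    simpa using this
  simp only [integral_const, smul_eq_mul, mul_one, one_apply_eq_self, h2] at h
  rw [measureReal_def, ENNReal.toReal_eq_one_iff] at h
  exact ⟨h⟩

lemma integral_pow_spectralMeasure (ha : IsSelfAdjoint a) (ψ : K) (k : ℕ) :
    ∫ t, t ^ k ∂(spectralMeasure a ψ) = (inner ℂ ψ ((a ^ k) ψ)).re := by
  rw [integral_spectralMeasure ψ (continuous_pow k), cfc_pow_id (R := ℝ) a k]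

lemma integrable_spectralMeasure (ψ : K) [IsFiniteMeasure (spectralMeasure a ψ)] {g : ℝ → ℝ}
    (hg : Continuous g) : Integrable g (spectralMeasure a ψ) := by
  obtain ⟨B, hB⟩ := (isCompact_Icc (a := -‖a‖) (b := ‖a‖)).exists_bound_of_continuousOn
    hg.continuousOn
  refine Integrable.of_bound hg.aestronglyMeasurable B ?_
  filter_upwards [ae_mem_Icc_spectralMeasure ψ (le_refl ‖a‖)] with t ht using hB t ht

lemma abs_integral_spectralMeasure_le {ψ : K} [IsProbabilityMeasure (spectralMeasure a ψ)]
    (hR : ‖a‖ ≤ R) {g : ℝ → ℝ} {B : ℝ} (hB : ∀ t ∈ Set.Icc (-R) R, |g t| ≤ B) :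
    |∫ t, g t ∂(spectralMeasure a ψ)| ≤ B := by
  have := norm_integral_le_of_norm_le_const (μ := spectralMeasure a ψ) (f := g) (C := B) (by
    filter_upwards [ae_mem_Icc_spectralMeasure ψ hR] with t ht using hB t ht)
  simpa using this

end SpectralMeasure

/-- A family of probability measures is measurable if the integrals of bounded continuous functions
are. -/
lemma measurable_of_measurable_integral {X : Type*} [MeasurableSpace X] {κ : X → Measure ℝ}
    [∀ x, IsProbabilityMeasure (κ x)]
    (h : ∀ g : ℝ → ℝ, Continuous g → Measurable fun x => ∫ t, g t ∂(κ x)) : Measurable κ := by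
  -- Closed sets form a generating π-system, and the mass of a closed set is a limit of integrals of
  -- continuous functions.
  refine .measure_of_isPiSystem_of_isProbabilityMeasure
    ((BorelSpace.measurable_eq (α := ℝ)).trans borel_eq_generateFrom_isClosed) isPiSystem_isClosed
    fun F hF => ?_
  refine measurable_of_tendsto_metrizable (f := fun n x => ∫⁻ t, hF.apprSeq n t ∂(κ x))
    (fun n => ?_) (tendsto_pi_nhds.2 fun x => HasOuterApproxClosed.tendsto_lintegral_apprSeq hF (κ x))
  have : ∀ x, ∫⁻ t, hF.apprSeq n t ∂(κ x) = ENNReal.ofReal (∫ t, (hF.apprSeq n t : ℝ) ∂(κ x)) := by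
    intro x
    rw [← BoundedContinuousFunction.toReal_lintegral_coe_eq_integral, ENNReal.ofReal_toReal]
    exact (BoundedContinuousFunction.lintegral_lt_top_of_nnreal _ _).ne
  simp only [this]
  exact (h _ (by fun_prop)).ennreal_ofReal

/-! ### Moments of the spectral measures and finite volume operators -/

section Moments

variable {Θ : Type*} [MetricSpace Θ] {m : ℕ}

lemma norm_blockDiag_le {m : ℕ} (D : ℤ → Matrix (Fin m) (Fin m) ℂ) (K : ℝ) (hK : 0 ≤ K)
    (hD : ∀ n, ‖Matrix.toEuclideanCLM (𝕜 := ℂ) (D n)‖ ≤ K) : ‖blockDiag D K hK hD‖ ≤ K :=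
  lp.norm_mapCLM_le 2 _ hK hD

lemma norm_shift_le (m : ℕ) (k : ℤ) : ‖shift m k‖ ≤ 1 :=
  LinearMap.mkContinuous_norm_le _ zero_le_one _

lemma exists_norm_stripOperator_le [CompactSpace Θ] (T : Θ ≃ₜ Θ) (C : GL (Fin m) ℂ)
    (f : C(Θ, selfAdjoint (Matrix (Fin m) (Fin m) ℂ))) :
    ∃ R, ∀ θ, ‖stripOperator T C f θ‖ ≤ R := by
  refine ⟨‖Matrix.toEuclideanCLM (𝕜 := ℂ) (C : Matrix (Fin m) (Fin m) ℂ)ᴴ‖ * 1 + ‖clmFamily f‖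
    + ‖Matrix.toEuclideanCLM (𝕜 := ℂ) (C : Matrix (Fin m) (Fin m) ℂ)‖ * 1, fun θ => ?_⟩
  refine (norm_add_le _ _).trans (add_le_add ((norm_add_le _ _).trans (add_le_add ?_ ?_)) ?_)
  · exact (ContinuousLinearMap.opNorm_comp_le _ _).trans (mul_le_mul (norm_blockDiag_le _ _ _ _)
      (norm_shift_le _ _) (norm_nonneg _) (norm_nonneg _))
  · exact norm_blockDiag_le _ _ _ _
  · exact (ContinuousLinearMap.opNorm_comp_le _ _).trans (mul_le_mul (norm_blockDiag_le _ _ _ _)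
      (norm_shift_le _ _) (norm_nonneg _) (norm_nonneg _))

lemma homeomorph_zpow_iterate {Θ : Type*} [TopologicalSpace Θ] (T : Θ ≃ₜ Θ) (y : ℤ) (l n : ℕ)
    (h : y + l = n) (θ : Θ) : (T ^ y) (T^[l] θ) = T^[n] θ := by
  have key : ∀ k : ℕ, ∀ x, (T ^ (k : ℤ)) x = T^[k] x := fun k => by
    induction k with
    | zero => intro x; simp
    | succ k ih =>
      intro x
      rw [Function.iterate_succ_apply, ← ih, Nat.cast_succ, zpow_add_one]
      rfl
  rw [← key, ← key, ← h, zpow_add]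
  rfl

lemma sum_ite_eq_of_support {n : ℕ} (w : ℤ → Fin m → ℂ) (M : Fin m → ℂ) (z : ℤ)
    (hw : (z < 0 ∨ (n : ℤ) ≤ z) → w z = 0) :
    ∑ q : Fin n × Fin m, (if (q.1 : ℤ) = z then M q.2 else 0) * w q.1 q.2
      = ∑ j, M j * w z j := by
  rw [Fintype.sum_prod_type]
  by_cases hz : z < 0 ∨ (n : ℤ) ≤ z
  · rw [hw hz]
    simp only [Pi.zero_apply, mul_zero, Finset.sum_const_zero]
    refine Finset.sum_eq_zero fun p _ => Finset.sum_eq_zero fun j _ => ?_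
    rw [if_neg (by have := p.2; omega), zero_mul]
  · push Not at hz
    have hz' : z.toNat < n := by omega
    rw [Finset.sum_eq_single (⟨z.toNat, hz'⟩ : Fin n)]
    · have : ((z.toNat : ℕ) : ℤ) = z := by omega
      simp [this]
    · intro p _ hp
      refine Finset.sum_eq_zero fun j _ => ?_
      rw [if_neg (fun h => hp (Fin.ext (by simp only at h ⊢; omega))), zero_mul]
    · simp

/-- For vectors vanishing at the two sites just outside the box, truncation to the box loses no
neighbour term. -/
lemma finiteOp_mulVec (T : Θ ≃ₜ Θ) (C : GL (Fin m) ℂ)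
    (f : C(Θ, selfAdjoint (Matrix (Fin m) (Fin m) ℂ))) (θ : Θ) (n : ℕ) (w : ℤ → Fin m → ℂ)
    (h0 : w (-1) = 0) (hn : w n = 0) (p : Fin n × Fin m) :
    (finiteOp T C f θ n *ᵥ fun q => w q.1 q.2) p
      = ((C.1ᴴ *ᵥ w (p.1 - 1)) + ((f (T^[p.1] θ)).1 *ᵥ w p.1) + (C.1 *ᵥ w (p.1 + 1))) p.2 := by
  have e1 := sum_ite_eq_of_support (n := n) w (fun j => C.1ᴴ p.2 j) (p.1 - 1) (fun h => by
    have := p.1.2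
    have : (p.1 : ℤ) - 1 = -1 := by omega
    rw [this, h0])
  have e2 := sum_ite_eq_of_support (n := n) w (fun j => (f (T^[p.1] θ)).1 p.2 j) p.1 (fun h => by
    have := p.1.2
    omega)
  have e3 := sum_ite_eq_of_support (n := n) w (fun j => C.1 p.2 j) (p.1 + 1) (fun h => by
    have := p.1.2
    have : (p.1 : ℤ) + 1 = n := by omega
    rw [this, hn])
  simp only [Pi.add_apply, Matrix.mulVec, dotProduct]
  rw [← e1, ← e2, ← e3, ← Finset.sum_add_distrib, ← Finset.sum_add_distrib]
  refine Finset.sum_congr rfl fun q _ => ?_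
  rw [← add_mul, ← add_mul]
  congr 1
  simp only [finiteOp, Matrix.of_apply]
  congr 1
  · congr 1
    · exact if_congr (by omega) rfl rfl
    · exact if_congr (by omega) rfl rfl
  · exact if_congr (by omega) rfl rfl

variable [CompactSpace Θ]

/-- Finite propagation: away from the boundary, the powers of the strip operator and of its
restriction to a finite box have the same matrix elements. -/
lemma stripOperator_pow_delta (T : Θ ≃ₜ Θ) (C : GL (Fin m) ℂ)
    (f : C(Θ, selfAdjoint (Matrix (Fin m) (Fin m) ℂ))) (θ : Θ) (n : ℕ) (l : Fin n) (i : Fin m)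
    (k : ℕ) (hl : k ≤ l) (hn : l + k < n) :
    (∀ y : ℤ, (k : ℤ) < |y| →
      ((stripOperator T C f (T^[l] θ) ^ k) (delta 0 i) y : Fin m → ℂ) = 0) ∧
    ∀ p : Fin n × Fin m, ((stripOperator T C f (T^[l] θ) ^ k) (delta 0 i) (p.1 - l) : Fin m → ℂ) p.2
      = (finiteOp T C f θ n ^ k) p (l, i) := by
  induction k with
  | zero =>
    constructor
    · intro y hy
      have : y ≠ 0 := by rintro rfl; simp at hy
      simp [delta, this]
    · intro p
      by_cases h : p.1 = l
      · subst h
        simp [delta, Matrix.one_apply, Prod.ext_iff]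
      · have h' : ((p.1 : ℕ) : ℤ) - l ≠ 0 := fun h' => h (by ext; omega)
        simp [delta, Prod.ext_iff, h, h']
  | succ k ih =>
    obtain ⟨ih1, ih2⟩ := ih (by omega) (by omega)
    simp only [pow_succ', mul_apply_eq_comp, stripOperator_apply]
    constructor
    · intro y hy
      push_cast at hy
      have e0 : ∀ z : ℤ, |y - z| ≤ 1 → (k : ℤ) < |z| := fun z hz => by
        have := abs_sub_abs_le_abs_sub y z
        omega
      rw [ih1 (y - 1) (e0 _ (by simp)), ih1 y (e0 _ (by simp)), ih1 (y + 1) (e0 _ (by simp))]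
      simp
    · intro p
      have hT : (T ^ ((p.1 : ℤ) - l)) (T^[l] θ) = T^[p.1] θ :=
        homeomorph_zpow_iterate T _ _ _ (by ring) θ
      rw [hT]
      -- Site y of the box is site y - l for the operator based at T^l θ. The sites -1 and n are at
      -- distance more than k from l, so the first half of the induction hypothesis supplies the
      -- vanishing.
      have := finiteOp_mulVec T C f θ n (fun y =>
        ((stripOperator T C f (T^[l] θ) ^ k) (delta 0 i) (y - l) : Fin m → ℂ))
        (ih1 _ (by rw [abs_of_neg (by omega)]; omega)) (ih1 _ (by rw [abs_of_pos (by omega)]; omega)) p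
      rw [Matrix.mul_apply]
      simp only [ih2, Matrix.mulVec, dotProduct] at this
      rw [this]
      simp only [sub_right_comm _ (1 : ℤ), add_sub_right_comm]

lemma integral_pow_spectralMeasure_delta (T : Θ ≃ₜ Θ) (C : GL (Fin m) ℂ)
    (f : C(Θ, selfAdjoint (Matrix (Fin m) (Fin m) ℂ))) (θ : Θ) (n : ℕ) (l : Fin n) (i : Fin m)
    (k : ℕ) (hl : k ≤ l) (hn : l + k < n) :
    ∫ t, t ^ k ∂(spectralMeasure (stripOperator T C f (T^[l] θ)) (delta 0 i))
      = ((finiteOp T C f θ n ^ k) (l, i) (l, i)).re := by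
  rw [integral_pow_spectralMeasure (stripOperator_isSelfAdjoint T C f _), delta,
    lp.inner_single_left]
  have := (stripOperator_pow_delta T C f θ n l i k hl hn).2 (l, i)
  rw [← this, EuclideanSpace.inner_single_left]
  simp [delta]

instance (T : Θ ≃ₜ Θ) (C : GL (Fin m) ℂ) (f : C(Θ, selfAdjoint (Matrix (Fin m) (Fin m) ℂ)))
    (θ : Θ) (i : Fin m) :
    IsProbabilityMeasure (spectralMeasure (stripOperator T C f θ) (delta 0 i)) :=
  isProbabilityMeasure_spectralMeasure (stripOperator_isSelfAdjoint T C f θ) (by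
    rw [delta, lp.norm_single (by norm_num)]
    simp)

end Moments

/-! ### Finite volume eigenvalue counts and the density of states -/

section FiniteVolume

variable {Θ : Type*} [MetricSpace Θ] {m : ℕ}

lemma trace_pow_eq_sum_eigenvalues {ι : Type*} [Fintype ι] [DecidableEq ι] {A : Matrix ι ι ℂ}
    (hA : A.IsHermitian) (k : ℕ) : (A ^ k).trace = ∑ j, ((hA.eigenvalues j ^ k : ℝ) : ℂ) := by
  conv_lhs => rw [hA.spectral_theorem, ← map_pow, Unitary.conjStarAlgAut_apply,
    Matrix.trace_mul_cycle]
  simp [Matrix.diagonal_pow, Matrix.trace]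

lemma sum_ite_le_sum {α β : Type*} [Fintype α] [Fintype β] (P : α → Prop) [DecidablePred P]
    (hP : ∀ x y, P x → P y → x = y) (g : β → ℝ) (hg : ∀ j, 0 ≤ g j) :
    ∑ q : α × β, (if P q.1 then g q.2 else 0) ≤ ∑ j, g j := by
  rw [Fintype.sum_prod_type_right]
  refine Finset.sum_le_sum fun j _ => ?_
  simp only
  rw [← Finset.sum_filter, Finset.sum_const, nsmul_eq_mul]
  refine mul_le_of_le_one_left (hg j) ?_
  exact_mod_cast Finset.card_le_one.2 fun x hx y hy =>
    hP x y (Finset.mem_filter.1 hx).2 (Finset.mem_filter.1 hy).2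

lemma sum_row_le_sum {ι : Type*} [Fintype ι] (A : Matrix ι ι ℂ) (i : ι) :
    ∑ j, ‖A i j‖ ≤ ∑ i, ∑ j, ‖A i j‖ :=
  Finset.single_le_sum (f := fun i => ∑ j, ‖A i j‖)
    (fun _ _ => Finset.sum_nonneg fun _ _ => norm_nonneg _) (Finset.mem_univ i)

open scoped Matrix.Norms.Operator in
lemma linfty_opNorm_le_of_sum_row {ι : Type*} [Fintype ι] (A : Matrix ι ι ℂ) {R : ℝ} (hR : 0 ≤ R)
    (h : ∀ i, ∑ j, ‖A i j‖ ≤ R) : ‖A‖ ≤ R := by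
  rw [Matrix.linfty_opNorm_def]
  lift R to NNReal using hR
  rw [NNReal.coe_le_coe]
  refine Finset.sup_le fun i _ => ?_
  have := h i
  rw [← NNReal.coe_le_coe]
  simpa using this

open scoped Matrix.Norms.Operator in
lemma norm_apply_le_linfty_opNorm {ι : Type*} [Fintype ι] (A : Matrix ι ι ℂ) (i j : ι) :
    ‖A i j‖ ≤ ‖A‖ := by
  rw [Matrix.linfty_opNorm_def]
  have h1 : ‖A i j‖₊ ≤ ∑ j, ‖A i j‖₊ :=
    Finset.single_le_sum (f := fun j => ‖A i j‖₊) (fun _ _ => zero_le) (Finset.mem_univ j)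
  exact_mod_cast h1.trans (Finset.le_sup (f := fun i => ∑ j, ‖A i j‖₊) (Finset.mem_univ i))

lemma exists_sum_row_finiteOp_le [CompactSpace Θ] (T : Θ ≃ₜ Θ) (C : GL (Fin m) ℂ)
    (f : C(Θ, selfAdjoint (Matrix (Fin m) (Fin m) ℂ))) :
    ∃ R, 0 ≤ R ∧ ∀ θ n p, ∑ q, ‖finiteOp T C f θ n p q‖ ≤ R := by
  have hf : Continuous fun θ => ∑ i, ∑ j, ‖(f θ).1 i j‖ := by
    have := continuous_subtype_val.comp f.continuous
    refine continuous_finsetSum _ fun i _ => continuous_finsetSum _ fun j _ => ?_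
    exact (this.matrix_elem i j).norm
  obtain ⟨B, hB⟩ := (isCompact_univ (X := Θ)).exists_bound_of_continuousOn hf.continuousOn
  have hB' : ∀ θ i, ∑ j, ‖(f θ).1 i j‖ ≤ |B| := fun θ i =>
    (sum_row_le_sum _ i).trans ((le_abs_self _).trans ((hB θ trivial).trans (le_abs_self _)))
  have h0 : ∀ A : Matrix (Fin m) (Fin m) ℂ, 0 ≤ ∑ i, ∑ j, ‖A i j‖ := fun A =>
    Finset.sum_nonneg fun _ _ => Finset.sum_nonneg fun _ _ => norm_nonneg _
  refine ⟨(∑ i, ∑ j, ‖C.1ᴴ i j‖) + |B| + ∑ i, ∑ j, ‖C.1 i j‖,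
    add_nonneg (add_nonneg (h0 _) (abs_nonneg _)) (h0 _), fun θ n p => ?_⟩
  have e1 := (sum_ite_le_sum (fun x : Fin n => (x : ℕ) + 1 = p.1) (fun x y hx hy => by
    ext; omega) (fun j => ‖C.1ᴴ p.2 j‖) fun _ => norm_nonneg _).trans (sum_row_le_sum _ p.2)
  have e2 := (sum_ite_le_sum (fun x : Fin n => (p.1 : ℕ) = x) (fun x y hx hy => by
    ext; omega) (fun j => ‖(f (T^[p.1] θ)).1 p.2 j‖) fun _ => norm_nonneg _).trans (hB' _ p.2)
  have e3 := (sum_ite_le_sum (fun x : Fin n => (p.1 : ℕ) + 1 = x) (fun x y hx hy => by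
    ext; omega) (fun j => ‖C.1 p.2 j‖) fun _ => norm_nonneg _).trans (sum_row_le_sum _ p.2)
  refine le_trans ?_ (add_le_add (add_le_add e1 e2) e3)
  rw [← Finset.sum_add_distrib, ← Finset.sum_add_distrib]
  refine Finset.sum_le_sum fun q _ => ?_
  simp only [finiteOp, Matrix.of_apply]
  refine (norm_add₃_le).trans (le_of_eq ?_)
  congr 1
  · congr 1 <;> split_ifs <;> simp
  · split_ifs <;> simp

-- The maximal row sum is a submultiplicative norm that dominates entries and eigenvalues. It is
-- bounded uniformly in n and θ because each row has at most three nonzero blocks.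
open scoped Matrix.Norms.Operator in
lemma exists_finiteOp_bound [CompactSpace Θ] (T : Θ ≃ₜ Θ) (C : GL (Fin m) ℂ)
    (f : C(Θ, selfAdjoint (Matrix (Fin m) (Fin m) ℂ))) :
    ∃ R, 0 ≤ R ∧ ∀ θ n, (∀ j, |(finiteOp_isHermitian T C f θ n).eigenvalues j| ≤ R) ∧
      ∀ k p, ‖(finiteOp T C f θ n ^ k) p p‖ ≤ R ^ k := by
  obtain ⟨R, hR, h⟩ := exists_sum_row_finiteOp_le T C f
  refine ⟨R, hR, fun θ n => ⟨fun j => ?_, fun k p => ?_⟩⟩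
  · have : Nonempty (Fin n × Fin m) := ⟨j⟩
    have h1 := spectrum.norm_le_norm_mul_of_mem
      ((finiteOp_isHermitian T C f θ n).eigenvalues_mem_spectrum_real j)
    have h2 : ‖(1 : Matrix (Fin n × Fin m) (Fin n × Fin m) ℂ)‖ ≤ 1 := by
      refine linfty_opNorm_le_of_sum_row _ zero_le_one fun i => ?_
      simp [Matrix.one_apply, apply_ite]
    exact h1.trans ((mul_le_of_le_one_right (norm_nonneg _) h2).trans
      (linfty_opNorm_le_of_sum_row _ hR (h θ n)))
  · rcases Nat.eq_zero_or_pos k with rfl | hk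
    · simp
    · exact (norm_apply_le_linfty_opNorm _ p p).trans ((norm_pow_le' _ hk).trans
        (pow_le_pow_left₀ (norm_nonneg _) (linfty_opNorm_le_of_sum_row _ hR (h θ n)) k))

lemma continuous_finiteOp (T : Θ ≃ₜ Θ) (C : GL (Fin m) ℂ)
    (f : C(Θ, selfAdjoint (Matrix (Fin m) (Fin m) ℂ))) (n : ℕ) :
    Continuous fun θ => finiteOp T C f θ n := by
  have hf : Continuous fun θ => (f θ).1 := continuous_subtype_val.comp f.continuous
  refine continuous_matrix fun p q => ?_
  simp only [finiteOp, Matrix.of_apply]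
  refine (continuous_const.add ?_).add continuous_const
  split_ifs
  · exact (hf.comp (T.continuous.iterate _)).matrix_elem _ _
  · exact continuous_const

variable [CompactSpace Θ]

/-- The sum over `i` of the integrals of `ψ` against the spectral measures at `δ_{0,i}`. -/
def spectralSum (T : Θ ≃ₜ Θ) (C : GL (Fin m) ℂ) (f : C(Θ, selfAdjoint (Matrix (Fin m) (Fin m) ℂ)))
    (ψ : ℝ → ℝ) (θ : Θ) : ℝ :=
  ∑ i, ∫ t, ψ t ∂(spectralMeasure (stripOperator T C f θ) (delta 0 i))

variable (T : Θ ≃ₜ Θ) (C : GL (Fin m) ℂ) (f : C(Θ, selfAdjoint (Matrix (Fin m) (Fin m) ℂ)))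

lemma spectralSum_pow (θ : Θ) (n : ℕ) (l : Fin n) (k : ℕ) (hl : k ≤ l) (hn : l + k < n) :
    spectralSum T C f (fun t => t ^ k) (T^[l] θ)
      = ∑ i, ((finiteOp T C f θ n ^ k) (l, i) (l, i)).re :=
  Finset.sum_congr rfl fun i _ => integral_pow_spectralMeasure_delta T C f θ n l i k hl hn

lemma abs_spectralSum_le {R : ℝ} (hR : ∀ θ, ‖stripOperator T C f θ‖ ≤ R) {ψ : ℝ → ℝ} {B : ℝ}
    (hB : ∀ t ∈ Set.Icc (-R) R, |ψ t| ≤ B) (θ : Θ) : |spectralSum T C f ψ θ| ≤ m * B := by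
  refine (Finset.abs_sum_le_sum_abs _ _).trans ((Finset.sum_le_sum fun i _ =>
    abs_integral_spectralMeasure_le (hR θ) hB).trans ?_)
  simp

lemma spectralSum_add {ψ χ : ℝ → ℝ} (hψ : Continuous ψ) (hχ : Continuous χ) (θ : Θ) :
    spectralSum T C f (fun t => ψ t + χ t) θ = spectralSum T C f ψ θ + spectralSum T C f χ θ := by
  simp only [spectralSum, ← Finset.sum_add_distrib]
  exact Finset.sum_congr rfl fun i _ => integral_add (integrable_spectralMeasure _ hψ)
    (integrable_spectralMeasure _ hχ)

lemma spectralSum_const_mul (c : ℝ) (ψ : ℝ → ℝ) (θ : Θ) :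
    spectralSum T C f (fun t => c * ψ t) θ = c * spectralSum T C f ψ θ := by
  simp only [spectralSum, Finset.mul_sum, integral_const_mul]

/-- Only the k sites nearest to each end contribute. -/
lemma abs_sum_le_of_interior {n k : ℕ} {b : ℝ} (hb : 0 ≤ b) (d : Fin n → ℝ)
    (hd : ∀ l, |d l| ≤ b) (h0 : ∀ l : Fin n, k ≤ l → l + k < n → d l = 0) :
    |∑ l, d l| ≤ 2 * k * b := by
  have h1 : ∀ l : Fin n, |d l| ≤ (if (l : ℕ) < k then b else 0)
      + (if n ≤ (l : ℕ) + k then b else 0) := fun l => by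
    have := hd l
    split_ifs with h1 h2 h2
    · linarith
    · linarith
    · linarith
    · rw [h0 l (by omega) (by omega)]; simp
  refine (Finset.abs_sum_le_sum_abs _ _).trans ((Finset.sum_le_sum fun l _ => h1 l).trans ?_)
  rw [Finset.sum_add_distrib, ← Finset.sum_filter, ← Finset.sum_filter, Finset.sum_const,
    Finset.sum_const, nsmul_eq_mul, nsmul_eq_mul]
  have c1 : (Finset.univ.filter fun l : Fin n => (l : ℕ) < k).card ≤ k := by
    rw [← Finset.card_range k]
    exact Finset.card_le_card_of_injOn (fun l => (l : ℕ)) (fun l hl => by simpa using hl)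
      (fun x _ y _ h => Fin.ext h)
  have c2 : (Finset.univ.filter fun l : Fin n => n ≤ (l : ℕ) + k).card ≤ k := by
    rw [← Finset.card_range k]
    exact Finset.card_le_card_of_injOn (fun l => n - 1 - (l : ℕ))
      (fun l hl => by
        have h2 := l.2
        have h3 : n ≤ (l : ℕ) + k := by simpa using hl
        simp only [Finset.coe_range, Set.mem_Iio]
        omega)
      (fun x _ y _ h => by
        have := x.2
        have := y.2
        simp only at h
        ext; omega)
  have c1' : ((Finset.univ.filter fun l : Fin n => (l : ℕ) < k).card : ℝ) ≤ k := by exact_mod_cast c1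
  have c2' : ((Finset.univ.filter fun l : Fin n => n ≤ (l : ℕ) + k).card : ℝ) ≤ k := by
    exact_mod_cast c2
  nlinarith [mul_le_mul_of_nonneg_right c1' hb, mul_le_mul_of_nonneg_right c2' hb]

/-- The power sum of the eigenvalues is the trace of H_n^k. Its diagonal entries equal the moments
of the spectral measures along the orbit, except near the boundary, where at most 2k sites give
bounded errors. -/
lemma exists_abs_sum_pow_eigenvalues_sub_le (k : ℕ) : ∃ c, ∀ n θ,
    |∑ j, (finiteOp_isHermitian T C f θ n).eigenvalues j ^ k
      - birkhoffSum T (spectralSum T C f fun t => t ^ k) n θ| ≤ c := by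
  obtain ⟨R, hR0, hR⟩ := exists_finiteOp_bound T C f
  obtain ⟨R', hR'⟩ := exists_norm_stripOperator_le T C f
  refine ⟨2 * k * (m * R ^ k + m * |R'| ^ k), fun n θ => ?_⟩
  have h1 : ∑ j, (finiteOp_isHermitian T C f θ n).eigenvalues j ^ k
      = ∑ l : Fin n, ∑ i, ((finiteOp T C f θ n ^ k) (l, i) (l, i)).re := by
    have := congrArg Complex.re (trace_pow_eq_sum_eigenvalues (finiteOp_isHermitian T C f θ n) k)
    rw [← Complex.ofReal_sum, Complex.ofReal_re] at this
    rw [← this, Matrix.trace, Complex.re_sum, Fintype.sum_prod_type]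
    rfl
  rw [h1, birkhoffSum, Finset.sum_range, ← Finset.sum_sub_distrib]
  refine abs_sum_le_of_interior (by positivity) _ (fun l => ?_) fun l hl hn => ?_
  · refine (abs_sub _ _).trans (add_le_add ?_ ?_)
    · refine (Finset.abs_sum_le_sum_abs _ _).trans ((Finset.sum_le_sum fun i _ =>
        (Complex.abs_re_le_norm _).trans ((hR θ n).2 k _)).trans ?_)
      simp
    · refine abs_spectralSum_le T C f hR' (fun t ht => ?_) _
      rw [abs_pow]
      exact pow_le_pow_left₀ (abs_nonneg _) ((abs_le.2 ht).trans (le_abs_self _)) k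
  · rw [spectralSum_pow T C f θ n l k hl hn, sub_self]

lemma birkhoffSum_add_fun {X : Type*} (S : X → X) (g h : X → ℝ) (n : ℕ) (x : X) :
    birkhoffSum S (fun x => g x + h x) n x = birkhoffSum S g n x + birkhoffSum S h n x :=
  Finset.sum_add_distrib

open Polynomial in
lemma exists_abs_sum_eval_eigenvalues_sub_le (q : ℝ[X]) : ∃ c, ∀ n θ,
    |∑ j, q.eval ((finiteOp_isHermitian T C f θ n).eigenvalues j)
      - birkhoffSum T (spectralSum T C f fun t => q.eval t) n θ| ≤ c := by
  induction q using Polynomial.induction_on' with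
  | add p q hp hq =>
    obtain ⟨c, hc⟩ := hp
    obtain ⟨d, hd⟩ := hq
    refine ⟨c + d, fun n θ => ?_⟩
    have e : spectralSum T C f (fun t => (p + q).eval t) = fun θ =>
        spectralSum T C f (fun t => p.eval t) θ + spectralSum T C f (fun t => q.eval t) θ := by
      ext θ
      simp only [Polynomial.eval_add]
      exact spectralSum_add T C f p.continuous q.continuous θ
    rw [e, birkhoffSum_add_fun]
    simp only [Polynomial.eval_add, Finset.sum_add_distrib]
    rw [add_sub_add_comm]
    exact (abs_add_le _ _).trans (add_le_add (hc n θ) (hd n θ))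
  | monomial k a =>
    obtain ⟨c, hc⟩ := exists_abs_sum_pow_eigenvalues_sub_le T C f k
    refine ⟨|a| * c, fun n θ => ?_⟩
    have e : spectralSum T C f (fun t => (monomial k a).eval t) = fun θ =>
        a * spectralSum T C f (fun t => t ^ k) θ := by
      ext θ
      simp only [Polynomial.eval_monomial]
      exact spectralSum_const_mul T C f a _ θ
    have e2 : birkhoffSum T (fun θ => a * spectralSum T C f (fun t => t ^ k) θ) n θ
        = a * birkhoffSum T (spectralSum T C f (fun t => t ^ k)) n θ := by
      simp [birkhoffSum, Finset.mul_sum]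
    rw [e, e2]
    simp only [Polynomial.eval_monomial]
    rw [← Finset.mul_sum, ← mul_sub, abs_mul]
    exact mul_le_mul_of_nonneg_left (hc n θ) (abs_nonneg _)

lemma abs_spectralSum_sub_le {R : ℝ} (hR : ∀ θ, ‖stripOperator T C f θ‖ ≤ R) {ψ χ : ℝ → ℝ}
    (hψ : Continuous ψ) (hχ : Continuous χ) {ε : ℝ} (h : ∀ t ∈ Set.Icc (-R) R, |ψ t - χ t| ≤ ε)
    (θ : Θ) : |spectralSum T C f ψ θ - spectralSum T C f χ θ| ≤ m * ε := by
  have := abs_spectralSum_le T C f hR h θ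
  have e := spectralSum_add T C f (hψ.sub hχ) hχ θ
  simp only [Pi.sub_apply, sub_add_cancel] at e
  rwa [e, add_sub_cancel_right]

/-- The eigenvalues of the finite volume operators are distributed according to the spectral
measures along the orbit. -/
lemma exists_abs_sum_eigenvalues_sub_le {ψ : ℝ → ℝ} (hψ : Continuous ψ) {ε : ℝ} (hε : 0 < ε) :
    ∃ c, ∀ n θ, |∑ j, ψ ((finiteOp_isHermitian T C f θ n).eigenvalues j)
      - birkhoffSum T (spectralSum T C f ψ) n θ| ≤ ε * n + c := by
  obtain ⟨R, hR0, hR⟩ := exists_finiteOp_bound T C f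
  obtain ⟨R', hR'⟩ := exists_norm_stripOperator_le T C f
  -- A polynomial at distance δ from ψ costs nmδ on the eigenvalues and again nmδ in the Birkhoff
  -- sum. The summand 1 keeps the denominator positive for m = 0.
  have hδ : 0 < ε / (2 * m + 1) := by positivity
  obtain ⟨q, hq⟩ := exists_polynomial_near_of_continuousOn (-(max R R')) (max R R') ψ
    hψ.continuousOn _ hδ
  obtain ⟨c, hc⟩ := exists_abs_sum_eval_eigenvalues_sub_le T C f q
  refine ⟨c, fun n θ => ?_⟩
  have h1 : |∑ j, ψ ((finiteOp_isHermitian T C f θ n).eigenvalues j)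
      - ∑ j, q.eval ((finiteOp_isHermitian T C f θ n).eigenvalues j)|
      ≤ n * m * (ε / (2 * m + 1)) := by
    rw [← Finset.sum_sub_distrib]
    refine (Finset.abs_sum_le_sum_abs _ _).trans ((Finset.sum_le_sum (g := fun _ => ε / (2 * m + 1))
      fun j _ => ?_).trans_eq ?_)
    · rw [abs_sub_comm]
      exact (hq _ (abs_le.1 (((hR θ n).1 j).trans (le_max_left _ _)))).le
    · simp [Fintype.card_prod]
  have h2 : |birkhoffSum T (spectralSum T C f fun t => q.eval t) n θ
      - birkhoffSum T (spectralSum T C f ψ) n θ| ≤ n * (m * (ε / (2 * m + 1))) := by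
    rw [birkhoffSum, birkhoffSum, ← Finset.sum_sub_distrib]
    refine (Finset.abs_sum_le_sum_abs _ _).trans ((Finset.sum_le_sum fun l _ =>
      abs_spectralSum_sub_le T C f (fun θ => (hR' θ).trans (le_max_right R R')) q.continuous hψ
        (fun t ht => (hq t ht).le) _).trans_eq ?_)
    simp
  have h3 : (n : ℝ) * m * (ε / (2 * m + 1)) + n * (m * (ε / (2 * m + 1))) ≤ ε * n := by
    have : (n : ℝ) * m * (ε / (2 * m + 1)) + n * (m * (ε / (2 * m + 1)))
        = (2 * m / (2 * m + 1)) * (ε * n) := by ring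
    rw [this]
    refine mul_le_of_le_one_left (by positivity) ?_
    rw [div_le_one (by positivity)]
    linarith
  have h4 := abs_le.1 (hc n θ)
  have h5 := abs_le.1 h1
  have h6 := abs_le.1 h2
  rw [abs_le]
  constructor <;> linarith [h4.1, h4.2, h5.1, h5.2, h6.1, h6.2]

/-- With the origin in the middle of a box of 2k + 1 sites, the moment is an entry of a power of a
finite matrix that depends continuously on θ. No strong continuity of the infinite operators is
needed. -/
lemma continuous_integral_pow_spectralMeasure (i : Fin m) (k : ℕ) :
    Continuous fun θ => ∫ t, t ^ k ∂(spectralMeasure (stripOperator T C f θ) (delta 0 i)) := by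
  have e : ∀ θ, ∫ t, t ^ k ∂(spectralMeasure (stripOperator T C f θ) (delta 0 i))
      = ((finiteOp T C f (T.symm^[k] θ) (2 * k + 1) ^ k) (⟨k, by omega⟩, i) (⟨k, by omega⟩, i)).re :=
    fun θ => by
      rw [← integral_pow_spectralMeasure_delta T C f _ _ _ i k le_rfl (by simp only; omega)]
      simp only
      rw [(Function.LeftInverse.iterate T.apply_symm_apply k) θ]
  simp only [e]
  exact Complex.continuous_re.comp ((((continuous_finiteOp T C f _).comp
    (T.symm.continuous.iterate k)).pow k).matrix_elem _ _)

open Polynomial in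
lemma continuous_integral_eval_spectralMeasure (i : Fin m) (q : ℝ[X]) :
    Continuous fun θ => ∫ t, q.eval t ∂(spectralMeasure (stripOperator T C f θ) (delta 0 i)) := by
  induction q using Polynomial.induction_on' with
  | add p q hp hq =>
    simp only [Polynomial.eval_add]
    simp_rw [fun θ => integral_add (integrable_spectralMeasure (a := stripOperator T C f θ)
      (delta 0 i) p.continuous) (integrable_spectralMeasure _ q.continuous)]
    exact hp.add hq
  | monomial k a =>
    simp only [Polynomial.eval_monomial, integral_const_mul]
    exact (continuous_integral_pow_spectralMeasure T C f i k).const_mul a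

lemma continuous_integral_spectralMeasure (i : Fin m) {ψ : ℝ → ℝ} (hψ : Continuous ψ) :
    Continuous fun θ => ∫ t, ψ t ∂(spectralMeasure (stripOperator T C f θ) (delta 0 i)) := by
  obtain ⟨R, hR⟩ := exists_norm_stripOperator_le T C f
  refine continuous_of_uniform_approx_of_continuous fun u hu => ?_
  obtain ⟨ε, hε, hu⟩ := Metric.mem_uniformity_dist.1 hu
  obtain ⟨q, hq⟩ := exists_polynomial_near_of_continuousOn (-R) R ψ hψ.continuousOn _ (half_pos hε)
  refine ⟨_, continuous_integral_eval_spectralMeasure T C f i q, fun θ => hu ?_⟩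
  rw [Real.dist_eq, ← integral_sub (integrable_spectralMeasure _ hψ)
    (integrable_spectralMeasure _ q.continuous)]
  refine (abs_integral_spectralMeasure_le (B := ε / 2) (hR θ) fun t ht => ?_).trans_lt
    (half_lt_self hε)
  rw [abs_sub_comm]
  exact (hq t ht).le

lemma continuous_spectralSum {ψ : ℝ → ℝ} (hψ : Continuous ψ) :
    Continuous (spectralSum T C f ψ) :=
  continuous_finsetSum _ fun i _ => continuous_integral_spectralMeasure T C f i hψ

end FiniteVolume

/-! ### The integrated density of states as a mean displacement -/

section TotalDisplacement

variable {Θ : Type*} [MetricSpace Θ] {m : ℕ} (T : Θ ≃ₜ Θ) (C : GL (Fin m) ℂ)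
  (f : C(Θ, selfAdjoint (Matrix (Fin m) (Fin m) ℂ)))

lemma continuous_totalDisplacement_base (n : ℕ) (E : ℝ) :
    Continuous (totalDisplacement T C f n E) :=
  (continuous_birkhoffSum (continuous_cocycleMap T _) (continuous_schrodingerDisplacement C f E)
    n).comp (by fun_prop)

/-- After n steps the orbit sits at some W instead of 1; restarting the remaining k steps from 1
changes their displacement by at most m. -/
lemma abs_totalDisplacement_add_sub_le (E : ℝ) (n k : ℕ) (θ : Θ) :
    |totalDisplacement T C f (n + k) E θ - totalDisplacement T C f n E θ
      - totalDisplacement T C f k E (T^[n] θ)| ≤ m := by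
  have h := abs_birkhoffSum_sub_le (continuous_schrodingerDisplacement C f E)
    (det_schrodingerCocycle T C f E) (T^[n] θ)
    (((cocycleMap T (schrodingerCocycle C f E))^[n] (θ, 1)).2) 1 k
  simp only [totalDisplacement]
  rw [birkhoffSum_add, add_sub_cancel_left]
  convert h using 4
  exact Prod.ext (iterate_cocycleMap_fst T n (θ, 1)) rfl

/-- The displacement is within m of a weighted count of nm eigenvalues. The bound is uniform in E
and θ, as dominated convergence in E requires. -/
lemma abs_totalDisplacement_le (n : ℕ) (E : ℝ) (θ : Θ) :
    |totalDisplacement T C f n E θ| ≤ n * m + m := by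
  obtain ⟨l, hl, h⟩ := exists_count T C f n θ E
  have h1 : |∑ j, l j| ≤ n * m := by
    refine (Finset.abs_sum_le_sum_abs _ _).trans ((Finset.sum_le_sum (g := fun _ => (1 : ℝ))
      fun j _ => ?_).trans_eq ?_)
    · rw [abs_of_nonneg (h j).1]
      exact (h j).2.1
    · simp [Fintype.card_prod]
  have h2 := abs_sub_abs_le_abs_sub (totalDisplacement T C f n E θ) (∑ j, l j)
  linarith

variable [CompactSpace Θ]

/-- The sum over `i` of the masses on `(E, ∞)` of the spectral measures at `δ_{0,i}`. -/
def spectralTail (E : ℝ) (θ : Θ) : ℝ :=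
  ∑ i, (spectralMeasure (stripOperator T C f θ) (delta 0 i)).real (Set.Ioi E)

lemma spectralSum_le_spectralTail {E : ℝ} {ψ : ℝ → ℝ} (hψ : Continuous ψ) (h1 : ∀ t, ψ t ≤ 1)
    (h0 : ∀ t ≤ E, ψ t = 0) (θ : Θ) : spectralSum T C f ψ θ ≤ spectralTail T C f E θ := by
  refine Finset.sum_le_sum fun i _ => ?_
  rw [← integral_indicator_one measurableSet_Ioi]
  refine integral_mono (integrable_spectralMeasure _ hψ)
    ((integrable_const (1 : ℝ)).indicator measurableSet_Ioi) fun t => ?_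
  by_cases ht : t ≤ E
  · simp [h0 t ht, ht]
  · simp [not_le.1 ht, h1 t]

lemma spectralTail_le_spectralSum {E : ℝ} {ψ : ℝ → ℝ} (hψ : Continuous ψ) (h0 : ∀ t, 0 ≤ ψ t)
    (h1 : ∀ t, E ≤ t → ψ t = 1) (θ : Θ) : spectralTail T C f E θ ≤ spectralSum T C f ψ θ := by
  refine Finset.sum_le_sum fun i _ => ?_
  rw [← integral_indicator_one measurableSet_Ioi]
  refine integral_mono ((integrable_const (1 : ℝ)).indicator measurableSet_Ioi)
    (integrable_spectralMeasure _ hψ) fun t => ?_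
  by_cases ht : t ≤ E
  · simp [ht, h0 t]
  · simp [not_le.1 ht, h1 t (not_le.1 ht).le]

end TotalDisplacement

/-! ### Measurability in θ and comparison of the mean displacement with the spectral tails. -/

section MeanDisplacement

variable {Θ : Type*} [MetricSpace Θ] [CompactSpace Θ] [MeasurableSpace Θ] [BorelSpace Θ] {m : ℕ}

lemma integral_birkhoffSum {X : Type*} [MeasurableSpace X] {μ : Measure X} {S : X → X}
    (hS : MeasurePreserving S μ μ) {φ : X → ℝ} (hφ : Measurable φ) (hi : Integrable φ μ) (n : ℕ) :
    Integrable (birkhoffSum S φ n) μ ∧ ∫ x, birkhoffSum S φ n x ∂μ = n * ∫ x, φ x ∂μ := by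
  have h1 : ∀ k, Integrable (fun x => φ (S^[k] x)) μ := fun k =>
    (hS.iterate k).integrable_comp_of_integrable hi
  refine ⟨integrable_finsetSum _ fun k _ => h1 k, ?_⟩
  simp only [birkhoffSum]
  rw [integral_finsetSum _ fun k _ => h1 k]
  have h2 : ∀ k, ∫ x, φ (S^[k] x) ∂μ = ∫ x, φ x ∂μ := fun k => by
    have h := integral_map (μ := μ) (f := φ) (hS.iterate k).measurable.aemeasurable
      (by rw [(hS.iterate k).map_eq]; exact hφ.aestronglyMeasurable)
    rw [(hS.iterate k).map_eq] at h
    exact h.symm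
  simp [h2]

lemma le_of_forall_pos_exists_le_add_div {x y : ℝ}
    (h : ∀ ε > 0, ∃ c, ∀ n : ℕ, 0 < n → x ≤ y + ε + c / n) : x ≤ y := by
  refine le_of_forall_pos_le_add fun ε hε => ?_
  obtain ⟨c, hc⟩ := h ε hε
  have : Tendsto (fun n : ℕ => y + ε + c / n) atTop (𝓝 (y + ε + 0)) :=
    tendsto_const_nhds.add (tendsto_const_div_atTop_nhds_zero_nat c)
  rw [add_zero] at this
  exact ge_of_tendsto this ((eventually_gt_atTop 0).mono hc)

variable (T : Θ ≃ₜ Θ) (μ : Measure Θ) [IsProbabilityMeasure μ] (C : GL (Fin m) ℂ)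
  (f : C(Θ, selfAdjoint (Matrix (Fin m) (Fin m) ℂ)))

lemma measurable_spectralMeasure (i : Fin m) :
    Measurable fun θ => spectralMeasure (stripOperator T C f θ) (delta 0 i) :=
  measurable_of_measurable_integral fun _ hg =>
    (continuous_integral_spectralMeasure T C f i hg).measurable

lemma measurable_spectralMeasure_real (i : Fin m) {s : Set ℝ} (hs : MeasurableSet s) :
    Measurable fun θ => (spectralMeasure (stripOperator T C f θ) (delta 0 i)).real s :=
  ((Measure.measurable_coe hs).comp (measurable_spectralMeasure T C f i)).ennreal_toReal

lemma integrable_spectralMeasure_real (i : Fin m) {s : Set ℝ} (hs : MeasurableSet s) :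
    Integrable (fun θ => (spectralMeasure (stripOperator T C f θ) (delta 0 i)).real s) μ :=
  Integrable.of_bound (measurable_spectralMeasure_real T C f i hs).aestronglyMeasurable 1
    (Eventually.of_forall fun θ => by
      rw [Real.norm_of_nonneg measureReal_nonneg]
      exact measureReal_le_one)

lemma integrable_spectralTail (E : ℝ) : Integrable (spectralTail T C f E) μ :=
  integrable_finsetSum _ fun i _ => integrable_spectralMeasure_real T μ C f i measurableSet_Ioi

lemma mul_one_sub_ids (hm : 1 ≤ m) (E : ℝ) :
    m * (1 - ids T μ C f E) = ∫ θ, spectralTail T C f E θ ∂μ := by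
  have hm0 : (m : ℝ) ≠ 0 := by positivity
  have h1 : m * ids T μ C f E = ∑ i : Fin m,
      ∫ θ, (spectralMeasure (stripOperator T C f θ) (delta 0 i)).real (Set.Iic E) ∂μ := by
    have h2 : ∀ i : Fin m, (μ.bind fun θ => spectralMeasure (stripOperator T C f θ) (delta 0 i))
        (Set.Iic E) = ∫⁻ θ, spectralMeasure (stripOperator T C f θ) (delta 0 i) (Set.Iic E) ∂μ :=
      fun i => Measure.bind_apply measurableSet_Iic (measurable_spectralMeasure T C f i).aemeasurable
    have h3 : ∀ i : Fin m, ∫⁻ θ, spectralMeasure (stripOperator T C f θ) (delta 0 i) (Set.Iic E) ∂μ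
        ≠ ∞ := fun i => by
      refine ((lintegral_mono fun θ => prob_le_one).trans_lt ?_).ne
      simp
    rw [ids, measureReal_def, dosMeasure, Measure.smul_apply, Measure.finsetSum_apply, smul_eq_mul,
      ENNReal.toReal_mul, ENNReal.toReal_sum fun i _ => by rw [h2]; exact h3 i]
    rw [ENNReal.toReal_inv, ENNReal.toReal_natCast, mul_inv_cancel_left₀ hm0]
    refine Finset.sum_congr rfl fun i _ => ?_
    rw [h2]
    exact (integral_toReal (((Measure.measurable_coe measurableSet_Iic).comp
      (measurable_spectralMeasure T C f i)).aemeasurable)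
      (Eventually.of_forall fun θ => measure_lt_top _ _)).symm
  rw [mul_sub, h1, mul_one]
  simp only [spectralTail]
  rw [integral_finsetSum _ fun i _ => integrable_spectralMeasure_real T μ C f i measurableSet_Ioi,
    sub_eq_iff_eq_add, ← Finset.sum_add_distrib]
  have : ∀ i : Fin m, ∫ θ, (spectralMeasure (stripOperator T C f θ) (delta 0 i)).real (Set.Ioi E) ∂μ
      + ∫ θ, (spectralMeasure (stripOperator T C f θ) (delta 0 i)).real (Set.Iic E) ∂μ = 1 :=
    fun i => by
      rw [← integral_add (integrable_spectralMeasure_real T μ C f i measurableSet_Ioi)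
        (integrable_spectralMeasure_real T μ C f i measurableSet_Iic)]
      have h4 : ∀ θ, (spectralMeasure (stripOperator T C f θ) (delta 0 i)).real (Set.Ioi E)
          + (spectralMeasure (stripOperator T C f θ) (delta 0 i)).real (Set.Iic E) = 1 := fun θ => by
        rw [← Set.compl_Iic, probReal_compl_eq_one_sub measurableSet_Iic]
        ring
      simp [h4]
  simp [this]

lemma integrable_of_continuous {X : Type*} [TopologicalSpace X] [CompactSpace X]
    [MeasurableSpace X] [OpensMeasurableSpace X] (ν : Measure X) [IsFiniteMeasure ν]
    {φ : X → ℝ} (hφ : Continuous φ) : Integrable φ ν :=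
  hφ.integrable_of_hasCompactSupport (HasCompactSupport.of_compactSpace _)

variable {T μ}

lemma exists_meanDisplacement (hT : Ergodic T μ) (E : ℝ) : ∃ α,
    (∀ n : ℕ, 0 < n → |(∫ θ, totalDisplacement T C f n E θ ∂μ) / n - α| ≤ m / n) ∧
    ∀ᵐ θ ∂μ, Tendsto (fun n : ℕ => totalDisplacement T C f n E θ / n) atTop (𝓝 α) :=
  ae_tendsto_of_almost_additive hT
    (fun n => (continuous_totalDisplacement_base T C f n E).measurable)
    (fun n θ => abs_totalDisplacement_le T C f n E θ)
    (fun n k θ => abs_totalDisplacement_add_sub_le T C f E n k θ)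

/-- ψ dominates the weights of `exists_count`. An eigenvalue equal to E has an undetermined weight
in [0, 1], so ψ must already be 1 at E. The constant c + 2m collects m from the count and m from the
mean. -/
lemma meanDisplacement_le_integral (hT : Ergodic T μ) {E α : ℝ}
    (hα : ∀ n : ℕ, 0 < n → |(∫ θ, totalDisplacement T C f n E θ ∂μ) / n - α| ≤ m / n) {ψ : ℝ → ℝ}
    (hψ : Continuous ψ) (h0 : ∀ t, 0 ≤ ψ t) (h1 : ∀ t, E ≤ t → ψ t = 1) :
    α ≤ ∫ θ, spectralSum T C f ψ θ ∂μ := by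
  refine le_of_forall_pos_exists_le_add_div fun ε hε => ?_
  obtain ⟨c, hc⟩ := exists_abs_sum_eigenvalues_sub_le T C f hψ hε
  refine ⟨c + 2 * m, fun n hn => ?_⟩
  have hn' : (0 : ℝ) < n := by exact_mod_cast hn
  have hS := continuous_spectralSum T C f hψ
  obtain ⟨hi, he⟩ := integral_birkhoffSum hT.toMeasurePreserving hS.measurable
    (integrable_of_continuous μ hS) n
  have h2 : ∀ θ, totalDisplacement T C f n E θ
      ≤ birkhoffSum T (spectralSum T C f ψ) n θ + (ε * n + c + m) := fun θ => by
    obtain ⟨l, hl, h⟩ := exists_count T C f n θ E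
    have h3 : ∑ j, l j ≤ ∑ j, ψ ((finiteOp_isHermitian T C f θ n).eigenvalues j) := by
      refine Finset.sum_le_sum fun j _ => ?_
      rcases lt_or_ge ((finiteOp_isHermitian T C f θ n).eigenvalues j) E with h4 | h4
      · rw [(h j).2.2.1 h4]
        exact h0 _
      · rw [h1 _ h4]
        exact (h j).2.1
    have := (abs_le.1 (hc n θ)).2
    have := (abs_le.1 hl).2
    linarith
  have h5 := integral_mono (μ := μ) (integrable_of_continuous μ
    (continuous_totalDisplacement_base T C f n E)) (hi.add (integrable_const _)) h2
  rw [integral_add' hi (integrable_const _), he] at h5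
  simp only [integral_const, probReal_univ, one_smul] at h5
  have h6 := (abs_le.1 (hα n hn)).1
  have h7 : (∫ θ, totalDisplacement T C f n E θ ∂μ) / n
      ≤ (∫ θ, spectralSum T C f ψ θ ∂μ) + ε + (c + m) / n := by
    rw [div_le_iff₀ hn']
    have : ((∫ θ, spectralSum T C f ψ θ ∂μ) + ε + (c + m) / n) * n
        = n * (∫ θ, spectralSum T C f ψ θ ∂μ) + (ε * n + c + m) := by
      field_simp
      ring
    rw [this]
    exact h5
  have h8 : (c + 2 * m) / (n : ℝ) = (c + m) / n + m / n := by ring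
  rw [h8]
  linarith

/-- The reverse comparison: here ψ lies below the weights, so it has to vanish up to and including
E. -/
lemma integral_le_meanDisplacement (hT : Ergodic T μ) {E α : ℝ}
    (hα : ∀ n : ℕ, 0 < n → |(∫ θ, totalDisplacement T C f n E θ ∂μ) / n - α| ≤ m / n) {ψ : ℝ → ℝ}
    (hψ : Continuous ψ) (h1 : ∀ t, ψ t ≤ 1) (h0 : ∀ t ≤ E, ψ t = 0) :
    ∫ θ, spectralSum T C f ψ θ ∂μ ≤ α := by
  refine le_of_forall_pos_exists_le_add_div fun ε hε => ?_
  obtain ⟨c, hc⟩ := exists_abs_sum_eigenvalues_sub_le T C f hψ hε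
  refine ⟨c + 2 * m, fun n hn => ?_⟩
  have hn' : (0 : ℝ) < n := by exact_mod_cast hn
  have hS := continuous_spectralSum T C f hψ
  obtain ⟨hi, he⟩ := integral_birkhoffSum hT.toMeasurePreserving hS.measurable
    (integrable_of_continuous μ hS) n
  have h2 : ∀ θ, birkhoffSum T (spectralSum T C f ψ) n θ
      ≤ totalDisplacement T C f n E θ + (ε * n + c + m) := fun θ => by
    obtain ⟨l, hl, h⟩ := exists_count T C f n θ E
    have h3 : ∑ j, ψ ((finiteOp_isHermitian T C f θ n).eigenvalues j) ≤ ∑ j, l j := by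
      refine Finset.sum_le_sum fun j _ => ?_
      rcases le_or_gt ((finiteOp_isHermitian T C f θ n).eigenvalues j) E with h4 | h4
      · rw [h0 _ h4]
        exact (h j).1
      · rw [(h j).2.2.2 h4]
        exact h1 _
    have := (abs_le.1 (hc n θ)).1
    have := (abs_le.1 hl).1
    linarith
  have hia := integrable_of_continuous μ (continuous_totalDisplacement_base T C f n E)
  have h5 := integral_mono (μ := μ) hi (hia.add (integrable_const _)) h2
  rw [integral_add' hia (integrable_const _), he] at h5
  simp only [integral_const, probReal_univ, one_smul] at h5
  have h6 := (abs_le.1 (hα n hn)).2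
  have h7 : (∫ θ, spectralSum T C f ψ θ ∂μ)
      ≤ (∫ θ, totalDisplacement T C f n E θ ∂μ) / n + (ε + (c + m) / n) := by
    rw [← sub_le_iff_le_add, le_div_iff₀ hn']
    have : ((∫ θ, spectralSum T C f ψ θ ∂μ) - (ε + (c + m) / n)) * n
        = n * (∫ θ, spectralSum T C f ψ θ ∂μ) - (ε * n + c + m) := by
      field_simp
      ring
    rw [this]
    linarith
  have h8 : (c + 2 * m) / (n : ℝ) = (c + m) / n + m / n := by ring
  rw [h8]
  linarith

/-- The error m/n does not depend on E, so α is a uniform limit of integrals that are continuous in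
E by dominated convergence. This is the source of the continuity of the integrated density of
states. -/
lemma continuous_meanDisplacement {α : ℝ → ℝ}
    (hα : ∀ E, ∀ n : ℕ, 0 < n → |(∫ θ, totalDisplacement T C f n E θ ∂μ) / n - α E| ≤ m / n) :
    Continuous α := by
  refine continuous_of_uniform_approx_of_continuous fun u hu => ?_
  obtain ⟨ε, hε, hu⟩ := Metric.mem_uniformity_dist.1 hu
  obtain ⟨n, hn0, hn⟩ := (((tendsto_const_div_atTop_nhds_zero_nat (m : ℝ)).eventually
    (gt_mem_nhds hε)).and (eventually_gt_atTop 0)).exists.imp fun _ h => h.symm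
  refine ⟨fun E => (∫ θ, totalDisplacement T C f n E θ ∂μ) / n, ?_, fun E => hu ?_⟩
  · refine Continuous.div_const (continuous_of_dominated (bound := fun _ => (n * m + m : ℝ))
      (fun E => (continuous_totalDisplacement_base T C f n E).measurable.aestronglyMeasurable)
      (fun E => Eventually.of_forall fun θ => abs_totalDisplacement_le T C f n E θ)
      (integrable_const _)
      (Eventually.of_forall fun θ => continuous_totalDisplacement T C f n θ)) _
  · rw [dist_comm, Real.dist_eq]
    exact (hα E n hn0).trans_lt hn

lemma exists_ramp {E E' : ℝ} (h : E < E') : ∃ ψ : ℝ → ℝ, Continuous ψ ∧ (∀ t, 0 ≤ ψ t) ∧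
    (∀ t, ψ t ≤ 1) ∧ (∀ t ≤ E, ψ t = 0) ∧ ∀ t, E' ≤ t → ψ t = 1 := by
  have h' := sub_pos.2 h
  refine ⟨fun t => max 0 (min 1 ((t - E) / (E' - E))), by fun_prop, fun t => le_max_left _ _,
    fun t => max_le zero_le_one (min_le_left _ _), fun t ht => ?_, fun t ht => ?_⟩
  · exact max_eq_left ((min_le_right _ _).trans
      (div_nonpos_of_nonpos_of_nonneg (by linarith) h'.le))
  · have : 1 ≤ (t - E) / (E' - E) := by
      rw [le_div_iff₀ h']
      linarith
    simp [min_eq_left this]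

/-- The mean displacement of the Schrödinger cocycle is `m (1 - N(E))`. -/
theorem continuous_ids_and_ae_tendsto (hT : Ergodic T μ) (hm : 1 ≤ m) :
    Continuous (fun E => m * (1 - ids T μ C f E)) ∧
    ∀ E, ∀ᵐ θ ∂μ, Tendsto (fun n : ℕ => totalDisplacement T C f n E θ / n) atTop
      (𝓝 (m * (1 - ids T μ C f E))) := by
  choose α h1 h2 using fun E => exists_meanDisplacement C f hT E
  have hα := continuous_meanDisplacement C f h1
  have hup : ∀ E E', E < E' → α E' ≤ ∫ θ, spectralTail T C f E θ ∂μ := fun E E' h => by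
    obtain ⟨ψ, hψ, p0, p1, e0, e1⟩ := exists_ramp h
    exact (meanDisplacement_le_integral C f hT (h1 E') hψ p0 e1).trans
      (integral_mono (integrable_of_continuous μ (continuous_spectralSum T C f hψ))
        (integrable_spectralTail T μ C f E) (spectralSum_le_spectralTail T C f hψ p1 e0))
  have hlow : ∀ E E', E < E' → ∫ θ, spectralTail T C f E' θ ∂μ ≤ α E := fun E E' h => by
    obtain ⟨ψ, hψ, p0, p1, e0, e1⟩ := exists_ramp h
    exact (integral_mono (integrable_spectralTail T μ C f E') (integrable_of_continuous μ
      (continuous_spectralSum T C f hψ)) (spectralTail_le_spectralSum T C f hψ p0 e1)).trans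
      (integral_le_meanDisplacement C f hT (h1 E) hψ p1 e0)
  -- `hlow` with E' < E and `hup` with E' > E enclose the tail at E between values of α that
  -- converge to α E. Possible atoms of the density of states need no separate treatment.
  have key : ∀ E, m * (1 - ids T μ C f E) = α E := fun E => by
    rw [mul_one_sub_ids T μ C f hm]
    refine le_antisymm ?_ ?_
    · exact ge_of_tendsto (hα.continuousWithinAt (s := Set.Iio E) (x := E))
        (eventually_nhdsWithin_of_forall fun E' h => hlow E' E h)
    · exact le_of_tendsto (hα.continuousWithinAt (s := Set.Ioi E) (x := E))
        (eventually_nhdsWithin_of_forall fun E' h => hup E E' h)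
  simp only [key]
  exact ⟨hα, h2⟩

end MeanDisplacement

/-! ### The Schrödinger cocycle is homotopic to the identity -/

section Homotopy

variable {m : ℕ}

lemma fromBlocks_mem_HSp (M : GL (Fin m) ℂ) :
    Matrix.fromBlocks 0 (-(M.1)ᴴ) (M.1)⁻¹ 0 ∈ HSp m := by
  have := transferMatrix_mem M 0 0
  simpa [transferMatrix] using this

lemma continuous_nonsing_inv {X : Type*} [TopologicalSpace X] {M : X → Matrix (Fin m) (Fin m) ℂ}
    (hM : Continuous M) (h : ∀ x, (M x).det ≠ 0) : Continuous fun x => (M x)⁻¹ := by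
  simp only [Matrix.inv_def, Ring.inverse_eq_inv']
  exact (hM.matrix_det.inv₀ h).smul hM.matrix_adjugate

lemma countable_setOf_det_eq_zero (D : Matrix (Fin m) (Fin m) ℂ) :
    {z : ℂ | (1 + z • D).det = 0}.Countable := by
  refine (D.charpoly.roots.toFinset.finite_toSet.image fun w => -w⁻¹).countable.mono fun z hz => ?_
  have hz' : (1 + z • D).det = 0 := hz
  have hz0 : z ≠ 0 := by
    rintro rfl
    simp at hz'
  refine ⟨-z⁻¹, ?_, by simp⟩
  rw [Finset.mem_coe, Multiset.mem_toFinset,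
    Polynomial.mem_roots (Matrix.charpoly_monic D).ne_zero, Polynomial.IsRoot.def,
    Matrix.eval_charpoly]
  have : Matrix.scalar (Fin m) (-z⁻¹) - D = (-z⁻¹) • (1 + z • D) := by
    rw [smul_add, smul_smul, neg_mul, inv_mul_cancel₀ hz0, neg_one_smul, ← sub_eq_add_neg]
    congr 1
    ext i j
    simp [Matrix.scalar_apply, Matrix.diagonal_apply, Matrix.one_apply]
  rw [this, Matrix.det_smul, hz', mul_zero]

lemma joined_fromBlocks (C : GL (Fin m) ℂ) :
    Joined (⟨_, fromBlocks_mem_HSp C⟩ : HSp m) ⟨_, fromBlocks_mem_HSp 1⟩ := by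
  have hS := (countable_setOf_det_eq_zero (C.1 - 1)).isPathConnected_compl_of_one_lt_rank
    (by rw [Complex.rank_real_complex]; exact Cardinal.one_lt_two)
  have hC : C.1.det ≠ 0 := ((Matrix.isUnit_iff_isUnit_det _).1 C.isUnit).ne_zero
  obtain ⟨γ, hγ⟩ := hS.joinedIn 1 (by simpa using hC) 0 (by simp)
  have hdet : ∀ t, (1 + γ t • (C.1 - 1)).det ≠ 0 := hγ
  have hcont : Continuous fun t => 1 + γ t • (C.1 - 1) := by fun_prop
  exact ⟨⟨⟨fun t => ⟨_, fromBlocks_mem_HSp (Matrix.GeneralLinearGroup.mkOfDetNeZero _ (hdet t))⟩,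
    Continuous.subtype_mk (Continuous.matrix_fromBlocks continuous_const
      hcont.matrix_conjTranspose.neg (continuous_nonsing_inv hcont hdet) continuous_const) _⟩,
    Subtype.ext (by simp [Matrix.GeneralLinearGroup.mkOfDetNeZero]),
    Subtype.ext (by simp [Matrix.GeneralLinearGroup.mkOfDetNeZero])⟩⟩

lemma rotation_mem_HSp (s : ℝ) :
    Matrix.fromBlocks ((Real.cos s : ℂ) • 1) (-((Real.sin s : ℂ) • 1)) ((Real.sin s : ℂ) • 1)
      ((Real.cos s : ℂ) • (1 : Matrix (Fin m) (Fin m) ℂ)) ∈ HSp m := by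
  have h : (Real.sin s : ℂ) * Real.sin s + Real.cos s * Real.cos s = 1 := by
    have := Real.sin_sq_add_cos_sq s
    rw [pow_two, pow_two] at this
    exact_mod_cast this
  have h' : (Real.cos s : ℂ) * Real.cos s + Real.sin s * Real.sin s = 1 := by
    rw [add_comm, h]
  change _ * _ * _ = _
  rw [Matrix.J, Matrix.fromBlocks_conjTranspose, Matrix.fromBlocks_multiply,
    Matrix.fromBlocks_multiply]
  simp only [Matrix.conjTranspose_smul, Matrix.conjTranspose_neg, Matrix.conjTranspose_one,
    RCLike.star_def, Complex.conj_ofReal, mul_zero, mul_one, zero_add, add_zero, mul_neg,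
    neg_mul, neg_neg, Matrix.mul_smul, smul_smul, ← neg_add, ← add_smul, h, h',
    one_smul]
  congr 1
  · simp [mul_comm]
  · simp [mul_comm]

/-- For C = 1 the constant matrix is the rotation by π/2, which is undone through smaller angles. -/
lemma joined_rotation :
    Joined (⟨_, fromBlocks_mem_HSp 1⟩ : HSp m) (HSp.id m) := by
  refine Joined.symm ⟨⟨⟨fun t => ⟨_, rotation_mem_HSp (t * (Real.pi / 2))⟩,
    Continuous.subtype_mk (by fun_prop) _⟩, Subtype.ext ?_, Subtype.ext ?_⟩⟩
  · simp [HSp.id, Matrix.fromBlocks_one]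
  · simp

/-- Energy and potential are scaled to zero together, which leaves a constant matrix; the rest is
path connectedness. -/
lemma schrodingerCocycle_homotopic {Θ : Type*} [MetricSpace Θ] [CompactSpace Θ] [Nonempty Θ]
    (C : GL (Fin m) ℂ) (f : C(Θ, selfAdjoint (Matrix (Fin m) (Fin m) ℂ))) (E : ℝ) :
    (schrodingerCocycle C f E).Homotopic (ContinuousMap.const Θ (HSp.id m)) := by
  have h1 : (schrodingerCocycle C f E).Homotopic
      (ContinuousMap.const Θ ⟨_, fromBlocks_mem_HSp C⟩) := by
    have hf : Continuous fun θ => (f θ).1 := continuous_subtype_val.comp f.continuous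
    refine ⟨⟨⟨fun p => ⟨_, transferMatrix_mem C ((1 - p.1) * E) ((1 - p.1 : ℝ) • f p.2)⟩,
      Continuous.subtype_mk ?_ _⟩, fun θ => Subtype.ext ?_, fun θ => Subtype.ext ?_⟩⟩
    · have : Continuous fun p : unitInterval × Θ => ((1 - p.1 : ℝ) • f p.2).1 :=
        (continuous_const.sub (continuous_subtype_val.comp continuous_fst)).smul
          (hf.comp continuous_snd)
      unfold transferMatrix
      fun_prop
    · simp [schrodingerCocycle]
    · simp [transferMatrix]
  exact h1.trans (ContinuousMap.homotopic_const_iff.2 ((joined_fromBlocks C).trans joined_rotation))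

end Homotopy

/-! ### The fibered rotation number of the Schrödinger cocycle -/

section BirkhoffSum

variable {Θ : Type*} [MetricSpace Θ] {m : ℕ} {T : Θ ≃ₜ Θ}

lemma birkhoffAverage_add_fst {A : C(Θ, HSp m)} (g : Θ × Matrix.unitaryGroup (Fin m) ℂ → ℝ)
    (k : Θ → ℝ) (n : ℕ) (p : Θ × Matrix.unitaryGroup (Fin m) ℂ) :
    birkhoffAverage ℝ (cocycleMap T A) (fun p => g p + k p.1) n p
      = birkhoffSum (cocycleMap T A) g n p / n + birkhoffAverage ℝ T k n p.1 := by
  rw [birkhoffAverage, birkhoffSum_add_fun, smul_add, birkhoffAverage, smul_eq_mul, smul_eq_mul,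
    smul_eq_mul, ← div_eq_inv_mul]
  simp only [birkhoffSum, iterate_cocycleMap_fst]

/-- A lift determines its displacement on the image of the covering map, and this image is preserved
by the dynamics. Uniqueness of the rotation number then needs only one point above θ, not
surjectivity of the covering. -/
lemma birkhoffSum_coverMap {A : C(Θ, HSp m)}
    {F : Θ × ℝ × Matrix.specialUnitaryGroup (Fin m) ℂ →
      Θ × ℝ × Matrix.specialUnitaryGroup (Fin m) ℂ} (hF : IsLift T A F)
    {g g' : Θ × Matrix.unitaryGroup (Fin m) ℂ → ℝ} (hg : IsDisplacement F g)
    (hg' : IsDisplacement F g') (n : ℕ) (p : Θ × ℝ × Matrix.specialUnitaryGroup (Fin m) ℂ) :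
    birkhoffSum (cocycleMap T A) g n (coverMap p)
      = birkhoffSum (cocycleMap T A) g' n (coverMap p) := by
  refine Finset.sum_congr rfl fun k _ => ?_
  have h : Function.Semiconj coverMap F (cocycleMap T A) := hF.semiconj
  rw [← (h.iterate_right k).eq, hg.descends, hg'.descends]

end BirkhoffSum

section RotationNumber

variable {Θ : Type*} [MetricSpace Θ] [CompactSpace Θ] [MeasurableSpace Θ] [BorelSpace Θ] {m : ℕ}
  {T : Θ ≃ₜ Θ} {μ : Measure Θ} [IsProbabilityMeasure μ]

/-- All averages with n > 0 have the integral of g by invariance, and dominated convergence passes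
to the constant limit. Ergodicity of ν plays no role. -/
lemma integral_eq_of_ae_tendsto_birkhoffAverage {X : Type*} [MeasurableSpace X] {ν : Measure X}
    [IsProbabilityMeasure ν] {S : X → X} (hS : MeasurePreserving S ν ν) {g : X → ℝ}
    (hg : Measurable g) {B : ℝ} (hB : ∀ x, |g x| ≤ B) {ρ : ℝ}
    (h : ∀ᵐ x ∂ν, Tendsto (fun n => birkhoffAverage ℝ S g n x) atTop (𝓝 ρ)) : ∫ x, g x ∂ν = ρ := by
  have hi : Integrable g ν := Integrable.of_bound hg.aestronglyMeasurable B (Eventually.of_forall hB)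
  have h1 : Tendsto (fun n => ∫ x, birkhoffAverage ℝ S g n x ∂ν) atTop (𝓝 (∫ _, ρ ∂ν)) := by
    refine tendsto_integral_of_dominated_convergence (fun _ => B) (fun n => ?_)
      (integrable_const _) (fun n => Eventually.of_forall fun x => ?_) h
    · exact ((integral_birkhoffSum hS hg hi n).1.const_mul _).aestronglyMeasurable
    · have hB0 : 0 ≤ B := (abs_nonneg _).trans (hB x)
      rw [birkhoffAverage, Real.norm_eq_abs, smul_eq_mul, abs_mul, abs_inv, Nat.abs_cast]
      rcases Nat.eq_zero_or_pos n with rfl | hn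
      · simpa using hB0
      · rw [inv_mul_le_iff₀ (by exact_mod_cast hn)]
        refine (Finset.abs_sum_le_sum_abs _ _).trans ((Finset.sum_le_sum fun k _ => hB _).trans ?_)
        simp
  refine tendsto_nhds_unique (tendsto_const_nhds.congr' ?_) (by simpa using h1)
  filter_upwards [eventually_gt_atTop 0] with n hn
  have hn' : (n : ℝ) ≠ 0 := by positivity
  simp only [birkhoffAverage, smul_eq_mul]
  rw [integral_const_mul, (integral_birkhoffSum hS hg hi n).2, inv_mul_cancel_left₀ hn']

/-- The displacement of an arbitrary lift is the chosen one plus an integer function k of θ. The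
first part averages to m(1 - N(E)) for every W, being within m/n of the horizontal orbit. The second
averages to ∫ k dμ, which is zero in the quotient. -/
theorem hasFiberedRotationNumber_schrodingerCocycle (hT : Ergodic T μ) (hm : 1 ≤ m)
    (C : GL (Fin m) ℂ) (f : C(Θ, selfAdjoint (Matrix (Fin m) (Fin m) ℂ))) (E : ℝ) :
    HasFiberedRotationNumber T μ (schrodingerCocycle C f E)
      (QuotientAddGroup.mk (m * (1 - ids T μ C f E))) where
  homotopic := by
    have : Nonempty Θ := nonempty_of_isProbabilityMeasure μ
    exact schrodingerCocycle_homotopic C f E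
  exists_lift := exists_isLift hm (continuous_schrodingerDisplacement C f E)
    (det_schrodingerCocycle T C f E)
  of_lift F hF := by
    obtain ⟨k, hk⟩ := exists_isDisplacement (continuous_schrodingerDisplacement C f E)
      (det_schrodingerCocycle T C f E) hF
    have hkc : Continuous fun θ => (k θ : ℝ) := by fun_prop
    obtain ⟨B, hB⟩ := (isCompact_univ (X := Θ)).exists_bound_of_continuousOn hkc.continuousOn
    have hae : ∀ᵐ θ ∂μ, ∀ W, Tendsto (fun n => birkhoffAverage ℝ
        (cocycleMap T (schrodingerCocycle C f E))
        (fun p => schrodingerDisplacement C f E p + k p.1) n (θ, W)) atTop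
        (𝓝 (m * (1 - ids T μ C f E) + ∫ θ, (k θ : ℝ) ∂μ)) := by
      filter_upwards [(continuous_ids_and_ae_tendsto C f hT hm).2 E,
        ae_tendsto_birkhoffAverage hT hkc.measurable (fun θ => hB θ trivial)] with θ h1 h2 W
      refine Tendsto.congr (fun n => (birkhoffAverage_add_fst _ (fun θ => (k θ : ℝ)) n
        (θ, W)).symm) (Tendsto.add ?_ h2)
      have h3 : Tendsto (fun n : ℕ => (m : ℝ) / n) atTop (𝓝 0) :=
        tendsto_const_div_atTop_nhds_zero_nat _
      have h4 := squeeze_zero_norm (f := fun n : ℕ => (birkhoffSum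
        (cocycleMap T (schrodingerCocycle C f E)) (schrodingerDisplacement C f E) n (θ, W)
        - totalDisplacement T C f n E θ) / n) (fun n => by
          rw [Real.norm_eq_abs, abs_div, Nat.abs_cast]
          exact div_le_div_of_nonneg_right (abs_birkhoffSum_sub_le
            (continuous_schrodingerDisplacement C f E) (det_schrodingerCocycle T C f E) θ W 1 n)
            (Nat.cast_nonneg n)) h3
      have h5 := h4.add h1
      rw [zero_add] at h5
      refine h5.congr fun n => ?_
      rw [← add_div, sub_add_cancel]
    refine ⟨_, hk, _, ?_, hae, fun ν hν hinv hmap => ?_⟩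
    · rw [QuotientAddGroup.eq, neg_add_rev, neg_add_cancel_right]
      exact neg_mem ⟨k, rfl⟩
    -- One step from the horizontal subspace moves by at most 2m, another W adds at most m, and B
    -- bounds the integer function.
    · have hB' : ∀ p, |schrodingerDisplacement C f E p + k p.1| ≤ 3 * m + B := fun p => by
        have h1 := abs_birkhoffSum_sub_le (continuous_schrodingerDisplacement C f E)
          (det_schrodingerCocycle T C f E) p.1 p.2 1 1
        have h2 := abs_totalDisplacement_le T C f 1 E p.1
        rw [totalDisplacement, birkhoffSum_one] at h2
        rw [birkhoffSum_one, birkhoffSum_one] at h1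
        have h3 := abs_sub_abs_le_abs_sub (schrodingerDisplacement C f E p)
          (schrodingerDisplacement C f E (p.1, 1))
        have h4 := hB p.1 trivial
        rw [Real.norm_eq_abs] at h4
        refine (abs_add_le _ _).trans (add_le_add ?_ h4)
        rw [Nat.cast_one] at h2
        linarith
      refine integral_eq_of_ae_tendsto_birkhoffAverage hinv hk.continuous.measurable hB' ?_
      have hfst : ∀ P : Θ → Prop, (∀ᵐ θ ∂μ, P θ) → ∀ᵐ p ∂ν, P p.1 := fun P hP => by
        rw [← hmap] at hP
        exact ae_of_ae_map measurable_fst.aemeasurable hP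
      filter_upwards [hfst _ hae] with p hp using hp p.2

/-- The fibered rotation number is unique. -/
lemma HasFiberedRotationNumber.unique {A : C(Θ, HSp m)} {r r' : ℝ ⧸ integerMeans μ}
    (h : HasFiberedRotationNumber T μ A r) (h' : HasFiberedRotationNumber T μ A r') : r = r' := by
  obtain ⟨F, hF⟩ := h.exists_lift
  obtain ⟨g, hg, ρ, rfl, hρ, -⟩ := h.of_lift F hF
  obtain ⟨g', hg', ρ', rfl, hρ', -⟩ := h'.of_lift F hF
  obtain ⟨θ, h1, h2⟩ := (hρ.and hρ').exists
  let p : Θ × ℝ × Matrix.specialUnitaryGroup (Fin m) ℂ := (θ, 0, 1)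
  have h3 := h1 (coverMap p).2
  have h4 := h2 (coverMap p).2
  have e : ((θ, (coverMap p).2) : Θ × Matrix.unitaryGroup (Fin m) ℂ) = coverMap p := rfl
  simp only [e, birkhoffAverage, birkhoffSum_coverMap hF hg hg'] at h3 h4
  rw [tendsto_nhds_unique h3 h4]

/-- Distinct integer-valued functions are at uniform distance at least 1, so C(Θ, ℤ) is discrete. It
is also separable, because Θ is compact metric, and therefore countable. -/
lemma countable_integerMeans (μ : Measure Θ) [IsFiniteMeasure μ] :
    (integerMeans μ : Set ℝ).Countable := by
  have : DiscreteTopology C(Θ, ℤ) := DiscreteTopology.of_forall_le_dist zero_lt_one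
    fun p q hpq => by
      obtain ⟨θ, hθ⟩ := not_forall.1 (mt ContinuousMap.ext hpq)
      refine le_trans ?_ (ContinuousMap.dist_apply_le_dist θ)
      rw [Int.dist_eq]
      exact_mod_cast Int.one_le_abs (sub_ne_zero.2 hθ)
  have : Countable C(Θ, ℤ) := TopologicalSpace.separableSpace_iff_countable.1 inferInstance
  refine (Set.countable_range fun p : C(Θ, ℤ) => ∫ θ, (p θ : ℝ) ∂μ).mono ?_
  rintro _ ⟨p, rfl⟩
  exact ⟨p, rfl⟩

/-- Two fibered rotation functions of the same family differ by a constant. -/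
lemma IsFiberedRotationFunction.exists_eq_add {C : GL (Fin m) ℂ}
    {f : C(Θ, selfAdjoint (Matrix (Fin m) (Fin m) ℂ))} {ρ ρ' : ℝ → ℝ}
    (h : IsFiberedRotationFunction T μ C f ρ) (h' : IsFiberedRotationFunction T μ C f ρ') :
    ∃ c ∈ integerMeans μ, ∀ E, ρ E = ρ' E + c := by
  have hmem : ∀ E, ρ E - ρ' E ∈ integerMeans μ := fun E => by
    have := QuotientAddGroup.eq.1 ((h'.branch E).unique (h.branch E))
    rwa [neg_add_eq_sub] at this
  -- The difference of the branches is continuous on the connected line with values in a countable,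
  -- hence totally disconnected, subset of ℝ.
  have hsub := (countable_integerMeans μ).isTotallyDisconnected _
    (Set.range_subset_iff.2 hmem) (isPreconnected_range (h.continuous.sub h'.continuous))
  refine ⟨ρ 0 - ρ' 0, hmem 0, fun E => ?_⟩
  have := hsub (Set.mem_range_self E) (Set.mem_range_self 0)
  linarith

end RotationNumber

end StripSchrodinger

end

theorem theorem2 {Θ : Type*} [MetricSpace Θ] [CompactSpace Θ] [MeasurableSpace Θ] [BorelSpace Θ]
    (T : Θ ≃ₜ Θ) (μ : MeasureTheory.Measure Θ) [MeasureTheory.IsProbabilityMeasure μ]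
    (hT : Ergodic T μ) (m : ℕ) (hm : 1 ≤ m) (C : GL (Fin m) ℂ)
    (f : C(Θ, selfAdjoint (Matrix (Fin m) (Fin m) ℂ))) :
    StripSchrodinger.IsFiberedRotationFunction T μ C f
        (fun E => m * (1 - StripSchrodinger.ids T μ C f E)) ∧
      ∀ ρ : ℝ → ℝ, StripSchrodinger.IsFiberedRotationFunction T μ C f ρ →
        ∃ c ∈ StripSchrodinger.integerMeans μ,
          ∀ E : ℝ, m * (1 - StripSchrodinger.ids T μ C f E) = ρ E + c := by
  have h : StripSchrodinger.IsFiberedRotationFunction T μ C f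
      (fun E => m * (1 - StripSchrodinger.ids T μ C f E)) :=
    ⟨(StripSchrodinger.continuous_ids_and_ae_tendsto C f hT hm).1,
      StripSchrodinger.hasFiberedRotationNumber_schrodingerCocycle hT hm C f⟩
  exact ⟨h, fun ρ hρ => h.exists_eq_add hρ⟩
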